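/- Let $n \ge 0$ and let $W$ be the Weyl algebra, that is, the vector space $\mathbb{C}[p_1,q_1,\dots,p_n,q_n]$ with the Moyal product $a * b = m\bigl(\exp(\tfrac12 \Pi)(a\otimes b)\bigr)$, where $m$ is the commutative product and $\Pi=\sum_i \bigl(\partial_{p_i}\otimes\partial_{q_i}-\partial_{q_i}\otimes\partial_{p_i}\bigr)$. Let $V=\mathrm{span}(p_i,q_i)\subset W$ and let $\omega$ be the symplectic form on $V$ with $\omega(p_i,q_j)=\delta_{ij}$, $\omega(p_i,p_j)=\omega(q_i,q_j)=0$. Every $s\in Sp(2n)=Sp(V,\omega)$ (over $\mathbb{C}$) extends to an automorphism of $W$, again denoted $s$. For $\sigma\in Sp(2n)$ let $W_\sigma$ be the $W$-bimodule with space $W$, left action $a\cdot b=a*b$ and right action $b\cdot a=b*\sigma(a)$, and let $H^k(W_\sigma)$ be its Hochschild cohomology over $\mathbb{C}$, computed with normalized cochains (multilinear maps $C : W^k\to W$ that vanish when some argument is in $\mathbb{C}$). The restriction $C|_{\Lambda^k}$ of a $k$-cochain to the exterior power $\Lambda^k = \Lambda^k V$ is $$C|_{\Lambda^k}(v_1,\dots,v_k)=\sum_{\tau\in\Sigma_k}\varepsilon(\tau)\,C(v_{\tau(1)},\dots,v_{\tau(k)}),\qquad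 v_i\in V.$$ Let $\sigma\in Sp(2n)$ be diagonalizable, and let $V_\sigma=\mathrm{Range}\bigl((\sigma-\mathrm{Id})|_V\bigr)$. Then $V=V_\sigma\oplus\mathrm{Ker}\bigl((\sigma-\mathrm{Id})|_V\bigr)$ and $\dim V_\sigma$ is even, say $\dim V_\sigma=2k_\sigma$. Let $P_\sigma$ be the projection of $V$ on $V_\sigma$ given by this decomposition, and $$\omega_\sigma(v_1,\dots,v_{2k_\sigma})=\frac1{k_\sigma!}\,\omega^{k_\sigma}(P_\sigma v_1,\dots,P_\sigma v_{2k_\sigma}),$$ where $\omega^{k}=\omega\wedge\dots\wedge\omega$, with $(\alpha\wedge\beta)(v,w)=\alpha(v)\beta(w)-\alpha(w)\beta(v)$ for one-forms. (1) $\dim H^{2k_\sigma}(W_\sigma)=1$, and $H^k(W_\sigma)=\{0\}$ if $k\neq 2k_\sigma$. (2) There is a normalized Hochschild cocycle $\Omega_\sigma\in Z^{2k_\sigma}(W_\sigma)$ such that $\Omega_\sigma|_{\Lambda^{2k_\sigma}}=\omega_\sigma$ and the class of $\Omega_\sigma$ spans $H^{2k_\sigma}(W_\sigma)$. (3) Let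 $S$ be a finite subgroup of $Sp(2n)$ all of whose elements commute with $\sigma$. Let $H^\bullet_S(W_\sigma)$ be the cohomology of the complex of those normalized cochains $C$ with $s\bigl(C(s^{-1}a_1,\dots,s^{-1}a_k)\bigr)=C(a_1,\dots,a_k)$ for all $s\in S$ and $a_i\in W$. Then the natural map $H^k_S(W_\sigma)\to H^k(W_\sigma)$ is bijective for every $k$, and the cocycle $\Omega_\sigma$ of (2) can be chosen $S$-invariant. -/

import Mathlib

open scoped TensorProduct

noncomputable section

namespace HalfExp

variable {E : Type*} [AddCommGroup E] [Module ℂ E]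

theorem finite_support {f : Module.End ℂ E} (hf : ∀ t, ∃ N, ∀ k, N ≤ k → (f ^ k) t = 0) (t : E) :
    (Function.support fun k : ℕ => ((2 : ℂ) ^ k * (k.factorial : ℂ))⁻¹ • (f ^ k) t).Finite := by
  obtain ⟨N, hN⟩ := hf t
  refine (Set.finite_lt_nat N).subset fun k hk => ?_
  by_contra h
  exact hk (by simp [hN k (not_lt.mp h)])

end HalfExp

/-- `exp(f/2) = ∑ₖ fᵏ / (2ᵏ k!)` for a locally nilpotent endomorphism `f`: on every element the
sum is finite. -/
def halfExp {E : Type*} [AddCommGroup E] [Module ℂ E] (f : Module.End ℂ E)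
    (hf : ∀ t, ∃ N, ∀ k, N ≤ k → (f ^ k) t = 0) : Module.End ℂ E where
  toFun t := ∑ᶠ k : ℕ, ((2 : ℂ) ^ k * (k.factorial : ℂ))⁻¹ • (f ^ k) t
  map_add' s t := by
    rw [← finsum_add_distrib (HalfExp.finite_support hf s) (HalfExp.finite_support hf t)]
    simp
  map_smul' c t := by
    rw [RingHom.id_apply, smul_finsum' c (HalfExp.finite_support hf t)]
    simp [smul_comm c]

namespace HalfExp

variable {E : Type*} [AddCommGroup E] [Module ℂ E]

theorem eq_sum {f : Module.End ℂ E} (hf : ∀ t, ∃ N, ∀ k, N ≤ k → (f ^ k) t = 0) (t : E) {N : ℕ}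
    (hN : ∀ k, N ≤ k → (f ^ k) t = 0) :
    halfExp f hf t
      = ∑ k ∈ Finset.range N, ((2 : ℂ) ^ k * (k.factorial : ℂ))⁻¹ • (f ^ k) t := by
  refine finsum_eq_sum_of_support_subset _ fun k hk => ?_
  by_contra h
  exact hk (by simp [hN k (by simpa using h)])

theorem of_eq_zero {f : Module.End ℂ E} (hf : ∀ t, ∃ N, ∀ k, N ≤ k → (f ^ k) t = 0) (t : E)
    (h : f t = 0) : halfExp f hf t = t := by
  rw [eq_sum hf t (N := 1)]
  · simp
  · intro k hk
    obtain ⟨k, rfl⟩ := Nat.exists_eq_add_of_le' hk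
    rw [pow_succ, Module.End.mul_apply, h, map_zero]

theorem commute {f : Module.End ℂ E} (hf : ∀ t, ∃ N, ∀ k, N ≤ k → (f ^ k) t = 0)
    (T : Module.End ℂ E) (hT : f * T = T * f) (t : E) :
    halfExp f hf (T t) = T (halfExp f hf t) := by
  obtain ⟨N, hN⟩ := hf t
  have h : ∀ k : ℕ, (f ^ k) (T t) = T ((f ^ k) t) := fun k =>
    congrArg (fun f => f t) ((show Commute f T from hT).pow_left k).eq
  rw [eq_sum hf t hN, eq_sum hf (N := N)]
  · simp [h]
  · intro k hk
    rw [h, hN k hk, map_zero]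

theorem pow_mul {f X R : Module.End ℂ E} (h1 : f * X = X * f + R) (h2 : f * R = R * f) (k : ℕ) :
    f ^ (k + 1) * X = X * f ^ (k + 1) + ((k : ℂ) + 1) • (f ^ k * R) := by
  induction k with
  | zero => simp [h1]
  | succ k ih =>
    rw [pow_succ', mul_assoc, ih, mul_add, ← mul_assoc, h1, add_mul,
      mul_assoc, ← pow_succ', mul_smul_comm, ← mul_assoc, ← pow_succ',
      ((show Commute f R from h2).pow_left (k + 1)).eq.symm]
    push_cast
    module

theorem apply_mul {f X R : Module.End ℂ E} (hf : ∀ t, ∃ N, ∀ k, N ≤ k → (f ^ k) t = 0)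
    (h1 : f * X = X * f + R) (h2 : f * R = R * f) (t : E) :
    halfExp f hf (X t) = X (halfExp f hf t) + (1 / 2 : ℂ) • halfExp f hf (R t) := by
  have h : ∀ k : ℕ, (f ^ (k + 1)) (X t) = X ((f ^ (k + 1)) t)
      + ((k : ℂ) + 1) • (f ^ k) (R t) := fun k =>
    congrArg (fun f => f t) (pow_mul h1 h2 k)
  obtain ⟨N, hN⟩ := hf t
  obtain ⟨M, hM⟩ := hf (R t)
  rw [eq_sum hf t (N := max N M + 1) (fun k hk => hN k (by omega)),
    eq_sum hf (R t) (N := max N M) (fun k hk => hM k (by omega)),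
    eq_sum hf (X t) (N := max N M + 1)]
  · rw [Finset.sum_range_succ', Finset.sum_range_succ', map_add, map_sum, Finset.smul_sum,
      add_right_comm, ← Finset.sum_add_distrib]
    congr 1
    · refine Finset.sum_congr rfl fun k _ => ?_
      rw [h, smul_add, map_smul, smul_smul, smul_smul]
      congr 2
      have : (k : ℂ) + 1 ≠ 0 := Nat.cast_add_one_ne_zero k
      have : (k.factorial : ℂ) ≠ 0 := by exact_mod_cast k.factorial_ne_zero
      rw [Nat.factorial_succ]
      push_cast
      field_simp
      ring
    · simp
  · intro k hk
    obtain ⟨k, rfl⟩ := Nat.exists_eq_add_of_le' (le_trans (Nat.le_add_left 1 _) hk)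
    rw [h, hN _ (by omega), hM _ (by omega), map_zero, smul_zero, add_zero]

end HalfExp

abbrev WeylPoly (n : ℕ) : Type := MvPolynomial (Fin n ⊕ Fin n) ℂ

namespace WeylPoly
variable {n : ℕ}

/-- The Poisson bidifferential operator
`Π (a ⊗ b) = ∑ᵢ (∂a/∂pᵢ ⊗ ∂b/∂qᵢ - ∂a/∂qᵢ ⊗ ∂b/∂pᵢ)`. -/
def poisson (n : ℕ) : Module.End ℂ (WeylPoly n ⊗[ℂ] WeylPoly n) :=
  ∑ i : Fin n,
    (TensorProduct.map (MvPolynomial.pderiv (Sum.inl i)).toLinearMap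
        (MvPolynomial.pderiv (Sum.inr i)).toLinearMap
      - TensorProduct.map (MvPolynomial.pderiv (Sum.inr i)).toLinearMap
        (MvPolynomial.pderiv (Sum.inl i)).toLinearMap)

/-- The Hamiltonian derivation `{Z, ·}` of a coordinate `Z`. -/
def ham : Fin n ⊕ Fin n → Derivation ℂ (WeylPoly n) (WeylPoly n)
  | Sum.inl i => MvPolynomial.pderiv (Sum.inr i)
  | Sum.inr i => -MvPolynomial.pderiv (Sum.inl i)

theorem pderiv_comm (i j : Fin n ⊕ Fin n) (a : WeylPoly n) :
    MvPolynomial.pderiv i (MvPolynomial.pderiv j a)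
      = MvPolynomial.pderiv j (MvPolynomial.pderiv i a) := by
  have h1 : ⁅MvPolynomial.pderiv (R := ℂ) i, MvPolynomial.pderiv (R := ℂ) j⁆ = 0 := by
    apply MvPolynomial.derivation_ext
    intro k
    simp [Derivation.commutator_apply, MvPolynomial.pderiv_X, Pi.single_apply, apply_ite]
  have h := congrArg (fun D => D a) h1
  simpa [Derivation.commutator_apply, sub_eq_zero] using h

theorem ham_pderiv (i j : Fin n ⊕ Fin n) (a : WeylPoly n) :
    ham j (MvPolynomial.pderiv i a) = MvPolynomial.pderiv i (ham j a) := by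
  rcases j with j | j
  · exact pderiv_comm _ _ _
  · change -(MvPolynomial.pderiv (Sum.inl j) (MvPolynomial.pderiv i a))
      = MvPolynomial.pderiv i (-(MvPolynomial.pderiv (Sum.inl j) a))
    rw [map_neg, pderiv_comm]

theorem poisson_tmul (a b : WeylPoly n) :
    poisson n (a ⊗ₜ b) = ∑ i : Fin n,
      (MvPolynomial.pderiv (Sum.inl i) a ⊗ₜ MvPolynomial.pderiv (Sum.inr i) b
        - MvPolynomial.pderiv (Sum.inr i) a ⊗ₜ[ℂ] MvPolynomial.pderiv (Sum.inl i) b) := by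
  simp [poisson]

def mulX (j : Fin n ⊕ Fin n) : Module.End ℂ (WeylPoly n ⊗[ℂ] WeylPoly n) :=
  TensorProduct.map (LinearMap.mulLeft ℂ (MvPolynomial.X j)) LinearMap.id

def hamL (j : Fin n ⊕ Fin n) : Module.End ℂ (WeylPoly n ⊗[ℂ] WeylPoly n) :=
  TensorProduct.map (ham j).toLinearMap LinearMap.id

def hamR (j : Fin n ⊕ Fin n) : Module.End ℂ (WeylPoly n ⊗[ℂ] WeylPoly n) :=
  TensorProduct.map LinearMap.id (ham j).toLinearMap

theorem mulX_tmul (j : Fin n ⊕ Fin n) (a b : WeylPoly n) :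
    mulX j (a ⊗ₜ b) = (MvPolynomial.X j * a) ⊗ₜ b := rfl

theorem hamL_tmul (j : Fin n ⊕ Fin n) (a b : WeylPoly n) :
    hamL j (a ⊗ₜ b) = (ham j a) ⊗ₜ b := rfl

theorem hamR_tmul (j : Fin n ⊕ Fin n) (a b : WeylPoly n) :
    hamR j (a ⊗ₜ b) = a ⊗ₜ (ham j b) := rfl

theorem poisson_mul_mulX (j : Fin n ⊕ Fin n) :
    poisson n * mulX j = mulX j * poisson n + hamR j := by
  apply TensorProduct.ext'
  intro a b
  simp only [Module.End.mul_apply, LinearMap.add_apply, mulX_tmul, hamR_tmul,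
    poisson_tmul, map_sum, map_sub,
    Derivation.leibniz, MvPolynomial.pderiv_X, smul_eq_mul, TensorProduct.add_tmul]
  rcases j with j | j
  · simp [Pi.single_apply, ham, Finset.sum_add_distrib, Finset.sum_sub_distrib,
      TensorProduct.ite_tmul, mul_ite]
    abel
  · simp [Pi.single_apply, ham, Finset.sum_add_distrib, Finset.sum_sub_distrib,
      TensorProduct.ite_tmul, TensorProduct.tmul_neg, mul_ite]
    abel

theorem poisson_mul_hamR (j : Fin n ⊕ Fin n) : poisson n * hamR j = hamR j * poisson n := by
  apply TensorProduct.ext'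
  intro a b
  simp only [Module.End.mul_apply, hamR_tmul, poisson_tmul, map_sum, map_sub, ham_pderiv]

theorem poisson_mul_hamL (j : Fin n ⊕ Fin n) : poisson n * hamL j = hamL j * poisson n := by
  apply TensorProduct.ext'
  intro a b
  simp only [Module.End.mul_apply, hamL_tmul, poisson_tmul, map_sum, map_sub, ham_pderiv]

theorem poisson_C_tmul (c : ℂ) (b : WeylPoly n) :
    poisson n (MvPolynomial.C c ⊗ₜ b) = 0 := by
  simp [poisson_tmul]

theorem poisson_tmul_C (c : ℂ) (b : WeylPoly n) :
    poisson n (b ⊗ₜ MvPolynomial.C c) = 0 := by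
  simp [poisson_tmul]

theorem poisson_locally_nilpotent (t : WeylPoly n ⊗[ℂ] WeylPoly n) :
    ∃ N, ∀ k, N ≤ k → (poisson n ^ k) t = 0 := by
  have key : ∀ a b : WeylPoly n, ∃ N, ∀ k, N ≤ k → (poisson n ^ k) (a ⊗ₜ b) = 0 := by
    intro a
    induction a using MvPolynomial.induction_on with
    | C c =>
      intro b
      refine ⟨1, fun k hk => ?_⟩
      obtain ⟨k, rfl⟩ := Nat.exists_eq_add_of_le' hk
      rw [pow_succ, Module.End.mul_apply, poisson_C_tmul, map_zero]
    | add p q hp hq =>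
      intro b
      obtain ⟨N, hN⟩ := hp b
      obtain ⟨M, hM⟩ := hq b
      refine ⟨max N M, fun k hk => ?_⟩
      rw [TensorProduct.add_tmul, map_add, hN k (le_trans (le_max_left _ _) hk),
        hM k (le_trans (le_max_right _ _) hk), add_zero]
    | mul_X p j hp =>
      intro b
      obtain ⟨N, hN⟩ := hp b
      obtain ⟨M, hM⟩ := hp (ham j b)
      refine ⟨max N M + 1, fun k hk => ?_⟩
      obtain ⟨k, rfl⟩ := Nat.exists_eq_add_of_le' (le_trans (Nat.le_add_left 1 _) hk)
      have h := congrArg (fun f => f (p ⊗ₜ[ℂ] b))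
        (HalfExp.pow_mul (poisson_mul_mulX j) (poisson_mul_hamR j) k)
      have h1 : max N M ≤ k := by omega
      simp only [Module.End.mul_apply, LinearMap.add_apply, LinearMap.smul_apply, mulX_tmul,
        hamR_tmul] at h
      rw [mul_comm, h, hN (k + 1) (by omega), hM k (by omega), map_zero, smul_zero, add_zero]
  induction t using TensorProduct.induction_on with
  | zero => exact ⟨0, fun k _ => map_zero _⟩
  | tmul a b => exact key a b
  | add x y hx hy =>
    obtain ⟨N, hN⟩ := hx
    obtain ⟨M, hM⟩ := hy
    refine ⟨max N M, fun k hk => ?_⟩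
    rw [map_add, hN k (le_trans (le_max_left _ _) hk), hM k (le_trans (le_max_right _ _) hk),
      add_zero]

/-- The Moyal product `a * b = m (exp (Π/2) (a ⊗ b))`, where `m` is the commutative product of
polynomials. -/
def moyal (n : ℕ) : WeylPoly n →ₗ[ℂ] WeylPoly n →ₗ[ℂ] WeylPoly n :=
  TensorProduct.curry
    (LinearMap.mul' ℂ (WeylPoly n) ∘ₗ halfExp (poisson n) poisson_locally_nilpotent)

theorem moyal_apply (a b : WeylPoly n) : moyal n a b
    = LinearMap.mul' ℂ (WeylPoly n) (halfExp (poisson n) poisson_locally_nilpotent (a ⊗ₜ b)) :=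
  rfl

theorem C_moyal (c : ℂ) (b : WeylPoly n) : moyal n (MvPolynomial.C c) b = c • b := by
  rw [moyal_apply, HalfExp.of_eq_zero _ _ (poisson_C_tmul c b),
    LinearMap.mul'_apply, MvPolynomial.C_mul']

theorem moyal_C (a : WeylPoly n) (c : ℂ) : moyal n a (MvPolynomial.C c) = c • a := by
  rw [moyal_apply, HalfExp.of_eq_zero _ _ (poisson_tmul_C c a),
    LinearMap.mul'_apply, mul_comm, MvPolynomial.C_mul']

theorem mul'_mulX (j : Fin n ⊕ Fin n) (s : WeylPoly n ⊗[ℂ] WeylPoly n) :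
    LinearMap.mul' ℂ (WeylPoly n) (mulX j s)
      = MvPolynomial.X j * LinearMap.mul' ℂ (WeylPoly n) s := by
  induction s using TensorProduct.induction_on with
  | zero => simp only [map_zero, mul_zero]
  | tmul x y => simp only [mulX_tmul, LinearMap.mul'_apply, mul_assoc]
  | add x y hx hy => simp only [map_add, hx, hy, mul_add]

theorem ham_mul' (j : Fin n ⊕ Fin n) (s : WeylPoly n ⊗[ℂ] WeylPoly n) :
    ham j (LinearMap.mul' ℂ (WeylPoly n) s)
      = LinearMap.mul' ℂ (WeylPoly n) (hamL j s) + LinearMap.mul' ℂ (WeylPoly n) (hamR j s) := by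
  induction s using TensorProduct.induction_on with
  | zero => simp only [map_zero, add_zero]
  | tmul x y =>
    simp only [hamL_tmul, hamR_tmul, LinearMap.mul'_apply, Derivation.leibniz, smul_eq_mul]
    ring
  | add x y hx hy => simp only [map_add, hx, hy]; abel

theorem mul_X_moyal (a : WeylPoly n) (j : Fin n ⊕ Fin n) (b : WeylPoly n) :
    moyal n (a * MvPolynomial.X j) b
      = MvPolynomial.X j * moyal n a b + (1 / 2 : ℂ) • moyal n a (ham j b) := by
  have h := congrArg (LinearMap.mul' ℂ (WeylPoly n)) (HalfExp.apply_mul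
    poisson_locally_nilpotent (poisson_mul_mulX j) (poisson_mul_hamR j) (a ⊗ₜ b))
  rw [map_add, map_smul, mul'_mulX, mulX_tmul, hamR_tmul] at h
  rw [mul_comm]
  exact h

theorem ham_moyal (j : Fin n ⊕ Fin n) (a b : WeylPoly n) :
    ham j (moyal n a b) = moyal n (ham j a) b + moyal n a (ham j b) := by
  rw [moyal_apply, ham_mul', ← HalfExp.commute _ _ (poisson_mul_hamL j),
    ← HalfExp.commute _ _ (poisson_mul_hamR j)]
  rfl

theorem moyal_assoc (a b c : WeylPoly n) :
    moyal n (moyal n a b) c = moyal n a (moyal n b c) := by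
  induction a using MvPolynomial.induction_on generalizing b c with
  | C r => simp only [C_moyal, map_smul, LinearMap.smul_apply]
  | add p q hp hq => simp only [hp, hq, map_add, LinearMap.add_apply]
  | mul_X p j hp =>
    rw [mul_X_moyal, mul_X_moyal, map_add, LinearMap.add_apply, mul_comm, mul_X_moyal, hp,
      map_smul, LinearMap.smul_apply, hp, hp, ham_moyal, map_add, smul_add]
    abel


/-- The inclusion of `V = span(pᵢ, qᵢ)` in the polynomials; `V` has coordinates in the basis
`(p₁, …, pₙ, q₁, …, qₙ)`. -/
def lin (n : ℕ) : (Fin n ⊕ Fin n → ℂ) →ₗ[ℂ] WeylPoly n :=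
  ∑ j, (LinearMap.proj j).smulRight (MvPolynomial.X j)

theorem lin_apply (v : Fin n ⊕ Fin n → ℂ) : lin n v = ∑ j, v j • MvPolynomial.X j := by
  simp [lin]

/-- The automorphism of the polynomial algebra that extends a linear map of `V`. -/
def subst (M : Matrix (Fin n ⊕ Fin n) (Fin n ⊕ Fin n) ℂ) : WeylPoly n →ₐ[ℂ] WeylPoly n :=
  MvPolynomial.aeval fun j => lin n fun i => M i j

theorem subst_X (M : Matrix (Fin n ⊕ Fin n) (Fin n ⊕ Fin n) ℂ) (j : Fin n ⊕ Fin n) :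
    subst M (MvPolynomial.X j) = ∑ i, M i j • MvPolynomial.X i := by
  rw [subst, MvPolynomial.aeval_X, lin_apply]

theorem subst_lin (M : Matrix (Fin n ⊕ Fin n) (Fin n ⊕ Fin n) ℂ) (v : Fin n ⊕ Fin n → ℂ) :
    subst M (lin n v) = lin n (M.mulVec v) := by
  simp only [lin_apply, map_sum, map_smul, subst_X, Matrix.mulVec, dotProduct, Finset.smul_sum,
    Finset.sum_smul, smul_smul]
  rw [Finset.sum_comm]
  simp only [mul_comm]

theorem subst_mul (M N : Matrix (Fin n ⊕ Fin n) (Fin n ⊕ Fin n) ℂ) (a : WeylPoly n) :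
    subst (M * N) a = subst M (subst N a) := by
  have h : subst (M * N) = (subst M).comp (subst N) := by
    apply MvPolynomial.algHom_ext
    intro j
    have h1 : ∀ K : Matrix (Fin n ⊕ Fin n) (Fin n ⊕ Fin n) ℂ,
        subst K (MvPolynomial.X j) = lin n fun i => K i j := fun K => MvPolynomial.aeval_X _ _
    rw [AlgHom.comp_apply, h1, h1, subst_lin]
    rfl
  rw [h]
  rfl

theorem subst_one (a : WeylPoly n) : subst 1 a = a := by
  have h : subst (1 : Matrix (Fin n ⊕ Fin n) (Fin n ⊕ Fin n) ℂ) = AlgHom.id ℂ _ := by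
    apply MvPolynomial.algHom_ext
    intro j
    simp [subst_X, Matrix.one_apply]
  rw [h]
  rfl

theorem ham_X (i j : Fin n ⊕ Fin n) :
    ham i (MvPolynomial.X j) = MvPolynomial.C (-Matrix.J (Fin n) ℂ i j) := by
  rcases i with i | i <;> rcases j with j | j <;>
  simp [ham, Matrix.J, MvPolynomial.pderiv_X, Pi.single_apply, Matrix.one_apply, eq_comm,
    apply_ite]

theorem ham_subst (M : Matrix.symplecticGroup (Fin n) ℂ) (j : Fin n ⊕ Fin n) (b : WeylPoly n) :
    ∑ i, M.1 i j • ham i (subst M.1 b) = subst M.1 (ham j b) := by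
  induction b using MvPolynomial.induction_on with
  | C r => simp [← MvPolynomial.algebraMap_eq]
  | add p q hp hq => simp only [map_add, smul_add, Finset.sum_add_distrib, hp, hq]
  | mul_X p l hp =>
    have h : ∑ i, M.1 i j • ham i (subst M.1 (MvPolynomial.X l))
        = subst M.1 (ham j (MvPolynomial.X l)) := by
      have h1 := congrFun (congrFun (SymplecticGroup.mem_iff'.mp M.2) j) l
      rw [ham_X, ← MvPolynomial.algebraMap_eq, AlgHom.commutes, ← h1]
      have h2 : ∀ i, ham i (subst M.1 (MvPolynomial.X l))
          = ∑ m, MvPolynomial.C (-(M.1 m l * Matrix.J (Fin n) ℂ i m)) := by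
        intro i
        rw [subst_X, map_sum]
        refine Finset.sum_congr rfl fun m _ => ?_
        rw [Derivation.map_smul, ham_X, MvPolynomial.smul_eq_C_mul, ← map_mul, mul_neg]
      simp only [h2, Finset.smul_sum, MvPolynomial.smul_eq_C_mul, ← map_mul]
      rw [Finset.sum_comm, MvPolynomial.algebraMap_eq, Matrix.mul_apply, ← Finset.sum_neg_distrib,
        map_sum]
      refine Finset.sum_congr rfl fun m _ => ?_
      rw [Matrix.mul_apply, Finset.sum_mul, ← Finset.sum_neg_distrib, map_sum]
      refine Finset.sum_congr rfl fun i _ => congrArg MvPolynomial.C ?_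
      rw [Matrix.transpose_apply]
      ring
    rw [Derivation.leibniz, map_add, map_mul, smul_eq_mul, smul_eq_mul, map_mul, map_mul, ← h,
      ← hp, Finset.mul_sum, Finset.mul_sum, ← Finset.sum_add_distrib]
    refine Finset.sum_congr rfl fun i _ => ?_
    rw [Derivation.leibniz, smul_eq_mul, smul_eq_mul, smul_add, mul_smul_comm, mul_smul_comm]

theorem subst_moyal (M : Matrix.symplecticGroup (Fin n) ℂ) (a b : WeylPoly n) :
    subst M.1 (moyal n a b) = moyal n (subst M.1 a) (subst M.1 b) := by
  induction a using MvPolynomial.induction_on generalizing b with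
  | C r =>
    rw [C_moyal, map_smul, ← MvPolynomial.algebraMap_eq, AlgHom.commutes,
      MvPolynomial.algebraMap_eq, C_moyal]
  | add p q hp hq => simp only [map_add, LinearMap.add_apply, hp, hq]
  | mul_X p j hp =>
    rw [mul_X_moyal, map_add, map_mul, map_smul, hp, hp, map_mul, subst_X, Finset.mul_sum,
      map_sum, LinearMap.sum_apply, ← ham_subst, map_sum, Finset.smul_sum, Finset.sum_mul,
      ← Finset.sum_add_distrib]
    refine Finset.sum_congr rfl fun i _ => ?_
    have h1 := mul_X_moyal (subst M.1 p) i (subst M.1 b)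
    have h2 : moyal n (subst M.1 p * M.1 i j • MvPolynomial.X i) (subst M.1 b)
        = M.1 i j • moyal n (subst M.1 p * MvPolynomial.X i) (subst M.1 b) := by
      rw [← LinearMap.map_smul₂, mul_smul_comm]
    rw [h2, h1, smul_add, smul_mul_assoc, map_smul, smul_comm (1 / 2 : ℂ)]

end WeylPoly

/-- The Weyl algebra: the space of polynomials in `pᵢ = X (inl i)`, `qᵢ = X (inr i)`, with the
Moyal product. -/
def WeylAlgebra (n : ℕ) : Type := WeylPoly n

namespace WeylAlgebra

variable {n : ℕ}

instance : AddCommGroup (WeylAlgebra n) := inferInstanceAs (AddCommGroup (WeylPoly n))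

instance : Module ℂ (WeylAlgebra n) := inferInstanceAs (Module ℂ (WeylPoly n))

/-- The identity map from polynomials to the Weyl algebra. -/
def ofPoly (n : ℕ) : WeylPoly n ≃ₗ[ℂ] WeylAlgebra n := LinearEquiv.refl ℂ (WeylPoly n)

instance : Ring (WeylAlgebra n) :=
  { (inferInstance : AddCommGroup (WeylAlgebra n)) with
    mul := fun a b => ofPoly n (WeylPoly.moyal n ((ofPoly n).symm a) ((ofPoly n).symm b))
    one := ofPoly n 1
    mul_assoc := fun a b c => WeylPoly.moyal_assoc (n := n) a b c
    one_mul := fun a => (WeylPoly.C_moyal (n := n) 1 a).trans (one_smul ℂ a)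
    mul_one := fun a => (WeylPoly.moyal_C (n := n) a 1).trans (one_smul ℂ a)
    left_distrib := fun a b c => map_add (WeylPoly.moyal n a) b c
    right_distrib := fun a b c => LinearMap.map_add₂ (WeylPoly.moyal n) a b c
    zero_mul := fun a => LinearMap.map_zero₂ (WeylPoly.moyal n) a
    mul_zero := fun a => map_zero (WeylPoly.moyal n a) }

theorem ofPoly_moyal (a b : WeylPoly n) :
    ofPoly n (WeylPoly.moyal n a b) = ofPoly n a * ofPoly n b := rfl

instance : Algebra ℂ (WeylAlgebra n) :=
  Algebra.ofModule (fun c a b => LinearMap.map_smul₂ (WeylPoly.moyal n) c a b)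
    (fun c a b => map_smul (WeylPoly.moyal n a) c b)

/-- The inclusion of `V` in the Weyl algebra. -/
def ofVec (n : ℕ) : (Fin n ⊕ Fin n → ℂ) →ₗ[ℂ] WeylAlgebra n :=
  (ofPoly n).toLinearMap ∘ₗ WeylPoly.lin n

/-- The algebra endomorphism of the Weyl algebra that extends a symplectic map of `V`. -/
def actHom (s : Matrix.symplecticGroup (Fin n) ℂ) : WeylAlgebra n →ₐ[ℂ] WeylAlgebra n :=
  AlgHom.ofLinearMap
    ((ofPoly n).toLinearMap ∘ₗ (WeylPoly.subst s.1).toLinearMap ∘ₗ (ofPoly n).symm.toLinearMap)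
    (map_one (WeylPoly.subst s.1)) (fun a b => WeylPoly.subst_moyal (n := n) s a b)

theorem actHom_mul (s t : Matrix.symplecticGroup (Fin n) ℂ) (a : WeylAlgebra n) :
    actHom (s * t) a = actHom s (actHom t a) :=
  WeylPoly.subst_mul (n := n) s.1 t.1 a

theorem actHom_one (a : WeylAlgebra n) : actHom 1 a = a := WeylPoly.subst_one (n := n) a

/-- The automorphism of the Weyl algebra that extends a symplectic map of `V`. -/
def act (s : Matrix.symplecticGroup (Fin n) ℂ) : WeylAlgebra n ≃ₐ[ℂ] WeylAlgebra n :=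
  AlgEquiv.ofAlgHom (actHom s) (actHom s⁻¹)
    (AlgHom.ext fun a => by
      rw [AlgHom.comp_apply, ← actHom_mul, mul_inv_cancel, actHom_one, AlgHom.id_apply])
    (AlgHom.ext fun a => by
      rw [AlgHom.comp_apply, ← actHom_mul, inv_mul_cancel, actHom_one, AlgHom.id_apply])

end WeylAlgebra

/-- The bimodule `A_φ` : the space `A`, with left action `a • b = a * b` and right action
`b • a = b * φ a`. -/
def TwistedBimodule {𝕜 A : Type*} [CommRing 𝕜] [Ring A] [Algebra 𝕜 A] (_φ : A ≃ₐ[𝕜] A) : Type _ :=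
  A

namespace TwistedBimodule

variable {𝕜 A : Type*} [CommRing 𝕜] [Ring A] [Algebra 𝕜 A] (φ : A ≃ₐ[𝕜] A)

instance : AddCommGroup (TwistedBimodule φ) := inferInstanceAs (AddCommGroup A)

instance : Module 𝕜 (TwistedBimodule φ) := inferInstanceAs (Module 𝕜 A)

instance : Module A (TwistedBimodule φ) := inferInstanceAs (Module A A)

instance : Module Aᵐᵒᵖ (TwistedBimodule φ) :=
  Module.compHom A (RingHom.op (φ : A →+* A))

/-- The identity map from `A` to the space of the bimodule. -/
def of : A ≃ₗ[𝕜] TwistedBimodule φ := LinearEquiv.refl 𝕜 A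

theorem smul_of (a b : A) : a • of φ b = of φ (a * b) := rfl

theorem op_smul_of (a b : A) : MulOpposite.op a • of φ b = of φ (b * φ a) := rfl

instance : IsScalarTower 𝕜 A (TwistedBimodule φ) := inferInstanceAs (IsScalarTower 𝕜 A A)

instance : IsScalarTower 𝕜 Aᵐᵒᵖ (TwistedBimodule φ) where
  smul_assoc c a b := by
    obtain ⟨b, rfl⟩ := (of φ).surjective b
    change of φ (b * φ (c • a.unop)) = c • of φ (b * φ a.unop)
    rw [map_smul, mul_smul_comm, map_smul]

instance : SMulCommClass A Aᵐᵒᵖ (TwistedBimodule φ) where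
  smul_comm a b m := (mul_assoc a ((of φ).symm m) (φ b.unop)).symm

end TwistedBimodule

namespace Hochschild

section

variable {𝕜 A M : Type*} [CommRing 𝕜] [Ring A] [Algebra 𝕜 A] [AddCommGroup M] [Module 𝕜 M]
  [Module A M] [Module Aᵐᵒᵖ M] [IsScalarTower 𝕜 A M] [IsScalarTower 𝕜 Aᵐᵒᵖ M]

/-- `(a₀, …, aₖ) ↦ a₀ • f (a₁, …, aₖ)` -/
def leftTerm {k : ℕ} (f : MultilinearMap 𝕜 (fun _ : Fin k => A) M) :
    MultilinearMap 𝕜 (fun _ : Fin (k + 1) => A) M where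
  toFun a := a 0 • f (Fin.tail a)
  map_update_add' {inst} a i x y := by
    rw [Subsingleton.elim inst (instDecidableEqFin (k + 1))]
    refine Fin.cases ?_ (fun i => ?_) i
    · simp [Fin.tail_update_zero, add_smul]
    · simp [Fin.tail_update_succ, (Fin.succ_ne_zero _).symm]
  map_update_smul' {inst} a i c x := by
    rw [Subsingleton.elim inst (instDecidableEqFin (k + 1))]
    refine Fin.cases ?_ (fun i => ?_) i
    · simp [Fin.tail_update_zero]
    · simp [Fin.tail_update_succ, (Fin.succ_ne_zero _).symm, smul_comm (a 0) c]

/-- `(a₀, …, aₖ) ↦ f (a₀, …, aₖ₋₁) • aₖ` -/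
def rightTerm {k : ℕ} (f : MultilinearMap 𝕜 (fun _ : Fin k => A) M) :
    MultilinearMap 𝕜 (fun _ : Fin (k + 1) => A) M where
  toFun a := MulOpposite.op (a (Fin.last k)) • f (Fin.init a)
  map_update_add' {inst} a i x y := by
    rw [Subsingleton.elim inst (instDecidableEqFin (k + 1))]
    refine Fin.lastCases ?_ (fun i => ?_) i
    · simp [Fin.init_update_last, add_smul]
    · simp [Fin.init_update_castSucc, (Fin.castSucc_lt_last _).ne']
  map_update_smul' {inst} a i c x := by
    rw [Subsingleton.elim inst (instDecidableEqFin (k + 1))]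
    refine Fin.lastCases ?_ (fun i => ?_) i
    · simp [Fin.init_update_last]
    · simp [Fin.init_update_castSucc, (Fin.castSucc_lt_last _).ne',
        smul_comm (MulOpposite.op (a (Fin.last k))) c]

theorem contractNth_update {k : ℕ} (i : Fin k) (a : Fin (k + 1) → A) (m : Fin (k + 1)) :
    ∃ (j : Fin k) (L : A →ₗ[𝕜] A), ∀ x : A,
      Fin.contractNth i.castSucc (· * ·) (Function.update a m x)
        = Function.update (Fin.contractNth i.castSucc (· * ·) a) j (L x) := by
  rcases lt_trichotomy (m : ℕ) (i : ℕ) with h | h | h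
  · refine ⟨⟨m, by omega⟩, LinearMap.id, fun x => ?_⟩
    ext l
    simp only [Fin.contractNth, Function.update_apply, Fin.ext_iff, Fin.val_castSucc, Fin.val_succ,
      LinearMap.id_apply]
    grind
  · refine ⟨i, LinearMap.mulRight 𝕜 (a i.succ), fun x => ?_⟩
    ext l
    simp only [Fin.contractNth, Function.update_apply, Fin.ext_iff, Fin.val_castSucc, Fin.val_succ,
      LinearMap.mulRight_apply]
    grind
  · rcases Nat.lt_or_ge ((i : ℕ) + 1) m with h' | h'
    · refine ⟨⟨m - 1, by omega⟩, LinearMap.id, fun x => ?_⟩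
      ext l
      simp only [Fin.contractNth, Function.update_apply, Fin.ext_iff, Fin.val_castSucc,
        Fin.val_succ, LinearMap.id_apply]
      grind
    · refine ⟨i, LinearMap.mulLeft 𝕜 (a i.castSucc), fun x => ?_⟩
      ext l
      simp only [Fin.contractNth, Function.update_apply, Fin.ext_iff, Fin.val_castSucc,
        Fin.val_succ, LinearMap.mulLeft_apply]
      grind

/-- `(a₀, …, aₖ) ↦ f (a₀, …, aᵢ * aᵢ₊₁, …, aₖ)` -/
def innerTerm {k : ℕ} (f : MultilinearMap 𝕜 (fun _ : Fin k => A) M) (i : Fin k) :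
    MultilinearMap 𝕜 (fun _ : Fin (k + 1) => A) M where
  toFun a := f (Fin.contractNth i.castSucc (· * ·) a)
  map_update_add' {inst} a m x y := by
    rw [Subsingleton.elim inst (instDecidableEqFin (k + 1))]
    obtain ⟨j, L, h⟩ := contractNth_update (𝕜 := 𝕜) i a m
    rw [h, h, h, map_add, f.map_update_add]
  map_update_smul' {inst} a m c x := by
    rw [Subsingleton.elim inst (instDecidableEqFin (k + 1))]
    obtain ⟨j, L, h⟩ := contractNth_update (𝕜 := 𝕜) i a m
    rw [h, h, map_smul, f.map_update_smul]

variable (𝕜 A M) in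
/-- The Hochschild differential. -/
def d (k : ℕ) : MultilinearMap 𝕜 (fun _ : Fin k => A) M →ₗ[𝕜]
    MultilinearMap 𝕜 (fun _ : Fin (k + 1) => A) M where
  toFun f := leftTerm f + ∑ i : Fin k, (-1 : 𝕜) ^ ((i : ℕ) + 1) • innerTerm f i
    + (-1 : 𝕜) ^ (k + 1) • rightTerm f
  map_add' f g := by
    have h1 : leftTerm (f + g) = leftTerm f + leftTerm g := by ext; simp [leftTerm]
    have h2 : rightTerm (f + g) = rightTerm f + rightTerm g := by ext; simp [rightTerm]
    have h3 : ∀ i, innerTerm (f + g) i = innerTerm f i + innerTerm g i := fun i => rfl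
    simp only [h1, h2, h3, smul_add, Finset.sum_add_distrib]
    abel
  map_smul' c f := by
    have h1 : leftTerm (c • f) = c • leftTerm f := by
      ext a; simp [leftTerm, smul_comm (a 0) c]
    have h2 : rightTerm (c • f) = c • rightTerm f := by
      ext a; simp [rightTerm, smul_comm (MulOpposite.op (a (Fin.last k))) c]
    have h3 : ∀ i, innerTerm (c • f) i = c • innerTerm f i := fun i => rfl
    simp only [h1, h2, h3, smul_add, Finset.smul_sum, RingHom.id_apply, smul_comm c]


/-- A cochain is normalized if it vanishes as soon as one argument is a scalar. -/
def normalized (𝕜 A M : Type*) [CommRing 𝕜] [Ring A] [Algebra 𝕜 A] [AddCommGroup M] [Module 𝕜 M]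
    (k : ℕ) : Submodule 𝕜 (MultilinearMap 𝕜 (fun _ : Fin k => A) M) where
  carrier := {f | ∀ a : Fin k → A, (∃ i, a i ∈ Set.range (algebraMap 𝕜 A)) → f a = 0}
  add_mem' hf hg a ha := by rw [add_apply, hf a ha, hg a ha, add_zero]
  zero_mem' _ _ := rfl
  smul_mem' c f hf a ha := by rw [smul_apply, hf a ha, smul_zero]

/-- The cocycles of a family `C` of spaces of cochains. -/
def cocycles (C : ∀ k, Submodule 𝕜 (MultilinearMap 𝕜 (fun _ : Fin k => A) M)) (k : ℕ) :
    Submodule 𝕜 (MultilinearMap 𝕜 (fun _ : Fin k => A) M) :=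
  C k ⊓ LinearMap.ker (d 𝕜 A M k)

/-- The coboundaries of a family `C` of spaces of cochains. -/
def coboundaries (C : ∀ k, Submodule 𝕜 (MultilinearMap 𝕜 (fun _ : Fin k => A) M)) :
    ∀ k, Submodule 𝕜 (MultilinearMap 𝕜 (fun _ : Fin k => A) M)
  | 0 => ⊥
  | k + 1 => (C k).map (d 𝕜 A M k)

/-- Cocycles modulo coboundaries. -/
abbrev Cohomology (C : ∀ k, Submodule 𝕜 (MultilinearMap 𝕜 (fun _ : Fin k => A) M)) (k : ℕ) :
    Type _ :=
  cocycles C k ⧸ (coboundaries C k).submoduleOf (cocycles C k)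

/-- The class of a cocycle. -/
abbrev cls (C : ∀ k, Submodule 𝕜 (MultilinearMap 𝕜 (fun _ : Fin k => A) M)) (k : ℕ) :
    cocycles C k →ₗ[𝕜] Cohomology C k :=
  ((coboundaries C k).submoduleOf (cocycles C k)).mkQ

theorem coboundaries_mono {C D : ∀ k, Submodule 𝕜 (MultilinearMap 𝕜 (fun _ : Fin k => A) M)}
    (h : ∀ k, C k ≤ D k) : ∀ k, coboundaries C k ≤ coboundaries D k
  | 0 => le_rfl
  | k + 1 => Submodule.map_mono (h k)

/-- The map in cohomology induced by the inclusion of a smaller family of cochains. -/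
def cohomologyMap {C D : ∀ k, Submodule 𝕜 (MultilinearMap 𝕜 (fun _ : Fin k => A) M)}
    (h : ∀ k, C k ≤ D k) (k : ℕ) : Cohomology C k →ₗ[𝕜] Cohomology D k :=
  Submodule.mapQ _ _ (Submodule.inclusion (inf_le_inf_right _ (h k))) fun _ hx =>
    coboundaries_mono h k hx

end

end Hochschild

namespace SymplecticMap

variable {n : ℕ}

/-- The action of a symplectic matrix on `V`. -/
def toEnd (σ : Matrix.symplecticGroup (Fin n) ℂ) : Module.End ℂ (Fin n ⊕ Fin n → ℂ) :=
  Matrix.toLin' σ.1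

/-- There is a basis of eigenvectors. -/
def IsDiagonalizable (σ : Matrix.symplecticGroup (Fin n) ℂ) : Prop :=
  ∃ b : Module.Basis (Fin n ⊕ Fin n) ℂ (Fin n ⊕ Fin n → ℂ), ∀ i, ∃ c : ℂ, toEnd σ (b i) = c • b i

/-- `V_σ = Range (σ - Id)`. -/
def movedSpace (σ : Matrix.symplecticGroup (Fin n) ℂ) : Submodule ℂ (Fin n ⊕ Fin n → ℂ) :=
  LinearMap.range (toEnd σ - 1)

/-- `Ker (σ - Id)`. -/
def fixedSpace (σ : Matrix.symplecticGroup (Fin n) ℂ) : Submodule ℂ (Fin n ⊕ Fin n → ℂ) :=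
  LinearMap.ker (toEnd σ - 1)

/-- `k_σ`, half the dimension of `V_σ`. -/
def halfDim (σ : Matrix.symplecticGroup (Fin n) ℂ) : ℕ :=
  Module.finrank ℂ (movedSpace σ) / 2

theorem isCompl {σ : Matrix.symplecticGroup (Fin n) ℂ} (hσ : IsDiagonalizable σ) :
    IsCompl (movedSpace σ) (fixedSpace σ) := by
  obtain ⟨b, hb⟩ := hσ
  have htop : movedSpace σ ⊔ fixedSpace σ = ⊤ := by
    rw [eq_top_iff, ← b.span_eq, Submodule.span_le]
    rintro _ ⟨i, rfl⟩
    obtain ⟨c, hc⟩ := hb i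
    by_cases h : c = 1
    · refine Submodule.mem_sup_right ?_
      simp [fixedSpace, hc, h]
    · refine Submodule.mem_sup_left ⟨(c - 1)⁻¹ • b i, ?_⟩
      have h' : c - 1 ≠ 0 := sub_ne_zero.mpr h
      rw [map_smul, LinearMap.sub_apply, hc, Module.End.one_apply]
      rw [show c • b i - b i = (c - 1) • b i by rw [sub_smul, one_smul], smul_smul,
        inv_mul_cancel₀ h', one_smul]
  refine ⟨?_, codisjoint_iff.mpr htop⟩
  have h1 := Submodule.finrank_sup_add_finrank_inf_eq (movedSpace σ) (fixedSpace σ)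
  have h2 := LinearMap.finrank_range_add_finrank_ker (toEnd σ - 1)
  rw [htop, finrank_top] at h1
  rw [disjoint_iff, ← Submodule.finrank_eq_zero (R := ℂ)]
  unfold movedSpace fixedSpace at *
  omega

/-- The canonical two-form, with `ω (pᵢ, qᵢ) = 1`. -/
def omega (v w : Fin n ⊕ Fin n → ℂ) : ℂ :=
  ∑ i : Fin n, (v (Sum.inl i) * w (Sum.inr i) - v (Sum.inr i) * w (Sum.inl i))

/-- The exterior power `ω ∧ ⋯ ∧ ω` (`k` factors) of the canonical two-form. -/
def omegaPow (k : ℕ) (v : Fin (2 * k) → Fin n ⊕ Fin n → ℂ) : ℂ :=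
  ((2 : ℂ) ^ k)⁻¹ * ∑ τ : Equiv.Perm (Fin (2 * k)), ((Equiv.Perm.sign τ : ℤ) : ℂ) *
    ∏ i : Fin k, omega (v (τ ⟨2 * i, by omega⟩)) (v (τ ⟨2 * i + 1, by omega⟩))

/-- `ω_σ (v₁, …, v_{2k}) = (1 / k!) ω^k (P v₁, …, P v_{2k})`, where `k = k_σ` and `P` is the
projection on `V_σ` along `Ker (σ - Id)`. -/
def volumeForm (σ : Matrix.symplecticGroup (Fin n) ℂ) (hσ : IsDiagonalizable σ)
    (v : Fin (2 * halfDim σ) → Fin n ⊕ Fin n → ℂ) : ℂ :=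
  ((halfDim σ).factorial : ℂ)⁻¹ *
    omegaPow (halfDim σ) fun i => (movedSpace σ).projection (fixedSpace σ) (isCompl hσ) (v i)

end SymplecticMap

namespace WeylAlgebra

variable {n : ℕ}

/-- The twisted bimodule `W_σ`. -/
abbrev Twisted (σ : Matrix.symplecticGroup (Fin n) ℂ) : Type := TwistedBimodule (act σ)

/-- The normalized Hochschild cochains of `W_σ`. -/
abbrev cochains (σ : Matrix.symplecticGroup (Fin n) ℂ) (k : ℕ) :
    Submodule ℂ (MultilinearMap ℂ (fun _ : Fin k => WeylAlgebra n) (Twisted σ)) :=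
  Hochschild.normalized ℂ (WeylAlgebra n) (Twisted σ) k

/-- The `S`-invariant normalized Hochschild cochains of `W_σ`, for the action
`(π_s C) (a₁, …, aₖ) = s (C (s⁻¹ a₁, …, s⁻¹ aₖ))`. -/
def invariantCochains (σ : Matrix.symplecticGroup (Fin n) ℂ)
    (S : Subgroup (Matrix.symplecticGroup (Fin n) ℂ)) (k : ℕ) :
    Submodule ℂ (MultilinearMap ℂ (fun _ : Fin k => WeylAlgebra n) (Twisted σ)) where
  carrier := {f | f ∈ cochains σ k ∧ ∀ s ∈ S, ∀ a : Fin k → WeylAlgebra n,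
    act s ((TwistedBimodule.of (act σ)).symm (f fun i => act s⁻¹ (a i)))
      = (TwistedBimodule.of (act σ)).symm (f a)}
  add_mem' hf hg := ⟨add_mem hf.1 hg.1, fun s hs a => by
    rw [add_apply, add_apply, map_add, map_add, map_add,
      hf.2 s hs a, hg.2 s hs a]⟩
  zero_mem' := ⟨zero_mem _, fun s hs a => by
    rw [zero_apply, zero_apply, map_zero, map_zero]⟩
  smul_mem' c f hf := ⟨Submodule.smul_mem _ c hf.1, fun s hs a => by
    rw [smul_apply, smul_apply, map_smul, map_smul, map_smul,
      hf.2 s hs a]⟩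

theorem invariantCochains_le (σ : Matrix.symplecticGroup (Fin n) ℂ)
    (S : Subgroup (Matrix.symplecticGroup (Fin n) ℂ)) (k : ℕ) :
    invariantCochains σ S k ≤ cochains σ k := fun _ hf => hf.1

/-- The restriction of a cochain to `Λᵏ`, where `v₁ ∧ ⋯ ∧ vₖ` is identified with
`∑ sign τ • v_{τ 1} ⊗ ⋯ ⊗ v_{τ k}`. -/
def restrict (σ : Matrix.symplecticGroup (Fin n) ℂ) {k : ℕ}
    (f : MultilinearMap ℂ (fun _ : Fin k => WeylAlgebra n) (Twisted σ))
    (v : Fin k → Fin n ⊕ Fin n → ℂ) : WeylAlgebra n :=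
  ∑ τ : Equiv.Perm (Fin k), ((Equiv.Perm.sign τ : ℤ) : ℂ) •
    (TwistedBimodule.of (act σ)).symm (f fun i => ofVec n (v (τ i)))

end WeylAlgebra

end

/-!
The proof computes `H(W_σ)` by adjoining one symplectic eigenvector of `σ` at a time.

*Coordinates.* A diagonalizable symplectic map has a basis of eigenvectors that is also a Darboux
basis (`SymplecticMap.exists_eigenbasis`): the columns of a symplectic matrix `g`, with eigenvalues
`c l` that satisfy `c l * c l.swap = 1`.

*A resolution.* The bimodule `W_σ` sits in the coinduced bimodule `Hom(W, W_σ)`, whose Hochschild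
cohomology is `W` in degree zero and vanishes in the other degrees. The image of `W_σ` consists of
the linear maps that commute with the left multiplication by every vector. The commutators with the
left multiplications by the columns of `g` are commuting bimodule maps with explicit right inverses
that commute with the other commutators (`WeylAlgebra.coindKoszul`), since an involution of
`Hom(W, W)` conjugates them with the duals of the multiplications by the coordinates. So the kernels
of more and more of these operators are linked by short exact sequences, and the long exact
sequences (`SplitKoszul.Computes.of_surjective`, `SplitKoszul.Computes.of_injective`) reduce the
cohomology of `W_σ` to that of the operators `P ↦ X l * P - c l • (P * X l)` induced on `W`
(`WeylPoly.twistComm`). If `c l = 1` this operator is the derivation `{X l, ·}`, which is onto, and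
the cohomology stays in its degree. If `c l ≠ 1` it is injective, its cokernel is the space of
polynomials without the variable `X l`, and the degree goes up by one. What remains at the end is
one class in degree `dim V_σ`.

*The restriction.* The right inverses take their values at vectors from the coordinate functions
of the basis `g`, so the generating cocycle is, at vectors, the product of the coordinates along
`V_σ` (`WeylAlgebra.exists_generator`). Its antisymmetrization is a determinant, which is a nonzero
multiple of `ω_σ` because the top exterior power of `V_σ` is a line and the symplectic form is
nondegenerate there (`SymplecticMap.volumeForm_eq_det`).

*Detection.* The antisymmetrization of a coboundary at moved eigenvectors is a sum of values of the
operators `WeylPoly.twistComm` (`Hochschild.sum_sign_smul_d`), and such a sum is never `1`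
(`WeylPoly.one_ne_sum_twistComm`). So every cocycle that restricts to `ω_σ` is a generator.

*Invariance.* Maps that commute with `σ` act on the complex and preserve `ω_σ`. Averaging over `S`
is a projection of complexes on the invariant cochains, and gives an invariant generator.
-/

open scoped TensorProduct

noncomputable section

/-! ### Hochschild cochains: functoriality and currying -/

namespace Hochschild

section

variable {𝕜 A M M' : Type*} [CommRing 𝕜] [Ring A] [Algebra 𝕜 A] [AddCommGroup M] [Module 𝕜 M]
  [AddCommGroup M'] [Module 𝕜 M']

theorem comp_mem_normalized (β : M →ₗ[𝕜] M') {k : ℕ}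
    {f : MultilinearMap 𝕜 (fun _ : Fin k => A) M} (hf : f ∈ normalized 𝕜 A M k) :
    β.compMultilinearMap f ∈ normalized 𝕜 A M' k := fun a ha => by
  rw [LinearMap.compMultilinearMap_apply, hf a ha, map_zero]

end

section functoriality

variable {𝕜 A M M' : Type*} [CommRing 𝕜] [Ring A] [Algebra 𝕜 A]
  [AddCommGroup M] [Module 𝕜 M] [Module A M] [Module Aᵐᵒᵖ M] [IsScalarTower 𝕜 A M]
  [IsScalarTower 𝕜 Aᵐᵒᵖ M]
  [AddCommGroup M'] [Module 𝕜 M'] [Module A M'] [Module Aᵐᵒᵖ M'] [IsScalarTower 𝕜 A M']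
  [IsScalarTower 𝕜 Aᵐᵒᵖ M']

theorem d_apply {k : ℕ} (f : MultilinearMap 𝕜 (fun _ : Fin k => A) M) (a : Fin (k + 1) → A) :
    d 𝕜 A M k f a = a 0 • f (Fin.tail a)
      + ∑ i : Fin k, (-1 : 𝕜) ^ ((i : ℕ) + 1) • f (Fin.contractNth i.castSucc (· * ·) a)
      + (-1 : 𝕜) ^ (k + 1) • (MulOpposite.op (a (Fin.last k)) • f (Fin.init a)) := by
  simp only [d, LinearMap.coe_mk, AddHom.coe_mk, add_apply, sum_apply,
    smul_apply]
  rfl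

/-- The Hochschild differential is natural for a map `β` of bimodules that is semilinear over an
algebra map `α`. -/
theorem d_natural (α : A →ₐ[𝕜] A) (β : M →ₗ[𝕜] M')
    (hl : ∀ a m, β (α a • m) = a • β m)
    (hr : ∀ a m, β (MulOpposite.op (α a) • m) = MulOpposite.op a • β m)
    {k : ℕ} (f : MultilinearMap 𝕜 (fun _ : Fin k => A) M) :
    d 𝕜 A M' k (β.compMultilinearMap (f.compLinearMap fun _ => α.toLinearMap))
      = β.compMultilinearMap ((d 𝕜 A M k f).compLinearMap fun _ => α.toLinearMap) := by
  ext a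
  simp only [d_apply, LinearMap.compMultilinearMap_apply, MultilinearMap.compLinearMap_apply,
    map_add, map_sum, map_smul, AlgHom.toLinearMap_apply, hl, hr]
  congr 2
  refine Finset.sum_congr rfl fun i _ => ?_
  congr 3
  ext j
  simp only [Fin.contractNth]
  split_ifs <;> simp

/-- Composition with a bimodule map commutes with the Hochschild differential. -/
theorem d_comp (β : M →ₗ[𝕜] M') (hl : ∀ (a : A) m, β (a • m) = a • β m)
    (hr : ∀ (a : A) m, β (MulOpposite.op a • m) = MulOpposite.op a • β m)
    {k : ℕ} (f : MultilinearMap 𝕜 (fun _ : Fin k => A) M) :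
    d 𝕜 A M' k (β.compMultilinearMap f) = β.compMultilinearMap (d 𝕜 A M k f) :=
  d_natural (AlgHom.id 𝕜 A) β hl hr f

end functoriality

end Hochschild

/-- The coinduced bimodule: the linear maps `A → M`, with `(c • φ) b = φ (b * c)` and
`(φ • c) b = φ b • c`. -/
def Coind (𝕜 A M : Type*) [CommRing 𝕜] [Ring A] [Algebra 𝕜 A] [AddCommGroup M] [Module 𝕜 M] :
    Type _ :=
  A →ₗ[𝕜] M

namespace Coind

section

variable {𝕜 A M : Type*} [CommRing 𝕜] [Ring A] [Algebra 𝕜 A] [AddCommGroup M] [Module 𝕜 M]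

instance : AddCommGroup (Coind 𝕜 A M) := inferInstanceAs (AddCommGroup (A →ₗ[𝕜] M))

instance : Module 𝕜 (Coind 𝕜 A M) := inferInstanceAs (Module 𝕜 (A →ₗ[𝕜] M))

instance : FunLike (Coind 𝕜 A M) A M := inferInstanceAs (FunLike (A →ₗ[𝕜] M) A M)

instance : LinearMapClass (Coind 𝕜 A M) 𝕜 A M :=
  inferInstanceAs (LinearMapClass (A →ₗ[𝕜] M) 𝕜 A M)

/-- The identity map from linear maps to the coinduced bimodule. -/
def of : (A →ₗ[𝕜] M) ≃ₗ[𝕜] Coind 𝕜 A M := LinearEquiv.refl 𝕜 _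

@[simp] theorem of_apply (φ : A →ₗ[𝕜] M) (b : A) : of φ b = φ b := rfl

@[ext] theorem ext {φ ψ : Coind 𝕜 A M} (h : ∀ b, φ b = ψ b) : φ = ψ := DFunLike.ext _ _ h

@[simp] theorem add_apply (φ ψ : Coind 𝕜 A M) (b : A) : (φ + ψ) b = φ b + ψ b := rfl

@[simp] theorem neg_apply (φ : Coind 𝕜 A M) (b : A) : (-φ) b = -φ b := rfl

@[simp] theorem sub_apply (φ ψ : Coind 𝕜 A M) (b : A) : (φ - ψ) b = φ b - ψ b := rfl

@[simp] theorem zero_apply (b : A) : (0 : Coind 𝕜 A M) b = 0 := rfl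

@[simp] theorem smul_apply (c : 𝕜) (φ : Coind 𝕜 A M) (b : A) : (c • φ) b = c • φ b := rfl

/-- Evaluation at a point. -/
def eval (b : A) : Coind 𝕜 A M →ₗ[𝕜] M where
  toFun φ := φ b
  map_add' _ _ := rfl
  map_smul' _ _ := rfl

theorem sum_apply {ι : Type*} (s : Finset ι) (φ : ι → Coind 𝕜 A M) (b : A) :
    (∑ i ∈ s, φ i) b = ∑ i ∈ s, φ i b := map_sum (eval b) φ s

instance : Module A (Coind 𝕜 A M) where
  smul c φ := of ((of.symm φ) ∘ₗ LinearMap.mulRight 𝕜 c)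
  one_smul φ := by ext b; exact congrArg φ (mul_one b)
  mul_smul c c' φ := by ext b; exact congrArg φ (mul_assoc b c c').symm
  smul_zero c := rfl
  smul_add c φ ψ := rfl
  add_smul c c' φ := by ext b; exact (congrArg φ (mul_add b c c')).trans (map_add φ _ _)
  zero_smul φ := by ext b; exact (congrArg φ (mul_zero b)).trans (map_zero φ)

@[simp] theorem left_smul_apply (c : A) (φ : Coind 𝕜 A M) (b : A) : (c • φ) b = φ (b * c) := rfl

instance : IsScalarTower 𝕜 A (Coind 𝕜 A M) where
  smul_assoc r c φ := by ext b; simp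

section right

variable [Module Aᵐᵒᵖ M] [IsScalarTower 𝕜 Aᵐᵒᵖ M]

instance : Module Aᵐᵒᵖ (Coind 𝕜 A M) where
  smul c φ := of ((DistribSMul.toLinearMap 𝕜 M c) ∘ₗ (of.symm φ))
  one_smul φ := by ext b; exact one_smul _ (φ b)
  mul_smul c c' φ := by ext b; exact mul_smul c c' (φ b)
  smul_zero c := by ext b; exact smul_zero c
  smul_add c φ ψ := by ext b; exact smul_add c (φ b) (ψ b)
  add_smul c c' φ := by ext b; exact add_smul c c' (φ b)
  zero_smul φ := by ext b; exact zero_smul _ (φ b)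

@[simp] theorem right_smul_apply (c : Aᵐᵒᵖ) (φ : Coind 𝕜 A M) (b : A) :
    (c • φ) b = c • φ b := rfl

instance : IsScalarTower 𝕜 Aᵐᵒᵖ (Coind 𝕜 A M) where
  smul_assoc r c φ := by ext b; simp

instance : SMulCommClass A Aᵐᵒᵖ (Coind 𝕜 A M) where
  smul_comm a b φ := by ext; simp

end right

variable [Module A M] [IsScalarTower 𝕜 A M]

variable (𝕜 A M) in
/-- The embedding of a bimodule in the coinduced one, `m ↦ (b ↦ b • m)`. -/
def incl : M →ₗ[𝕜] Coind 𝕜 A M where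
  toFun m := of ((LinearMap.toSpanSingleton A M m).restrictScalars 𝕜)
  map_add' m m' := by ext b; exact smul_add b m m'
  map_smul' c m := by ext b; exact smul_comm b c m

@[simp] theorem incl_apply (m : M) (b : A) : incl 𝕜 A M m b = b • m := rfl

theorem incl_smul (a : A) (m : M) : incl 𝕜 A M (a • m) = a • incl 𝕜 A M m := by
  ext b; simp [mul_smul]

theorem incl_injective : Function.Injective (incl 𝕜 A M) := fun m m' h => by
  simpa using DFunLike.congr_fun h 1

theorem incl_op_smul [Module Aᵐᵒᵖ M] [IsScalarTower 𝕜 Aᵐᵒᵖ M] [SMulCommClass A Aᵐᵒᵖ M]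
    (a : Aᵐᵒᵖ) (m : M) : incl 𝕜 A M (a • m) = a • incl 𝕜 A M m := by
  ext b; simp [smul_comm]

end

end Coind

namespace Hochschild

universe u v w

section curry

variable {𝕜 : Type u} {A : Type v} {M : Type w} [CommRing 𝕜] [Ring A] [Algebra 𝕜 A]
  [AddCommGroup M] [Module 𝕜 M]

/-- The first argument of a cochain made the argument of its values. -/
def curry {k : ℕ} (f : MultilinearMap 𝕜 (fun _ : Fin (k + 1) => A) M) :
    MultilinearMap 𝕜 (fun _ : Fin k => A) (Coind 𝕜 A M) where
  toFun a := Coind.of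
    { toFun b := f (Fin.cons b a)
      map_add' b b' := f.cons_add a b b'
      map_smul' c b := f.cons_smul a c b }
  map_update_add' {inst} a i x y := by
    rw [Subsingleton.elim inst (instDecidableEqFin k)]
    ext b
    simp only [Coind.of_apply, Coind.add_apply, LinearMap.coe_mk, AddHom.coe_mk, Fin.cons_update,
      f.map_update_add]
  map_update_smul' {inst} a i c x := by
    rw [Subsingleton.elim inst (instDecidableEqFin k)]
    ext b
    simp only [Coind.of_apply, Coind.smul_apply, LinearMap.coe_mk, AddHom.coe_mk, Fin.cons_update,
      f.map_update_smul]

@[simp] theorem curry_apply {k : ℕ} (f : MultilinearMap 𝕜 (fun _ : Fin (k + 1) => A) M)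
    (a : Fin k → A) (b : A) : curry f a b = f (Fin.cons b a) := rfl

theorem curry_injective {k : ℕ} :
    Function.Injective (curry : MultilinearMap 𝕜 (fun _ : Fin (k + 1) => A) M → _) :=
  fun f g h => by
    ext a
    have := DFunLike.congr_fun (DFunLike.congr_fun h (Fin.tail a)) (a 0)
    simpa [Fin.cons_self_tail] using this

theorem curry_mem_normalized {k : ℕ} {f : MultilinearMap 𝕜 (fun _ : Fin (k + 1) => A) M}
    (hf : f ∈ normalized 𝕜 A M (k + 1)) : curry f ∈ normalized 𝕜 A (Coind 𝕜 A M) k := by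
  rintro a ⟨i, hi⟩
  ext b
  exact hf _ ⟨i.succ, by simpa using hi⟩

variable [Module A M] [Module Aᵐᵒᵖ M] [IsScalarTower 𝕜 A M] [IsScalarTower 𝕜 Aᵐᵒᵖ M]

theorem contractNth_zero_cons {k : ℕ} (b : A) (a : Fin (k + 1) → A) :
    Fin.contractNth 0 (· * ·) (Fin.cons b a : Fin (k + 2) → A)
      = (Fin.cons (b * a 0) (Fin.tail a) : Fin (k + 1) → A) := by
  ext j
  refine Fin.cases ?_ (fun j => ?_) j
  · simp [Fin.contractNth]
  · simp [Fin.contractNth, Fin.tail]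

theorem contractNth_succ_cons {k : ℕ} (i : Fin k) (b : A) (a : Fin (k + 1) → A) :
    Fin.contractNth i.succ.castSucc (· * ·) (Fin.cons b a : Fin (k + 2) → A)
      = (Fin.cons b (Fin.contractNth i.castSucc (· * ·) a) : Fin (k + 1) → A) := by
  ext j
  refine Fin.cases ?_ (fun j => ?_) j
  · simp [Fin.contractNth]
  · simp only [Fin.contractNth, Fin.cons_succ, Fin.val_succ, Fin.val_castSucc,
      add_lt_add_iff_right, add_left_inj, Fin.castSucc_succ]

/-- Currying turns the differential of `M` into that of the coinduced bimodule, up to the embedding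
of `M` in it. This is behind `d ∘ d = 0` and behind the acyclicity of coinduced bimodules. -/
theorem curry_d {k : ℕ} (f : MultilinearMap 𝕜 (fun _ : Fin (k + 1) => A) M) :
    curry (d 𝕜 A M (k + 1) f)
      = (Coind.incl 𝕜 A M).compMultilinearMap f - d 𝕜 A (Coind 𝕜 A M) k (curry f) := by
  ext a b
  simp only [curry_apply, d_apply, sub_apply, Coind.sub_apply, Coind.add_apply,
    Coind.sum_apply, Coind.smul_apply, LinearMap.compMultilinearMap_apply, Coind.incl_apply,
    Coind.left_smul_apply, Coind.right_smul_apply, Fin.sum_univ_succ, Fin.cons_zero, Fin.tail_cons,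
    Fin.castSucc_zero, contractNth_zero_cons, contractNth_succ_cons]
  have h1 : (Fin.cons b a : Fin (k + 2) → A) (Fin.last (k + 1)) = a (Fin.last k) := by
    rw [← Fin.succ_last, Fin.cons_succ]
  have h2 : Fin.init (Fin.cons b a : Fin (k + 2) → A) = Fin.cons b (Fin.init a) := by
    ext j
    refine Fin.cases ?_ (fun j => ?_) j
    · simp [Fin.init]
    · simp only [Fin.init, Fin.cons_succ, Fin.castSucc_succ]
  rw [h1, h2]
  simp only [Fin.val_zero, zero_add, pow_one, neg_smul, one_smul, Fin.val_succ, pow_succ _ (_ + 1),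
    mul_neg, mul_one, Finset.sum_neg_distrib]
  abel

theorem d_zero_apply (f : MultilinearMap 𝕜 (fun _ : Fin 0 => A) M) (a : Fin 1 → A) :
    d 𝕜 A M 0 f a = a 0 • f ![] - MulOpposite.op (a 0) • f ![] := by
  rw [d_apply]
  simp [Subsingleton.elim (Fin.tail a) ![], Subsingleton.elim (Fin.init a) ![], sub_eq_add_neg]

end curry

section

variable {𝕜 : Type u} {A : Type v} [CommRing 𝕜] [Ring A] [Algebra 𝕜 A]

theorem d_d {k : ℕ} : ∀ {M : Type (max v w)} [AddCommGroup M] [Module 𝕜 M] [Module A M]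
    [Module Aᵐᵒᵖ M] [IsScalarTower 𝕜 A M] [IsScalarTower 𝕜 Aᵐᵒᵖ M] [SMulCommClass A Aᵐᵒᵖ M]
    (f : MultilinearMap 𝕜 (fun _ : Fin k => A) M), d 𝕜 A M (k + 1) (d 𝕜 A M k f) = 0 := by
  induction k with
  | zero =>
    intro M _ _ _ _ _ _ _ f
    ext a
    rw [d_apply, d_zero_apply, d_zero_apply]
    have h0 : ∀ g : Fin (0 + 1) → M, ∑ x, g x = g 0 := Fin.sum_univ_one
    simp only [Fin.tail, Fin.init, d_zero_apply, h0]
    have h1 : Fin.contractNth (Fin.castSucc (0 : Fin 1)) (· * ·) a 0 = a 0 * a 1 := by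
      simp [Fin.contractNth]
    have key : ∀ (x y : A) (m : M), x • (y • m - MulOpposite.op y • m)
        + -((x * y) • m - MulOpposite.op (x * y) • m)
        + MulOpposite.op y • (x • m - MulOpposite.op x • m) = 0 := by
      intro x y m
      simp only [smul_sub, mul_smul, MulOpposite.op_mul, smul_comm x (MulOpposite.op y)]
      abel
    rw [h1]
    refine Eq.trans ?_ (key (a 0) (a 1) (f ![]))
    simp only [Fin.val_zero, zero_add, pow_one, neg_smul, one_smul, even_two, Even.neg_pow,
      one_pow, Nat.reduceAdd]
    rfl
  | succ k ih =>
    intro M _ _ _ _ _ _ _ f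
    apply curry_injective
    rw [curry_d, curry_d, map_sub, ih (M := Coind 𝕜 A M),
      d_comp _ Coind.incl_smul fun a => Coind.incl_op_smul _]
    rw [sub_zero, sub_self]
    rfl

end

section

variable {𝕜 : Type u} {A : Type v} {M : Type w} [CommRing 𝕜] [Ring A] [Algebra 𝕜 A]
  [AddCommGroup M] [Module 𝕜 M] [Module A M] [Module Aᵐᵒᵖ M] [IsScalarTower 𝕜 A M]
  [IsScalarTower 𝕜 Aᵐᵒᵖ M]

/-- If the values of `F` vanish at `1`, only the first term of `d F` survives at `1`. -/
theorem d_coind_apply_one {𝕜 : Type u} {A : Type v} {M : Type w} [CommRing 𝕜] [Ring A]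
    [Algebra 𝕜 A] [AddCommGroup M] [Module 𝕜 M] [Module Aᵐᵒᵖ M] [IsScalarTower 𝕜 Aᵐᵒᵖ M]
    {k : ℕ} (F : MultilinearMap 𝕜 (fun _ : Fin k => A) (Coind 𝕜 A M))
    (hF : ∀ a, F a 1 = 0) (a : Fin (k + 1) → A) :
    d 𝕜 A (Coind 𝕜 A M) k F a 1 = F (Fin.tail a) (a 0) := by
  simp [d_apply, Coind.sum_apply, hF]

theorem smul_eq_op_smul {a : A} (ha : a ∈ Set.range (algebraMap 𝕜 A)) (m : M) :
    a • m = MulOpposite.op a • m := by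
  obtain ⟨c, rfl⟩ := ha
  rw [algebraMap_smul]
  rw [Algebra.algebraMap_eq_smul_one, MulOpposite.op_smul, MulOpposite.op_one, smul_assoc, one_smul]

end

section

variable {𝕜 : Type u} {A : Type v} [CommRing 𝕜] [Ring A] [Algebra 𝕜 A]

theorem d_mem_normalized {k : ℕ} : ∀ {M : Type (max v w)} [AddCommGroup M] [Module 𝕜 M]
    [Module A M] [Module Aᵐᵒᵖ M] [IsScalarTower 𝕜 A M] [IsScalarTower 𝕜 Aᵐᵒᵖ M]
    {f : MultilinearMap 𝕜 (fun _ : Fin k => A) M}, f ∈ normalized 𝕜 A M k →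
    d 𝕜 A M k f ∈ normalized 𝕜 A M (k + 1) := by
  induction k with
  | zero =>
    rintro M _ _ _ _ _ _ f hf a ⟨i, hi⟩
    obtain rfl := Fin.fin_one_eq_zero i
    rw [d_zero_apply, smul_eq_op_smul hi, sub_self]
  | succ k ih =>
    rintro M _ _ _ _ _ _ f hf a ⟨i, hi⟩
    have key : ∀ (b : A) (a : Fin (k + 1) → A), d 𝕜 A M (k + 1) f (Fin.cons b a)
        = b • f a - d 𝕜 A (Coind 𝕜 A M) k (curry f) a b := fun b a =>
      DFunLike.congr_fun (DFunLike.congr_fun (curry_d f) a) b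
    rw [← Fin.cons_self_tail a, key]
    revert hi
    refine Fin.cases (fun hi => ?_) (fun i hi => ?_) i
    · obtain ⟨c, hc⟩ := hi
      rw [← hc, algebraMap_smul, Algebra.algebraMap_eq_smul_one, map_smul,
        d_coind_apply_one]
      · simp
      · intro a
        rw [curry_apply]
        exact hf _ ⟨0, 1, by simp⟩
    · rw [hf (Fin.tail a) ⟨i, hi⟩, ih (M := Coind 𝕜 A M) (curry_mem_normalized hf) (Fin.tail a)
        ⟨i, hi⟩]
      simp

end

section

variable {𝕜 : Type u} {A : Type v} {M : Type w} [CommRing 𝕜] [Ring A] [Algebra 𝕜 A]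
  [AddCommGroup M] [Module 𝕜 M] [Module Aᵐᵒᵖ M] [IsScalarTower 𝕜 Aᵐᵒᵖ M]

/-- A coinduced bimodule is acyclic in positive degrees. -/
theorem exists_d_eq_of_d_eq_zero {k : ℕ}
    {f : MultilinearMap 𝕜 (fun _ : Fin (k + 1) => A) (Coind 𝕜 A M)}
    (hf : f ∈ normalized 𝕜 A (Coind 𝕜 A M) (k + 1)) (hd : d 𝕜 A (Coind 𝕜 A M) (k + 1) f = 0) :
    ∃ g ∈ normalized 𝕜 A (Coind 𝕜 A M) k, d 𝕜 A (Coind 𝕜 A M) k g = f := by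
  -- evaluation at `1` is a bimodule retraction of the embedding of the coinduced bimodule
  let ev : Coind 𝕜 A (Coind 𝕜 A M) →ₗ[𝕜] Coind 𝕜 A M :=
    { toFun Ψ := Coind.of ((Coind.eval (1 : A)) ∘ₗ Coind.of.symm Ψ)
      map_add' _ _ := rfl
      map_smul' _ _ := rfl }
  have hev : ∀ Ψ b, ev Ψ b = Ψ b 1 := fun _ _ => rfl
  refine ⟨ev.compMultilinearMap (curry f), comp_mem_normalized _ (curry_mem_normalized hf), ?_⟩
  rw [d_comp ev (fun a m => by ext b; simp [hev]) (fun a m => by ext b; simp [hev])]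
  have h := curry_d f
  rw [hd] at h
  have h' : d 𝕜 A (Coind 𝕜 A (Coind 𝕜 A M)) k (curry f)
      = (Coind.incl 𝕜 A (Coind 𝕜 A M)).compMultilinearMap f := (sub_eq_zero.mp h.symm).symm
  rw [h']
  ext a b
  simp [hev]

/-- A zero-cocycle of a coinduced bimodule is a map of right modules. -/
theorem eq_of_d_eq_zero {f : MultilinearMap 𝕜 (fun _ : Fin 0 => A) (Coind 𝕜 A M)}
    (hd : d 𝕜 A (Coind 𝕜 A M) 0 f = 0) (b : A) :
    f ![] b = MulOpposite.op b • f ![] 1 := by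
  have h := DFunLike.congr_fun (DFunLike.congr_fun hd ![b]) 1
  rw [d_zero_apply] at h
  simpa [sub_eq_zero] using h

end

end Hochschild

/-! ### Complexes with commuting split endomorphisms -/

/-- A cochain complex with a family of commuting endomorphisms `x l`, each of which has a
right inverse `s l` in every degree. The `s l` commute with the other `x m`, but need not commute
with the differential. -/
structure SplitKoszul (𝕜 ι : Type*) [Field 𝕜] (C : ℕ → Type*) [∀ k, AddCommGroup (C k)]
    [∀ k, Module 𝕜 (C k)] where
  d : ∀ k, C k →ₗ[𝕜] C (k + 1)
  d_d : ∀ k f, d (k + 1) (d k f) = 0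
  x : ι → ∀ k, C k →ₗ[𝕜] C k
  s : ι → ∀ k, C k →ₗ[𝕜] C k
  x_d : ∀ l k f, x l (k + 1) (d k f) = d k (x l k f)
  x_comm : ∀ l m k f, x l k (x m k f) = x m k (x l k f)
  x_s_self : ∀ l k f, x l k (s l k f) = f
  x_s : ∀ l m k f, l ≠ m → x m k (s l k f) = s l k (x m k f)

namespace SplitKoszul

variable {𝕜 ι : Type*} [Field 𝕜] {C : ℕ → Type*} [∀ k, AddCommGroup (C k)]
  [∀ k, Module 𝕜 (C k)] (K : SplitKoszul 𝕜 ι C) {W : Type*} [AddCommGroup W] [Module 𝕜 W]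

/-- The subcomplex on which the endomorphisms in `J` vanish. -/
def sub (J : Set ι) (k : ℕ) : Submodule 𝕜 (C k) where
  carrier := {f | ∀ l ∈ J, K.x l k f = 0}
  add_mem' hf hg l hl := by rw [map_add, hf l hl, hg l hl, add_zero]
  zero_mem' l _ := map_zero _
  smul_mem' c f hf l hl := by rw [map_smul, hf l hl, smul_zero]

/-- The coboundaries of the subcomplex on which the endomorphisms in `J` vanish. -/
def bdry (J : Set ι) : ∀ k, Submodule 𝕜 (C k)
  | 0 => ⊥
  | k + 1 => (K.sub J k).map (K.d k)

variable {K} {J : Set ι} {l m : ι} {k : ℕ} {f g : C k}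

theorem mem_sub : f ∈ K.sub J k ↔ ∀ l ∈ J, K.x l k f = 0 := Iff.rfl

theorem mem_sub_insert : f ∈ K.sub (insert l J) k ↔ K.x l k f = 0 ∧ f ∈ K.sub J k := by
  simp [mem_sub]

theorem d_mem_sub (hf : f ∈ K.sub J k) : K.d k f ∈ K.sub J (k + 1) := fun l hl => by
  rw [K.x_d, hf l hl, map_zero]

theorem x_mem_sub (hf : f ∈ K.sub J k) : K.x m k f ∈ K.sub J k := fun l hl => by
  rw [K.x_comm, hf l hl, map_zero]

theorem s_mem_sub (hl : l ∉ J) (hf : f ∈ K.sub J k) : K.s l k f ∈ K.sub J k := fun m hm => by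
  rw [K.x_s l m k f (fun h => hl (by rwa [h])), hf m hm, map_zero]

theorem bdry_le_sub : ∀ {k}, K.bdry J k ≤ K.sub J k
  | 0 => bot_le
  | _ + 1 => by
    rintro _ ⟨f, hf, rfl⟩
    exact d_mem_sub hf

theorem d_mem_bdry (hf : f ∈ K.sub J k) : K.d k f ∈ K.bdry J (k + 1) := ⟨f, hf, rfl⟩

theorem d_eq_zero_of_mem_bdry : ∀ {k} {f : C k}, f ∈ K.bdry J k → K.d k f = 0
  | 0, f, hf => by rw [(Submodule.mem_bot 𝕜).mp hf, map_zero]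
  | k + 1, _, ⟨f, _, rfl⟩ => K.d_d k f

theorem x_mem_bdry : ∀ {k} {f : C k}, f ∈ K.bdry J k → K.x m k f ∈ K.bdry J k
  | 0, f, hf => by rw [(Submodule.mem_bot 𝕜).mp hf, map_zero]; exact zero_mem _
  | k + 1, _, ⟨f, hf, rfl⟩ => by rw [K.x_d]; exact d_mem_bdry (x_mem_sub hf)

theorem exists_mem_bdry (hl : l ∉ J) : ∀ {k} {f : C k}, f ∈ K.bdry J k →
    ∃ g ∈ K.bdry J k, K.x l k g = f
  | 0, f, hf => ⟨0, zero_mem _, by rw [(Submodule.mem_bot 𝕜).mp hf, map_zero]⟩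
  | k + 1, _, ⟨f, hf, rfl⟩ => ⟨K.d k (K.s l k f), d_mem_bdry (s_mem_sub hl hf), by
      rw [K.x_d, K.x_s_self]⟩

/-- A cochain whose image under `x l` is a coboundary can be moved by a cocycle into the kernel of
`x l`. -/
theorem exists_mem_sub_insert (hl : l ∉ J) (hg : g ∈ K.sub J k) (h : K.x l k g ∈ K.bdry J k) :
    ∃ g' ∈ K.sub (insert l J) k, K.d k g' = K.d k g := by
  obtain ⟨z, hz, hz'⟩ := exists_mem_bdry hl h
  refine ⟨g - z, mem_sub_insert.mpr ⟨?_, sub_mem hg (bdry_le_sub hz)⟩, ?_⟩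
  · rw [map_sub, hz', sub_self]
  · rw [map_sub, d_eq_zero_of_mem_bdry hz, sub_zero]

variable (K)

/-- The map `θ` identifies `U` with the cohomology in degree `q` of the subcomplex on which the
endomorphisms in `J` vanish, and the cohomology of that subcomplex in other degrees is zero. -/
structure Computes (J : Set ι) (q : ℕ) (U : Submodule 𝕜 W) (θ : W →ₗ[𝕜] C q) : Prop where
  mem : ∀ P ∈ U, θ P ∈ K.sub J q
  cocycle : ∀ P ∈ U, K.d q (θ P) = 0
  exact : ∀ k, k ≠ q → ∀ f ∈ K.sub J k, K.d k f = 0 → f ∈ K.bdry J k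
  surj : ∀ f ∈ K.sub J q, K.d q f = 0 → ∃ P ∈ U, f - θ P ∈ K.bdry J q
  inj : ∀ P ∈ U, θ P ∈ K.bdry J q → P = 0

variable {K}

/-- The long exact sequence of `x l` in the case where it acts on the cohomology `U` by an
injective map `T`: the cohomology of its kernel is the cokernel `U'` of `T`, one degree higher. -/
theorem Computes.of_injective {q : ℕ} {U U' : Submodule 𝕜 W} {θ : W →ₗ[𝕜] C q}
    (h : K.Computes J q U θ) (hl : l ∉ J) (T : W →ₗ[𝕜] W)
    (hT : ∀ P ∈ U, T P ∈ U) (hθ : ∀ P ∈ U, K.x l q (θ P) - θ (T P) ∈ K.bdry J q)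
    (hU' : U' ≤ U) (hdec : ∀ P ∈ U, ∃ Q ∈ U, P - T Q ∈ U')
    (hinj : ∀ P ∈ U, T P ∈ U' → P = 0) :
    K.Computes (insert l J) (q + 1) U' (K.d q ∘ₗ K.s l q ∘ₗ θ) where
  mem P hP := by
    refine mem_sub_insert.mpr ⟨?_, d_mem_sub (s_mem_sub hl (h.mem P (hU' hP)))⟩
    simp [K.x_d, K.x_s_self, h.cocycle P (hU' hP)]
  cocycle P hP := K.d_d _ _
  exact k hk f hf hd := by
    have hf' := mem_sub_insert.mp hf
    have hfb : f ∈ K.bdry J k := by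
      by_cases hkq : k = q
      · subst hkq
        obtain ⟨P, hP, hb⟩ := h.surj f hf'.2 hd
        have h1 : θ (T P) ∈ K.bdry J k := by
          have h2 := x_mem_bdry (m := l) hb
          rw [map_sub, hf'.1, zero_sub] at h2
          have h3 := add_mem h2 (hθ P hP)
          rw [← neg_mem_iff] at h3
          convert h3 using 1
          abel
        have h4 : P = 0 := hinj P hP (by rw [h.inj _ (hT P hP) h1]; exact zero_mem _)
        simpa [h4] using hb
      · exact h.exact k hkq f hf'.2 hd
    cases k with
    | zero => exact hfb
    | succ k =>
      obtain ⟨g, hg, rfl⟩ := hfb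
      have h1 : K.x l k g ∈ K.bdry J k :=
        h.exact k (fun h => hk (by rw [h])) _ (x_mem_sub hg) (by rw [← K.x_d, hf'.1])
      obtain ⟨g', hg', h2⟩ := exists_mem_sub_insert hl hg h1
      exact ⟨g', hg', h2⟩
  surj f hf hd := by
    have hf' := mem_sub_insert.mp hf
    obtain ⟨g, hg, rfl⟩ := h.exact (q + 1) (Nat.succ_ne_self q) f hf'.2 hd
    obtain ⟨P, hP, hb⟩ := h.surj (K.x l q g) (x_mem_sub hg) (by rw [← K.x_d, hf'.1])
    obtain ⟨Q, hQ, hR⟩ := hdec P hP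
    refine ⟨P - T Q, hR, ?_⟩
    -- the correction of `g` by cochains whose images under `x l` are known
    have h1 : K.x l q (g - θ Q - K.s l q (θ (P - T Q))) ∈ K.bdry J q := by
      rw [map_sub, map_sub, K.x_s_self, map_sub θ]
      convert sub_mem hb (hθ Q hQ) using 1
      abel
    obtain ⟨g', hg', h2⟩ := exists_mem_sub_insert hl
      (sub_mem (sub_mem hg (h.mem Q hQ)) (s_mem_sub hl (h.mem _ (hU' hR)))) h1
    refine ⟨g', hg', ?_⟩
    rw [h2, map_sub, map_sub, h.cocycle Q hQ, sub_zero]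
    rfl
  inj R hR hb := by
    obtain ⟨g, hg, hgd⟩ := hb
    have hg' := mem_sub_insert.mp hg
    obtain ⟨P, hP, h1⟩ := h.surj (K.s l q (θ R) - g)
      (sub_mem (s_mem_sub hl (h.mem R (hU' hR))) hg'.2) (by
        rw [map_sub, sub_eq_zero]; exact hgd.symm)
    have h2 := add_mem (x_mem_bdry (m := l) h1) (hθ P hP)
    rw [map_sub, map_sub, K.x_s_self, hg'.1, sub_zero, sub_add_sub_cancel, ← map_sub] at h2
    have h3 := sub_eq_zero.mp (h.inj _ (sub_mem (hU' hR) (hT P hP)) h2)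
    rw [h3, hinj P hP (h3 ▸ hR), map_zero]

/-- The compatibility of the connecting map with the other endomorphisms. -/
theorem x_connecting {q : ℕ} {θ : W →ₗ[𝕜] C q} (hl : l ∉ J) (hlm : l ≠ m)
    (T : W →ₗ[𝕜] W) {P : W} (hθ : K.x m q (θ P) - θ (T P) ∈ K.bdry J q) :
    K.x m (q + 1) ((K.d q ∘ₗ K.s l q ∘ₗ θ) P) - (K.d q ∘ₗ K.s l q ∘ₗ θ) (T P)
      ∈ K.bdry (insert l J) (q + 1) := by
  have h1 : K.x m (q + 1) ((K.d q ∘ₗ K.s l q ∘ₗ θ) P) - (K.d q ∘ₗ K.s l q ∘ₗ θ) (T P)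
      = K.d q (K.s l q (K.x m q (θ P) - θ (T P))) := by
    simp [K.x_d, K.x_s l m _ _ hlm]
  rw [h1]
  obtain ⟨g', hg', h2⟩ := exists_mem_sub_insert hl (s_mem_sub hl (bdry_le_sub hθ))
    (by rw [K.x_s_self]; exact hθ)
  exact ⟨g', hg', h2⟩

/-- The long exact sequence of `x l` in the case where it acts on the cohomology `U`, which is in
degree zero, by a surjective map `T`: the cohomology of its kernel is the kernel `U'` of `T`. -/
theorem Computes.of_surjective {U U' : Submodule 𝕜 W} {θ : W →ₗ[𝕜] C 0}
    (h : K.Computes J 0 U θ) (hl : l ∉ J) (T : W →ₗ[𝕜] W)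
    (hT : ∀ P ∈ U, T P ∈ U) (hθ : ∀ P ∈ U, K.x l 0 (θ P) = θ (T P))
    (hU' : ∀ P, P ∈ U' ↔ P ∈ U ∧ T P = 0) (hsurj : ∀ P ∈ U, ∃ Q ∈ U, T Q = P) :
    K.Computes (insert l J) 0 U' θ where
  mem P hP := by
    obtain ⟨hP, hP'⟩ := (hU' P).mp hP
    exact mem_sub_insert.mpr ⟨by rw [hθ P hP, hP', map_zero], h.mem P hP⟩
  cocycle P hP := h.cocycle P ((hU' P).mp hP).1
  exact k hk f hf hd := by
    have hf' := mem_sub_insert.mp hf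
    have hfb := h.exact k hk f hf'.2 hd
    cases k with
    | zero => exact hfb
    | succ k =>
      obtain ⟨g, hg, rfl⟩ := hfb
      have hd' : K.d k (K.x l k g) = 0 := by rw [← K.x_d, hf'.1]
      suffices ∃ g₁ ∈ K.sub J k, K.d k g₁ = K.d k g ∧ K.x l k g₁ ∈ K.bdry J k by
        obtain ⟨g₁, hg₁, h1, h2⟩ := this
        obtain ⟨g', hg', h3⟩ := exists_mem_sub_insert hl hg₁ h2
        exact ⟨g', hg', h3.trans h1⟩
      by_cases hk0 : k = 0
      · subst hk0
        obtain ⟨P, hP, hb⟩ := h.surj _ (x_mem_sub hg) hd'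
        obtain ⟨Q, hQ, rfl⟩ := hsurj P hP
        refine ⟨g - θ Q, sub_mem hg (h.mem Q hQ), by rw [map_sub, h.cocycle Q hQ, sub_zero], ?_⟩
        rwa [map_sub, hθ Q hQ]
      · exact ⟨g, hg, rfl, h.exact k hk0 _ (x_mem_sub hg) hd'⟩
  surj f hf hd := by
    have hf' := mem_sub_insert.mp hf
    obtain ⟨P, hP, hb⟩ := h.surj f hf'.2 hd
    refine ⟨P, (hU' P).mpr ⟨hP, h.inj _ (hT P hP) ?_⟩, hb⟩
    rw [← hθ P hP, ← sub_eq_zero.mp ((Submodule.mem_bot 𝕜).mp hb), hf'.1]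
    exact zero_mem _
  inj P hP hb := h.inj P ((hU' P).mp hP).1 hb

end SplitKoszul

/-! ### Koszul coordinates on linear endomorphisms of the Weyl algebra -/

namespace WeylPoly

variable {n : ℕ}

theorem X_moyal (j : Fin n ⊕ Fin n) (b : WeylPoly n) :
    moyal n (MvPolynomial.X j) b = MvPolynomial.X j * b + (1 / 2 : ℂ) • ham j b := by
  have h := mul_X_moyal (1 : WeylPoly n) j b
  have h1 : ∀ b : WeylPoly n, moyal n 1 b = b := fun b => (C_moyal 1 b).trans (one_smul ℂ b)
  rwa [one_mul, h1, h1] at h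

theorem moyal_X (b : WeylPoly n) (j : Fin n ⊕ Fin n) :
    moyal n b (MvPolynomial.X j) = MvPolynomial.X j * b - (1 / 2 : ℂ) • ham j b := by
  induction b using MvPolynomial.induction_on with
  | C c =>
    rw [C_moyal, ← MvPolynomial.algebraMap_eq, Derivation.map_algebraMap, smul_zero, sub_zero,
      mul_comm, Algebra.smul_def]
  | add p q hp hq =>
    rw [map_add, LinearMap.add_apply, hp, hq, mul_add, map_add, smul_add]
    abel
  | mul_X p i hp =>
    have hJ : Matrix.J (Fin n) ℂ j i = -Matrix.J (Fin n) ℂ i j := by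
      rcases i with i | i <;> rcases j with j | j <;>
        simp [Matrix.J, Matrix.one_apply, eq_comm]
    rw [mul_X_moyal, hp, ham_X, moyal_C, Derivation.leibniz, ham_X, hJ, smul_eq_mul, smul_eq_mul,
      neg_neg, MvPolynomial.smul_eq_C_mul, MvPolynomial.smul_eq_C_mul,
      MvPolynomial.smul_eq_C_mul, MvPolynomial.smul_eq_C_mul, map_neg]
    ring

/-- The algebra homomorphism `f ↦ f (x - y)` for the commutative product of polynomials. -/
def antidiag (n : ℕ) : WeylPoly n →ₐ[ℂ] WeylPoly n ⊗[ℂ] WeylPoly n :=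
  MvPolynomial.aeval fun j => MvPolynomial.X j ⊗ₜ 1 - 1 ⊗ₜ MvPolynomial.X j

/-- Multiplication of the second factor by a coordinate. -/
def mulXR (j : Fin n ⊕ Fin n) : Module.End ℂ (WeylPoly n ⊗[ℂ] WeylPoly n) :=
  TensorProduct.map LinearMap.id (LinearMap.mulLeft ℂ (MvPolynomial.X j))

theorem mulXR_tmul (j : Fin n ⊕ Fin n) (a b : WeylPoly n) :
    mulXR j (a ⊗ₜ b) = a ⊗ₜ (MvPolynomial.X j * b) := rfl

theorem antidiag_X_mul (j : Fin n ⊕ Fin n) (s : WeylPoly n) :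
    antidiag n (MvPolynomial.X j * s) = mulX j (antidiag n s) - mulXR j (antidiag n s) := by
  have h : ∀ t : WeylPoly n ⊗[ℂ] WeylPoly n,
      (MvPolynomial.X j ⊗ₜ 1 - 1 ⊗ₜ MvPolynomial.X j) * t = mulX j t - mulXR j t := by
    intro t
    induction t using TensorProduct.induction_on with
    | zero => simp
    | tmul a b => simp [sub_mul, mulX_tmul, mulXR_tmul]
    | add a b ha hb => rw [mul_add, ha, hb, map_add, map_add]; abel
  rw [map_mul, ← h, antidiag, MvPolynomial.aeval_X]

theorem hamL_mulX (i j : Fin n ⊕ Fin n) (t : WeylPoly n ⊗[ℂ] WeylPoly n) :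
    hamL i (mulX j t) = mulX j (hamL i t) - Matrix.J (Fin n) ℂ i j • t := by
  induction t using TensorProduct.induction_on with
  | zero => simp
  | tmul a b =>
    rw [mulX_tmul, hamL_tmul, hamL_tmul, mulX_tmul, Derivation.leibniz, ham_X, smul_eq_mul,
      smul_eq_mul, TensorProduct.add_tmul, sub_eq_add_neg, mul_comm a, ← MvPolynomial.smul_eq_C_mul,
      neg_smul, TensorProduct.neg_tmul, TensorProduct.smul_tmul']
  | add a b ha hb => simp only [map_add, ha, hb, smul_add]; abel

theorem hamR_mulXR (i j : Fin n ⊕ Fin n) (t : WeylPoly n ⊗[ℂ] WeylPoly n) :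
    hamR i (mulXR j t) = mulXR j (hamR i t) - Matrix.J (Fin n) ℂ i j • t := by
  induction t using TensorProduct.induction_on with
  | zero => simp
  | tmul a b =>
    rw [mulXR_tmul, hamR_tmul, hamR_tmul, mulXR_tmul, Derivation.leibniz, ham_X, smul_eq_mul,
      smul_eq_mul, TensorProduct.tmul_add, sub_eq_add_neg, mul_comm b, ← MvPolynomial.smul_eq_C_mul,
      neg_smul, TensorProduct.tmul_neg, TensorProduct.tmul_smul]
  | add a b ha hb => simp only [map_add, ha, hb, smul_add]; abel

theorem hamL_mulXR (i j : Fin n ⊕ Fin n) (t : WeylPoly n ⊗[ℂ] WeylPoly n) :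
    hamL i (mulXR j t) = mulXR j (hamL i t) := by
  induction t using TensorProduct.induction_on with
  | zero => simp
  | tmul a b => rw [mulXR_tmul, hamL_tmul, hamL_tmul, mulXR_tmul]
  | add a b ha hb => simp only [map_add, ha, hb]

theorem hamR_mulX (i j : Fin n ⊕ Fin n) (t : WeylPoly n ⊗[ℂ] WeylPoly n) :
    hamR i (mulX j t) = mulX j (hamR i t) := by
  induction t using TensorProduct.induction_on with
  | zero => simp
  | tmul a b => rw [mulX_tmul, hamR_tmul, hamR_tmul, mulX_tmul]
  | add a b ha hb => simp only [map_add, ha, hb]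

theorem antidiag_C (c : ℂ) : antidiag n (MvPolynomial.C c) = c • (1 ⊗ₜ 1) := by
  rw [← MvPolynomial.algebraMap_eq, AlgHom.commutes, Algebra.algebraMap_eq_smul_one]
  rfl

theorem hamL_antidiag (i : Fin n ⊕ Fin n) (s : WeylPoly n) :
    hamL i (antidiag n s) = antidiag n (ham i s) := by
  induction s using MvPolynomial.induction_on with
  | C c => simp [hamL_tmul, ← MvPolynomial.algebraMap_eq]
  | add p q hp hq => simp only [map_add, hp, hq]
  | mul_X p j hp =>
    rw [mul_comm, antidiag_X_mul, map_sub, hamL_mulX, hamL_mulXR, hp, Derivation.leibniz, ham_X,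
      smul_eq_mul, smul_eq_mul, map_add, antidiag_X_mul, mul_comm p, ← MvPolynomial.smul_eq_C_mul,
      map_smul]
    generalize Matrix.J (Fin n) ℂ i j = c
    module

theorem hamR_antidiag (i : Fin n ⊕ Fin n) (s : WeylPoly n) :
    hamR i (antidiag n s) = -antidiag n (ham i s) := by
  induction s using MvPolynomial.induction_on with
  | C c => simp [hamR_tmul, ← MvPolynomial.algebraMap_eq]
  | add p q hp hq => simp only [map_add, hp, hq, neg_add]
  | mul_X p j hp =>
    rw [mul_comm, antidiag_X_mul, map_sub, hamR_mulXR, hamR_mulX, hp, Derivation.leibniz, ham_X,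
      smul_eq_mul, smul_eq_mul, map_add, antidiag_X_mul, mul_comm p, ← MvPolynomial.smul_eq_C_mul,
      map_smul, map_neg, map_neg]
    generalize Matrix.J (Fin n) ℂ i j = c
    module

/-- `a ⊗ b ↦ a * ψ b`, with the Moyal product. -/
def moyalLift (ψ : WeylPoly n →ₗ[ℂ] WeylPoly n) : WeylPoly n ⊗[ℂ] WeylPoly n →ₗ[ℂ] WeylPoly n :=
  TensorProduct.lift (moyal n) ∘ₗ TensorProduct.map LinearMap.id ψ

theorem moyalLift_tmul (ψ : WeylPoly n →ₗ[ℂ] WeylPoly n) (a b : WeylPoly n) :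
    moyalLift ψ (a ⊗ₜ b) = moyal n a (ψ b) := rfl

/-- The involution `(Γ ψ) s = ∑ s' * ψ s''`, where `∑ s' ⊗ s'' = s (x - y)`. It conjugates the
commutators `comm (X j)` with the operators `ψ ↦ ψ ∘ X j`. -/
def koszulCoord (n : ℕ) : Module.End ℂ (WeylPoly n →ₗ[ℂ] WeylPoly n) where
  toFun ψ := moyalLift ψ ∘ₗ (antidiag n).toLinearMap
  map_add' ψ φ := by
    rw [← LinearMap.add_comp]
    congr 1
    apply TensorProduct.ext'
    intro a b
    simp [moyalLift_tmul]
  map_smul' c ψ := by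
    rw [RingHom.id_apply, ← LinearMap.smul_comp]
    congr 1
    apply TensorProduct.ext'
    intro a b
    simp [moyalLift_tmul]

theorem koszulCoord_apply (ψ : WeylPoly n →ₗ[ℂ] WeylPoly n) (s : WeylPoly n) :
    koszulCoord n ψ s = moyalLift ψ (antidiag n s) := rfl

/-- The commutator of a linear map with the left Moyal multiplication by `v`. -/
def comm : WeylPoly n →ₗ[ℂ] Module.End ℂ (WeylPoly n →ₗ[ℂ] WeylPoly n) where
  toFun v :=
    { toFun ψ := moyal n v ∘ₗ ψ - ψ ∘ₗ moyal n v
      map_add' ψ φ := by rw [LinearMap.comp_add, LinearMap.add_comp]; abel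
      map_smul' c ψ := by rw [LinearMap.comp_smul, LinearMap.smul_comp, smul_sub]; rfl }
  map_add' v w := by
    ext1 ψ
    simp only [LinearMap.coe_mk, AddHom.coe_mk, LinearMap.add_apply, map_add, LinearMap.add_comp,
      LinearMap.comp_add]
    abel
  map_smul' c v := by
    ext1 ψ
    simp only [LinearMap.coe_mk, AddHom.coe_mk, LinearMap.smul_apply, map_smul, LinearMap.smul_comp,
      LinearMap.comp_smul, smul_sub, RingHom.id_apply]

theorem comm_apply (v : WeylPoly n) (ψ : WeylPoly n →ₗ[ℂ] WeylPoly n) (b : WeylPoly n) :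
    comm v ψ b = moyal n v (ψ b) - ψ (moyal n v b) := rfl

theorem koszulCoord_comm_X (j : Fin n ⊕ Fin n) (ψ : WeylPoly n →ₗ[ℂ] WeylPoly n) :
    koszulCoord n (comm (MvPolynomial.X j) ψ)
      = koszulCoord n ψ ∘ₗ LinearMap.mulLeft ℂ (MvPolynomial.X j) := by
  have h : ∀ t : WeylPoly n ⊗[ℂ] WeylPoly n, moyalLift (comm (MvPolynomial.X j) ψ) t
      = moyalLift ψ (mulX j t - mulXR j t - (1 / 2 : ℂ) • (hamL j t + hamR j t)) := by
    intro t
    induction t using TensorProduct.induction_on with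
    | zero => simp
    | tmul a b =>
      simp only [mulX_tmul, mulXR_tmul, hamL_tmul, hamR_tmul, map_sub, map_smul, map_add,
        moyalLift_tmul, comm_apply]
      rw [← moyal_assoc, moyal_X, X_moyal]
      simp only [map_add, map_sub, map_smul, LinearMap.sub_apply, LinearMap.smul_apply, smul_add]
      abel
    | add a b ha hb =>
      rw [map_add, ha, hb, ← map_add]
      congr 1
      simp only [map_add, smul_add]
      abel
  refine LinearMap.ext fun s => ?_
  rw [koszulCoord_apply, h, LinearMap.comp_apply, LinearMap.mulLeft_apply, koszulCoord_apply,
    antidiag_X_mul, hamL_antidiag, hamR_antidiag, add_neg_cancel, smul_zero, sub_zero]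

theorem comm_X_koszulCoord (j : Fin n ⊕ Fin n) (ψ : WeylPoly n →ₗ[ℂ] WeylPoly n) :
    comm (MvPolynomial.X j) (koszulCoord n ψ)
      = koszulCoord n (ψ ∘ₗ LinearMap.mulLeft ℂ (MvPolynomial.X j)) := by
  have h1 : ∀ t : WeylPoly n ⊗[ℂ] WeylPoly n, moyal n (MvPolynomial.X j) (moyalLift ψ t)
      = moyalLift ψ (mulX j t + (1 / 2 : ℂ) • hamL j t) := by
    intro t
    induction t using TensorProduct.induction_on with
    | zero => simp
    | tmul a b =>
      rw [moyalLift_tmul, ← moyal_assoc, X_moyal, mulX_tmul, hamL_tmul, TensorProduct.smul_tmul',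
        ← TensorProduct.add_tmul, moyalLift_tmul]
    | add a b ha hb =>
      rw [map_add, map_add, ha, hb, ← map_add]
      congr 1
      simp only [map_add, smul_add]
      abel
  have h2 : ∀ t : WeylPoly n ⊗[ℂ] WeylPoly n,
      moyalLift (ψ ∘ₗ LinearMap.mulLeft ℂ (MvPolynomial.X j)) t = moyalLift ψ (mulXR j t) := by
    intro t
    induction t using TensorProduct.induction_on with
    | zero => simp
    | tmul a b => rfl
    | add a b ha hb => simp only [map_add, ha, hb]
  refine LinearMap.ext fun s => ?_
  rw [comm_apply, X_moyal j s, map_add, map_smul]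
  simp only [koszulCoord_apply]
  rw [h1, h2, antidiag_X_mul, map_add, map_sub, map_smul, hamL_antidiag]
  abel

theorem koszulCoord_C (ψ : WeylPoly n →ₗ[ℂ] WeylPoly n) (c : ℂ) :
    koszulCoord n ψ (MvPolynomial.C c) = c • ψ 1 := by
  rw [koszulCoord_apply, antidiag_C, map_smul, moyalLift_tmul]
  congr 1
  exact (C_moyal 1 _).trans (one_smul ℂ _)

theorem koszulCoord_koszulCoord (ψ : WeylPoly n →ₗ[ℂ] WeylPoly n) :
    koszulCoord n (koszulCoord n ψ) = ψ := by
  have h : ∀ s : WeylPoly n, ∀ ψ : WeylPoly n →ₗ[ℂ] WeylPoly n,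
      koszulCoord n (koszulCoord n ψ) s = ψ s := by
    intro s
    induction s using MvPolynomial.induction_on with
    | C c =>
      intro ψ
      rw [koszulCoord_C, ← MvPolynomial.C_1, koszulCoord_C, one_smul, ← map_smul,
        ← MvPolynomial.C_mul', mul_one]
    | add p q hp hq => intro ψ; rw [map_add, hp, hq, map_add]
    | mul_X p j hp =>
      intro ψ
      have h1 := congrArg (fun φ => φ p) (koszulCoord_comm_X j (koszulCoord n ψ))
      simp only [LinearMap.comp_apply, LinearMap.mulLeft_apply] at h1
      rw [mul_comm, ← h1, comm_X_koszulCoord, hp, LinearMap.comp_apply, LinearMap.mulLeft_apply]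
  refine LinearMap.ext fun s => ?_
  exact h s ψ

theorem lin_eq_sum (v : Fin n ⊕ Fin n → ℂ) :
    LinearMap.mulLeft ℂ (lin n v) = ∑ j, v j • LinearMap.mulLeft ℂ (MvPolynomial.X j) := by
  refine LinearMap.ext fun b => ?_
  simp only [lin_apply, LinearMap.sum_apply, Finset.sum_mul, LinearMap.mulLeft_apply,
    LinearMap.smul_apply, smul_mul_assoc]

theorem koszulCoord_comm_lin (v : Fin n ⊕ Fin n → ℂ) (ψ : WeylPoly n →ₗ[ℂ] WeylPoly n) :
    koszulCoord n (comm (lin n v) ψ) = koszulCoord n ψ ∘ₗ LinearMap.mulLeft ℂ (lin n v) := by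
  rw [lin_eq_sum, lin_apply]
  simp only [map_sum, map_smul, LinearMap.sum_apply, LinearMap.smul_apply, koszulCoord_comm_X]
  refine LinearMap.ext fun b => ?_
  simp only [LinearMap.sum_apply, LinearMap.smul_apply, LinearMap.comp_apply, map_sum, map_smul]

theorem comm_lin_koszulCoord (v : Fin n ⊕ Fin n → ℂ) (ψ : WeylPoly n →ₗ[ℂ] WeylPoly n) :
    comm (lin n v) (koszulCoord n ψ) = koszulCoord n (ψ ∘ₗ LinearMap.mulLeft ℂ (lin n v)) := by
  have h := koszulCoord_comm_lin v (koszulCoord n ψ)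
  rw [koszulCoord_koszulCoord] at h
  rw [← h, koszulCoord_koszulCoord]

/-- A linear map that commutes with left multiplication by the coordinates and vanishes at `1` is
zero. -/
theorem eq_zero_of_comm_eq_zero {ψ : WeylPoly n →ₗ[ℂ] WeylPoly n}
    (h : ∀ v, comm (lin n v) ψ = 0) (h1 : ψ 1 = 0) : ψ = 0 := by
  have hX : ∀ j : Fin n ⊕ Fin n, lin n (Pi.single j 1) = MvPolynomial.X j := fun j => by
    simp [lin_apply, Pi.single_apply]
  suffices koszulCoord n ψ = 0 by rw [← koszulCoord_koszulCoord ψ, this, map_zero]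
  refine LinearMap.ext fun s => ?_
  induction s using MvPolynomial.induction_on with
  | C c => rw [koszulCoord_C, h1, smul_zero, LinearMap.zero_apply]
  | add p q hp hq => rw [map_add, hp, hq, map_add]
  | mul_X p j hp =>
    have h2 := congrArg (fun φ => φ p) (koszulCoord_comm_lin (Pi.single j 1) ψ)
    rw [h, hX, map_zero] at h2
    simpa [mul_comm] using h2.symm

/-- The linear map `X l * f ↦ f` that sends monomials prime to `X l` to zero. -/
def divX (l : Fin n ⊕ Fin n) : Module.End ℂ (WeylPoly n) where
  toFun f := f.divMonomial (Finsupp.single l 1)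
  map_add' f g := MvPolynomial.add_divMonomial f g _
  map_smul' c f := by
    ext t
    simp [MvPolynomial.coeff_divMonomial]

theorem divX_X_mul (l : Fin n ⊕ Fin n) (f : WeylPoly n) :
    divX l (MvPolynomial.X l * f) = f := MvPolynomial.X_mul_divMonomial l f

theorem divX_one (l : Fin n ⊕ Fin n) : divX l (1 : WeylPoly n) = 0 := by
  ext t
  rw [divX, LinearMap.coe_mk, AddHom.coe_mk, MvPolynomial.coeff_divMonomial, MvPolynomial.coeff_one,
    if_neg, MvPolynomial.coeff_zero]
  intro h
  have := DFunLike.congr_fun h l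
  simp at this
  omega

theorem divX_X_mul_of_ne {l m : Fin n ⊕ Fin n} (h : l ≠ m) (f : WeylPoly n) :
    divX l (MvPolynomial.X m * f) = MvPolynomial.X m * divX l f := by
  ext t
  simp only [divX, LinearMap.coe_mk, AddHom.coe_mk, MvPolynomial.coeff_divMonomial,
    MvPolynomial.coeff_X_mul']
  have h1 : m ∈ (Finsupp.single l 1 + t).support ↔ m ∈ t.support := by
    simp [h]
  simp only [h1]
  split_ifs with h2
  · congr 1
    ext i
    simp only [Finsupp.coe_tsub, Finsupp.coe_add, Pi.sub_apply, Pi.add_apply,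
      Finsupp.single_apply]
    have h3 : t m ≠ 0 := Finsupp.mem_support_iff.mp h2
    by_cases hm : m = i
    · subst hm
      simp [h]
    · simp [hm]
  · rfl

/-- A right inverse of the commutator with the image of `X l` under `g`: the involution
`koszulCoord` turns that commutator into composition with a multiplication, which the division
`divX l`, moved by `g`, inverts on one side. -/
def commSection (g : Matrix.symplecticGroup (Fin n) ℂ) (l : Fin n ⊕ Fin n) :
    Module.End ℂ (WeylPoly n →ₗ[ℂ] WeylPoly n) :=
  koszulCoord n ∘ₗ LinearMap.lcomp ℂ (WeylPoly n) ((subst g.1).toLinearMap ∘ₗ divX l ∘ₗ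
    (subst (g⁻¹).1).toLinearMap) ∘ₗ koszulCoord n

theorem commSection_apply (g : Matrix.symplecticGroup (Fin n) ℂ) (l : Fin n ⊕ Fin n)
    (ψ : WeylPoly n →ₗ[ℂ] WeylPoly n) :
    commSection g l ψ = koszulCoord n (koszulCoord n ψ ∘ₗ ((subst g.1).toLinearMap ∘ₗ divX l ∘ₗ
      (subst (g⁻¹).1).toLinearMap)) := rfl

theorem subst_inv_subst (g : Matrix.symplecticGroup (Fin n) ℂ) (a : WeylPoly n) :
    subst (g⁻¹).1 (subst g.1 a) = a := by
  rw [← subst_mul]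
  exact (congrArg (fun h : Matrix.symplecticGroup (Fin n) ℂ => subst h.1 a)
    (inv_mul_cancel g)).trans (subst_one a)

theorem subst_subst_inv (g : Matrix.symplecticGroup (Fin n) ℂ) (a : WeylPoly n) :
    subst g.1 (subst (g⁻¹).1 a) = a := by
  rw [← subst_mul]
  exact (congrArg (fun h : Matrix.symplecticGroup (Fin n) ℂ => subst h.1 a)
    (mul_inv_cancel g)).trans (subst_one a)

theorem subst_X_eq_lin (M : Matrix (Fin n ⊕ Fin n) (Fin n ⊕ Fin n) ℂ) (j : Fin n ⊕ Fin n) :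
    subst M (MvPolynomial.X j) = lin n (M.col j) := by
  rw [subst, MvPolynomial.aeval_X]
  rfl

theorem comm_commSection (g : Matrix.symplecticGroup (Fin n) ℂ) (l : Fin n ⊕ Fin n)
    (ψ : WeylPoly n →ₗ[ℂ] WeylPoly n) :
    comm (lin n (g.1.col l)) (commSection g l ψ) = ψ := by
  rw [commSection_apply, comm_lin_koszulCoord]
  conv_rhs => rw [← koszulCoord_koszulCoord ψ]
  congr 1
  refine LinearMap.ext fun b => ?_
  simp only [LinearMap.comp_apply, LinearMap.mulLeft_apply, AlgHom.toLinearMap_apply, map_mul,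
    ← subst_X_eq_lin, subst_inv_subst, divX_X_mul, subst_subst_inv]

theorem comm_commSection_of_ne (g : Matrix.symplecticGroup (Fin n) ℂ) {l m : Fin n ⊕ Fin n}
    (h : l ≠ m) (ψ : WeylPoly n →ₗ[ℂ] WeylPoly n) :
    comm (lin n (g.1.col m)) (commSection g l ψ)
      = commSection g l (comm (lin n (g.1.col m)) ψ) := by
  rw [commSection_apply, comm_lin_koszulCoord, commSection_apply, koszulCoord_comm_lin]
  congr 1
  refine LinearMap.ext fun b => ?_
  simp only [LinearMap.comp_apply, LinearMap.mulLeft_apply, AlgHom.toLinearMap_apply, map_mul,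
    ← subst_X_eq_lin, subst_inv_subst, divX_X_mul_of_ne h]

theorem commSection_one (g : Matrix.symplecticGroup (Fin n) ℂ) (l : Fin n ⊕ Fin n)
    (ψ : WeylPoly n →ₗ[ℂ] WeylPoly n) : commSection g l ψ 1 = 0 := by
  have h := koszulCoord_C (koszulCoord n ψ ∘ₗ ((subst g.1).toLinearMap ∘ₗ divX l ∘ₗ
      (subst (g⁻¹).1).toLinearMap)) 1
  rw [map_one, one_smul] at h
  rw [commSection_apply, h]
  simp [divX_one]

theorem comm_comm (v w : Fin n ⊕ Fin n → ℂ) (ψ : WeylPoly n →ₗ[ℂ] WeylPoly n) :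
    comm (lin n v) (comm (lin n w) ψ) = comm (lin n w) (comm (lin n v) ψ) := by
  rw [← koszulCoord_koszulCoord ψ]
  simp only [comm_lin_koszulCoord]
  congr 1
  refine LinearMap.ext fun b => ?_
  simp only [LinearMap.comp_apply, LinearMap.mulLeft_apply, mul_left_comm]

/-- The values of `commSection g l ψ` at linear polynomials, in terms of the dual of the basis of
the columns of `g`. -/
theorem commSection_lin (g : Matrix.symplecticGroup (Fin n) ℂ) (l : Fin n ⊕ Fin n)
    (ψ : WeylPoly n →ₗ[ℂ] WeylPoly n) (v : Fin n ⊕ Fin n → ℂ) :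
    commSection g l ψ (lin n v) = -((g⁻¹).1.mulVec v l • ψ 1) := by
  have h1 : ∀ w, commSection g l ψ (lin n w) = -comm (lin n w) (commSection g l ψ) 1 := by
    intro w
    rw [comm_apply, commSection_one, map_zero, zero_sub, neg_neg]
    congr 1
    exact ((moyal_C _ 1).trans (one_smul ℂ _)).symm
  have h2 : v = ∑ m, (g⁻¹).1.mulVec v m • g.1.col m := by
    have h3 : g.1.mulVec ((g⁻¹).1.mulVec v) = v := by
      rw [Matrix.mulVec_mulVec]
      exact (congrArg (fun h : Matrix.symplecticGroup (Fin n) ℂ => h.1.mulVec v)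
        (mul_inv_cancel g)).trans (Matrix.one_mulVec v)
    conv_lhs => rw [← h3]
    ext i
    simp [Matrix.mulVec, dotProduct, Finset.sum_apply, mul_comm]
  have h4 : comm (lin n v) (commSection g l ψ) 1
      = ∑ m, (g⁻¹).1.mulVec v m • comm (lin n (g.1.col m)) (commSection g l ψ) 1 := by
    conv_lhs => rw [h2]
    simp only [map_sum, map_smul, LinearMap.sum_apply, LinearMap.smul_apply]
  rw [h1, h4, Finset.sum_eq_single l]
  · rw [comm_commSection]
  · intro m _ hm
    rw [comm_commSection_of_ne g hm.symm, commSection_one, smul_zero]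
  · simp

end WeylPoly

/-! ### Twisted commutators on polynomials -/

namespace WeylPoly

variable {n : ℕ}

/-- The twisted commutator `P ↦ X l * P - c l • (P * X l)` for the Moyal product. -/
def twistComm (c : Fin n ⊕ Fin n → ℂ) (l : Fin n ⊕ Fin n) : Module.End ℂ (WeylPoly n) :=
  moyal n (MvPolynomial.X l) - c l • (moyal n).flip (MvPolynomial.X l)

variable {c : Fin n ⊕ Fin n → ℂ} {l m : Fin n ⊕ Fin n} {P : WeylPoly n}

theorem twistComm_apply (c : Fin n ⊕ Fin n → ℂ) (l : Fin n ⊕ Fin n) (P : WeylPoly n) :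
    twistComm c l P = (1 - c l) • (MvPolynomial.X l * P) + ((1 + c l) / 2) • ham l P := by
  rw [twistComm, LinearMap.sub_apply, LinearMap.smul_apply, LinearMap.flip_apply, X_moyal, moyal_X]
  module

theorem twistComm_apply_of_eq_one (hl : c l = 1) (P : WeylPoly n) :
    twistComm c l P = ham l P := by
  rw [twistComm_apply, hl]
  norm_num

theorem ham_comm (l m : Fin n ⊕ Fin n) (P : WeylPoly n) : ham l (ham m P) = ham m (ham l P) := by
  rcases m with m | m
  · exact ham_pderiv _ _ _
  · change ham l (-(MvPolynomial.pderiv (Sum.inl m) P))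
      = -(MvPolynomial.pderiv (Sum.inl m) (ham l P))
    rw [map_neg, ham_pderiv]

/-- The twisted commutators commute if the eigenvalues of dual coordinates are inverse to each
other. -/
theorem twistComm_comm (hc : ∀ l, c l * c l.swap = 1) (l m : Fin n ⊕ Fin n) (P : WeylPoly n) :
    twistComm c l (twistComm c m P) = twistComm c m (twistComm c l P) := by
  have hJ : Matrix.J (Fin n) ℂ m l = -Matrix.J (Fin n) ℂ l m := by
    rcases l with i | i <;> rcases m with j | j <;>
      simp [Matrix.J, Matrix.one_apply, eq_comm]
  have hJ' : Matrix.J (Fin n) ℂ l m * (1 - c l * c m) = 0 := by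
    by_cases h : m = l.swap
    · rw [h, hc, sub_self, mul_zero]
    · suffices Matrix.J (Fin n) ℂ l m = 0 by rw [this, zero_mul]
      rcases l with i | i <;> rcases m with j | j <;>
        simp_all [Matrix.J, Matrix.one_apply, eq_comm]
  have hX : ∀ i j : Fin n ⊕ Fin n, ham i (MvPolynomial.X j * P)
      = MvPolynomial.X j * ham i P - Matrix.J (Fin n) ℂ i j • P := by
    intro i j
    rw [Derivation.leibniz, ham_X, smul_eq_mul, smul_eq_mul, mul_comm P,
      ← MvPolynomial.smul_eq_C_mul]
    generalize Matrix.J (Fin n) ℂ i j = t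
    module
  simp only [twistComm_apply, map_add, Derivation.map_smul, hX, ham_comm m l, hJ,
    mul_smul_comm, mul_left_comm (MvPolynomial.X m) (MvPolynomial.X l)]
  generalize Matrix.J (Fin n) ℂ l m = t at hJ' ⊢
  rw [← sub_eq_zero]
  trans (-(t * (1 - c l * c m))) • P
  · module
  · rw [hJ', neg_zero, zero_smul]

/-- The polynomials in the coordinates in `A`. -/
def polyIn (A : Set (Fin n ⊕ Fin n)) : Submodule ℂ (WeylPoly n) where
  carrier := {P | ∀ t : Fin n ⊕ Fin n →₀ ℕ, ∀ i ∉ A, t i ≠ 0 → MvPolynomial.coeff t P = 0}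
  add_mem' hP hQ t i hi ht := by rw [MvPolynomial.coeff_add, hP t i hi ht, hQ t i hi ht, add_zero]
  zero_mem' _ _ _ _ := MvPolynomial.coeff_zero _
  smul_mem' c P hP t i hi ht := by rw [MvPolynomial.coeff_smul, hP t i hi ht, smul_zero]

theorem polyIn_mono {A B : Set (Fin n ⊕ Fin n)} (h : A ⊆ B) : polyIn A ≤ polyIn B :=
  fun _ hP t i hi ht => hP t i (fun hA => hi (h hA)) ht

theorem polyIn_univ : polyIn (Set.univ : Set (Fin n ⊕ Fin n)) = ⊤ :=
  eq_top_iff.mpr fun _ _ _ i hi _ => (hi (Set.mem_univ i)).elim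

theorem one_mem_polyIn (A : Set (Fin n ⊕ Fin n)) : (1 : WeylPoly n) ∈ polyIn A := by
  intro t i _ ht
  rw [MvPolynomial.coeff_one, if_neg]
  rintro rfl
  exact ht rfl

theorem mem_polyIn_empty : P ∈ polyIn (∅ : Set (Fin n ⊕ Fin n)) ↔ ∃ a : ℂ, P = a • 1 := by
  constructor
  · intro h
    refine ⟨MvPolynomial.coeff 0 P, ?_⟩
    ext t
    rw [MvPolynomial.coeff_smul, MvPolynomial.coeff_one]
    split_ifs with h0
    · rw [← h0, smul_eq_mul, mul_one]
    · obtain ⟨i, hi⟩ := DFunLike.ne_iff.mp (Ne.symm h0)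
      rw [h t i (Set.notMem_empty i) hi, smul_zero]
  · rintro ⟨a, rfl⟩
    exact Submodule.smul_mem _ _ (one_mem_polyIn _)

theorem X_mul_mem_polyIn {A : Set (Fin n ⊕ Fin n)} (hl : l ∈ A) (hP : P ∈ polyIn A) :
    MvPolynomial.X l * P ∈ polyIn A := by
  intro t i hi ht
  rw [MvPolynomial.coeff_X_mul']
  split_ifs
  · refine hP _ i hi ?_
    rwa [Finsupp.coe_tsub, Pi.sub_apply, Finsupp.single_eq_of_ne, tsub_zero]
    rintro rfl
    exact hi hl
  · rfl

/-- Up to sign, `ham l` differentiates with respect to the dual coordinate `l.swap`. -/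
theorem coeff_ham (l : Fin n ⊕ Fin n) (t : Fin n ⊕ Fin n →₀ ℕ) :
    ∃ a : ℂ, a ≠ 0 ∧ ∀ P : WeylPoly n, MvPolynomial.coeff t (ham l P)
      = a * MvPolynomial.coeff (t + Finsupp.single l.swap 1) P := by
  rcases l with l | l
  · refine ⟨t (Sum.inr l) + 1, Nat.cast_add_one_ne_zero _, fun P => ?_⟩
    rw [mul_comm]
    exact MvPolynomial.coeff_pderiv P t
  · refine ⟨-(t (Sum.inl l) + 1), neg_ne_zero.mpr (Nat.cast_add_one_ne_zero _), fun P => ?_⟩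
    rw [neg_mul, mul_comm]
    exact (MvPolynomial.coeff_neg _ t (MvPolynomial.pderiv (Sum.inl l) P)).trans
      (congrArg _ (MvPolynomial.coeff_pderiv P t))

theorem ham_mem_polyIn {A : Set (Fin n ⊕ Fin n)} (hP : P ∈ polyIn A) : ham l P ∈ polyIn A := by
  intro t i hi ht
  obtain ⟨a, -, ha⟩ := coeff_ham l t
  rw [ha, hP _ i hi, mul_zero]
  simp [ht]

theorem divX_mem_polyIn {A : Set (Fin n ⊕ Fin n)} (hP : P ∈ polyIn A) : divX l P ∈ polyIn A := by
  intro t i hi ht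
  refine (MvPolynomial.coeff_divMonomial _ _ _).trans (hP _ i hi ?_)
  simp [ht]

theorem twistComm_mem_polyIn {A : Set (Fin n ⊕ Fin n)} (hl : l ∈ A) (hP : P ∈ polyIn A) :
    twistComm c l P ∈ polyIn A := by
  rw [twistComm_apply]
  exact add_mem (Submodule.smul_mem _ _ (X_mul_mem_polyIn hl hP))
    (Submodule.smul_mem _ _ (ham_mem_polyIn hP))

/-- The remainder of the division by `X l` does not contain `X l`. -/
theorem sub_X_mul_divX_mem_polyIn {A : Set (Fin n ⊕ Fin n)} (hP : P ∈ polyIn A) :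
    P - MvPolynomial.X l * divX l P ∈ polyIn (A \ {l}) := by
  have h : P - MvPolynomial.X l * divX l P = P.modMonomial (Finsupp.single l 1) :=
    sub_eq_of_eq_add' (MvPolynomial.divMonomial_add_modMonomial_single P l).symm
  rw [h]
  intro t i hi ht
  by_cases hl : Finsupp.single l 1 ≤ t
  · exact MvPolynomial.coeff_modMonomial_of_le P hl
  · rw [MvPolynomial.coeff_modMonomial_of_not_le P hl]
    by_cases hA : i ∈ A
    · have hil : i = l := by
        by_contra h
        exact hi ⟨hA, h⟩
      subst hil
      exact (hl (by rw [Finsupp.single_le_iff]; omega)).elim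
    · exact hP t i hA ht

/-- For `c l ≠ 1` every class modulo the image of the twisted commutator has a representative
without `X l`. -/
theorem exists_sub_twistComm_mem (hl : c l ≠ 1) {A : Set (Fin n ⊕ Fin n)} (hP : P ∈ polyIn A) :
    ∃ Q ∈ polyIn A, P - twistComm c l Q ∈ polyIn (A \ {l}) := by
  have key : ∀ (N : ℕ) (P : WeylPoly n), P ∈ polyIn A →
      (∀ t : Fin n ⊕ Fin n →₀ ℕ, N ≤ t.degree → MvPolynomial.coeff t P = 0) →
      ∃ Q ∈ polyIn A, P - twistComm c l Q ∈ polyIn (A \ {l}) := by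
    intro N
    induction N with
    | zero =>
      intro P _ h
      have : P = 0 := MvPolynomial.ext _ _ fun t => by rw [h t (Nat.zero_le _)]; rfl
      exact ⟨0, zero_mem _, by simp [this]⟩
    | succ N ih =>
      intro P hP h
      have h1 : 1 - c l ≠ 0 := sub_ne_zero.mpr hl.symm
      set D := (1 - c l)⁻¹ • divX l P with hD
      have hDA : D ∈ polyIn A := Submodule.smul_mem _ _ (divX_mem_polyIn hP)
      -- the leading term of `twistComm c l D` is `X l * divX l P`, the rest has lower degree
      obtain ⟨Q, hQ, hQ'⟩ := ih (-(((1 + c l) / 2) • ham l D))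
        (neg_mem (Submodule.smul_mem _ _ (ham_mem_polyIn hDA))) (by
          intro t ht
          obtain ⟨a, -, ha⟩ := coeff_ham l t
          rw [MvPolynomial.coeff_neg, MvPolynomial.coeff_smul, ha, hD, MvPolynomial.coeff_smul]
          have h2 : MvPolynomial.coeff (t + Finsupp.single l.swap 1) (divX l P) = 0 := by
            refine (MvPolynomial.coeff_divMonomial _ _ _).trans (h _ ?_)
            simp only [map_add, Finsupp.degree_single]
            omega
          rw [h2]
          simp)
      refine ⟨D + Q, add_mem hDA hQ, ?_⟩
      have h3 := add_mem (sub_X_mul_divX_mem_polyIn (l := l) hP) hQ'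
      convert h3 using 1
      rw [map_add, twistComm_apply c l D, hD, mul_smul_comm, smul_smul, mul_inv_cancel₀ h1]
      module
  obtain ⟨N, hN⟩ : ∃ N : ℕ, ∀ t : Fin n ⊕ Fin n →₀ ℕ, N ≤ t.degree →
      MvPolynomial.coeff t P = 0 := by
    refine ⟨P.totalDegree + 1, fun t ht => ?_⟩
    refine MvPolynomial.coeff_eq_zero_of_totalDegree_lt ?_
    rw [Finsupp.degree_apply] at ht
    exact ht
  exact key N P hP hN

/-- For `c l ≠ 1` the twisted commutator is injective, and its image contains no nonzero polynomial
without `X l`. -/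
theorem eq_zero_of_twistComm_mem (hl : c l ≠ 1) {A : Set (Fin n ⊕ Fin n)}
    (h : twistComm c l P ∈ polyIn (A \ {l})) : P = 0 := by
  by_contra hP
  -- a monomial of `P` of maximal degree in `X l`
  obtain ⟨t, ht, hmax⟩ := P.support.exists_max_image (fun t => t l)
    (MvPolynomial.support_nonempty.mpr hP)
  have h1 := h (t + Finsupp.single l 1) l (by simp) (by simp)
  obtain ⟨a, -, ha⟩ := coeff_ham l (t + Finsupp.single l 1)
  have h2 : MvPolynomial.coeff (t + Finsupp.single l 1 + Finsupp.single l.swap 1) P = 0 := by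
    by_contra h3
    have h4 := hmax _ (MvPolynomial.mem_support_iff.mpr h3)
    simp only [Finsupp.coe_add, Pi.add_apply, Finsupp.single_eq_same] at h4
    omega
  rw [twistComm_apply, MvPolynomial.coeff_add, MvPolynomial.coeff_smul, MvPolynomial.coeff_smul,
    ha, h2, add_comm t, MvPolynomial.coeff_X_mul, mul_zero, smul_zero, add_zero, smul_eq_mul,
    mul_eq_zero] at h1
  exact h1.elim (sub_ne_zero.mpr hl.symm) (MvPolynomial.mem_support_iff.mp ht)

/-- The twisted commutators with `c l ≠ 1` form a regular sequence, so their images do not span the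
constants. -/
theorem one_ne_sum_twistComm (hc : ∀ l, c l * c l.swap = 1) (s : Finset (Fin n ⊕ Fin n))
    (hs : ∀ l ∈ s, c l ≠ 1) (A : Set (Fin n ⊕ Fin n)) (hsA : ↑s ⊆ A)
    (P : Fin n ⊕ Fin n → WeylPoly n) (hP : ∀ l ∈ s, P l ∈ polyIn A) :
    (1 : WeylPoly n) ≠ ∑ l ∈ s, twistComm c l (P l) := by
  induction s using Finset.induction_on generalizing A P with
  | empty => simp
  | insert l s hl ih =>
    intro h
    have hl1 := hs l (by simp)
    have h1 : ∀ m, ∃ Q, m ∈ s → Q ∈ polyIn A ∧ P m - twistComm c l Q ∈ polyIn (A \ {l}) := by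
      intro m
      by_cases hm : m ∈ s
      · obtain ⟨Q, hQ⟩ := exists_sub_twistComm_mem hl1 (hP m (Finset.mem_insert_of_mem hm))
        exact ⟨Q, fun _ => hQ⟩
      · exact ⟨0, fun h => (hm h).elim⟩
    choose Q hQ using h1
    have hsA' : ↑s ⊆ A \ {l} := fun m hm => ⟨hsA (Finset.mem_insert_of_mem hm), by
      rintro rfl
      exact hl hm⟩
    refine ih (fun m hm => hs m (Finset.mem_insert_of_mem hm)) (A \ {l}) hsA'
      (fun m => P m - twistComm c l (Q m)) (fun m hm => (hQ m hm).2) ?_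
    have h2 : (1 : WeylPoly n) - ∑ m ∈ s, twistComm c m (P m - twistComm c l (Q m))
        = twistComm c l (P l + ∑ m ∈ s, twistComm c m (Q m)) := by
      rw [h, Finset.sum_insert hl, map_add, map_sum]
      simp only [map_sub, Finset.sum_sub_distrib, twistComm_comm hc l]
      abel
    have h3 := eq_zero_of_twistComm_mem (A := A) hl1 (by
      rw [← h2]
      refine sub_mem (one_mem_polyIn _) (sum_mem fun m hm => ?_)
      exact twistComm_mem_polyIn (hsA' hm) (hQ m hm).2)
    rw [h3, map_zero] at h2
    exact sub_eq_zero.mp h2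

/-- The Hamiltonian derivation of `X l` has a right inverse that commutes with those of the other
coordinates. -/
theorem exists_ham_section (l : Fin n ⊕ Fin n) : ∃ I : Module.End ℂ (WeylPoly n),
    (∀ P, ham l (I P) = P) ∧ ∀ m ≠ l, ∀ P, ham m (I P) = I (ham m P) := by
  -- integration with respect to a coordinate
  let I : (Fin n ⊕ Fin n) → Module.End ℂ (WeylPoly n) := fun i =>
    (MvPolynomial.basisMonomials _ ℂ).constr ℂ
      fun t => MvPolynomial.monomial (t + Finsupp.single i 1) ((t i + 1 : ℂ)⁻¹)
  have hI : ∀ i t r, I i (MvPolynomial.monomial t r)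
      = MvPolynomial.monomial (t + Finsupp.single i 1) (r * (t i + 1 : ℂ)⁻¹) := by
    intro i t r
    have h1 : MvPolynomial.monomial t r
        = r • (MvPolynomial.basisMonomials (Fin n ⊕ Fin n) ℂ) t := by
      rw [MvPolynomial.coe_basisMonomials, MvPolynomial.smul_monomial, smul_eq_mul, mul_one]
    rw [h1, map_smul]
    simp only [I]
    rw [Module.Basis.constr_basis, MvPolynomial.smul_monomial, smul_eq_mul]
  have h1 : ∀ i P, MvPolynomial.pderiv i (I i P) = P := by
    intro i P
    induction P using MvPolynomial.induction_on' with
    | monomial t r =>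
      rw [hI, MvPolynomial.pderiv_monomial, add_tsub_cancel_right]
      congr 1
      have : (t i + 1 : ℂ) ≠ 0 := Nat.cast_add_one_ne_zero _
      simp [this]
    | add P Q hP hQ => rw [map_add, map_add, hP, hQ]
  have h2 : ∀ i j, j ≠ i → ∀ P, MvPolynomial.pderiv j (I i P) = I i (MvPolynomial.pderiv j P) := by
    intro i j hij P
    induction P using MvPolynomial.induction_on' with
    | monomial t r =>
      rw [hI, MvPolynomial.pderiv_monomial, MvPolynomial.pderiv_monomial, hI]
      by_cases h0 : t j = 0
      · simp [h0, hij, hij.symm]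
      · have h3 : t + Finsupp.single i 1 - Finsupp.single j 1
            = t - Finsupp.single j 1 + Finsupp.single i 1 := by
          ext k
          simp only [Finsupp.coe_tsub, Finsupp.coe_add, Pi.sub_apply, Pi.add_apply,
            Finsupp.single_apply]
          by_cases hk : j = k
          · subst hk
            simp [hij.symm]
          · simp [hk]
        rw [h3]
        congr 1
        simp only [Finsupp.coe_tsub, Finsupp.coe_add, Pi.sub_apply, Pi.add_apply,
          Finsupp.single_eq_of_ne hij, Finsupp.single_eq_of_ne hij.symm, add_zero, tsub_zero]
        ring
    | add P Q hP hQ => simp only [map_add, hP, hQ]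
  rcases l with l | l
  · refine ⟨I (Sum.inr l), h1 _, fun m hm P => ?_⟩
    rcases m with m | m
    · exact h2 _ _ (fun h => hm (by simpa using h)) P
    · have := h2 (Sum.inr l) (Sum.inl m) (by simp) P
      change -(MvPolynomial.pderiv (Sum.inl m) _) = I _ (-(MvPolynomial.pderiv (Sum.inl m) P))
      rw [this, map_neg]
  · refine ⟨-I (Sum.inl l), fun P => ?_, fun m hm P => ?_⟩
    · change -(MvPolynomial.pderiv (Sum.inl l) (-(I (Sum.inl l) P))) = P
      rw [map_neg, neg_neg, h1]
    · rcases m with m | m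
      · have := h2 (Sum.inl l) (Sum.inr m) (by simp) P
        change MvPolynomial.pderiv (Sum.inr m) (-(I (Sum.inl l) P)) = -I (Sum.inl l) _
        rw [map_neg, this]
        rfl
      · have := h2 (Sum.inl l) (Sum.inl m) (fun h => hm (by simpa using h)) P
        change -(MvPolynomial.pderiv (Sum.inl m) (-(I (Sum.inl l) P)))
          = -I (Sum.inl l) (-(MvPolynomial.pderiv (Sum.inl m) P))
        rw [map_neg, map_neg, this]

/-- The polynomials annihilated by the Hamiltonian derivations of the coordinates in `A`. -/
def hamKer (A : Set (Fin n ⊕ Fin n)) : Submodule ℂ (WeylPoly n) where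
  carrier := {P | ∀ l ∈ A, ham l P = 0}
  add_mem' hP hQ l hl := by rw [map_add, hP l hl, hQ l hl, add_zero]
  zero_mem' l _ := map_zero _
  smul_mem' c P hP l hl := by rw [Derivation.map_smul, hP l hl, smul_zero]

theorem mem_hamKer {A : Set (Fin n ⊕ Fin n)} : P ∈ hamKer A ↔ ∀ l ∈ A, ham l P = 0 := Iff.rfl

theorem exists_ham_eq {A : Set (Fin n ⊕ Fin n)} (hl : l ∉ A) (hP : P ∈ hamKer A) :
    ∃ Q ∈ hamKer A, ham l Q = P := by
  obtain ⟨I, h1, h2⟩ := exists_ham_section l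
  refine ⟨I P, fun m hm => ?_, h1 P⟩
  rw [h2 m (fun h => hl (h ▸ hm)), hP m hm, map_zero]

/-- The derivations in `A` differentiate with respect to the duals of the coordinates in `A`, which
are again in `A`. -/
theorem hamKer_eq_polyIn {A : Set (Fin n ⊕ Fin n)} (hA : ∀ l, l ∈ A ↔ l.swap ∈ A) :
    hamKer A = polyIn Aᶜ := by
  ext P
  constructor
  · intro h t i hi ht
    rw [Set.notMem_compl_iff, hA] at hi
    obtain ⟨a, ha, h1⟩ := coeff_ham i.swap (t - Finsupp.single i 1)
    have h2 := h1 P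
    rw [h _ hi, MvPolynomial.coeff_zero, Sum.swap_swap,
      tsub_add_cancel_of_le (by rw [Finsupp.single_le_iff]; omega)] at h2
    exact (mul_eq_zero.mp h2.symm).resolve_left ha
  · intro h l hl
    ext t
    obtain ⟨a, -, h1⟩ := coeff_ham l t
    rw [h1, h _ l.swap (by rw [Set.notMem_compl_iff]; exact (hA l).mp hl) (by simp), mul_zero,
      MvPolynomial.coeff_zero]

end WeylPoly

/-! ### A symplectic basis of eigenvectors -/

namespace SymplecticMap

variable {n : ℕ}

/-- The canonical two-form as a bilinear map. -/
def omegaForm (n : ℕ) : (Fin n ⊕ Fin n → ℂ) →ₗ[ℂ] (Fin n ⊕ Fin n → ℂ) →ₗ[ℂ] ℂ :=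
  LinearMap.mk₂ ℂ omega
    (fun v v' w => by
      simp only [omega, Pi.add_apply, ← Finset.sum_add_distrib]
      exact Finset.sum_congr rfl fun i _ => by ring)
    (fun c v w => by
      simp only [omega, Pi.smul_apply, smul_eq_mul, Finset.mul_sum]
      exact Finset.sum_congr rfl fun i _ => by ring)
    (fun v w w' => by
      simp only [omega, Pi.add_apply, ← Finset.sum_add_distrib]
      exact Finset.sum_congr rfl fun i _ => by ring)
    (fun c v w => by
      simp only [omega, Pi.smul_apply, smul_eq_mul, Finset.mul_sum]
      exact Finset.sum_congr rfl fun i _ => by ring)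

theorem omegaForm_apply (v w : Fin n ⊕ Fin n → ℂ) : omegaForm n v w = omega v w := rfl

theorem omega_swap (v w : Fin n ⊕ Fin n → ℂ) : omega w v = -omega v w := by
  simp only [omega, ← Finset.sum_neg_distrib]
  exact Finset.sum_congr rfl fun i _ => by ring

theorem omega_eq_dotProduct (v w : Fin n ⊕ Fin n → ℂ) :
    omega v w = -(v ⬝ᵥ (Matrix.J (Fin n) ℂ).mulVec w) := by
  simp only [omega, dotProduct, Fintype.sum_sum_type, Matrix.mulVec, Matrix.J, Matrix.fromBlocks,
    Matrix.of_apply, Sum.elim_inl, Sum.elim_inr, Matrix.zero_apply, Matrix.neg_apply,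
    Matrix.one_apply, zero_mul, Finset.sum_const_zero, zero_add, add_zero, neg_mul, ite_mul,
    one_mul, Finset.sum_neg_distrib, Finset.sum_ite_eq, Finset.mem_univ, if_true, mul_neg,
    neg_add_rev, neg_neg, Finset.sum_sub_distrib]
  ring

theorem omega_mulVec_mulVec (M : Matrix (Fin n ⊕ Fin n) (Fin n ⊕ Fin n) ℂ)
    (v w : Fin n ⊕ Fin n → ℂ) : omega (M.mulVec v) (M.mulVec w)
      = -(v ⬝ᵥ (M.transpose * Matrix.J (Fin n) ℂ * M).mulVec w) := by
  rw [omega_eq_dotProduct, ← Matrix.mulVec_mulVec, ← Matrix.mulVec_mulVec,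
    Matrix.dotProduct_mulVec v, Matrix.vecMul_transpose]

theorem omega_toEnd (σ : Matrix.symplecticGroup (Fin n) ℂ) (v w : Fin n ⊕ Fin n → ℂ) :
    omega (toEnd σ v) (toEnd σ w) = omega v w := by
  rw [toEnd, Matrix.toLin'_apply, Matrix.toLin'_apply, omega_mulVec_mulVec,
    SymplecticGroup.mem_iff'.mp σ.2, ← omega_eq_dotProduct]

theorem omega_single_right (v : Fin n ⊕ Fin n → ℂ) (i : Fin n) :
    omega v (Pi.single (Sum.inr i) 1) = v (Sum.inl i) := by
  simp [omega, Pi.single_apply]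

theorem omega_single_left (v : Fin n ⊕ Fin n → ℂ) (i : Fin n) :
    omega v (Pi.single (Sum.inl i) 1) = -v (Sum.inr i) := by
  simp [omega, Pi.single_apply]

theorem eq_zero_of_omega_eq_zero {v : Fin n ⊕ Fin n → ℂ} (h : ∀ w, omega v w = 0) : v = 0 := by
  funext i
  rcases i with i | i
  · rw [← omega_single_right v, h, Pi.zero_apply]
  · simpa [omega_single_left] using h (Pi.single (Sum.inl i) 1)

/-- A partial symplectic basis of eigenvectors. -/
structure IsPartialEigenbasis (σ : Matrix.symplecticGroup (Fin n) ℂ) {m : ℕ}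
    (u w : Fin m → Fin n ⊕ Fin n → ℂ) (a b : Fin m → ℂ) : Prop where
  eigen_u : ∀ i, toEnd σ (u i) = a i • u i
  eigen_w : ∀ i, toEnd σ (w i) = b i • w i
  uw : ∀ i j, omega (u i) (w j) = if i = j then 1 else 0
  uu : ∀ i j, omega (u i) (u j) = 0
  ww : ∀ i j, omega (w i) (w j) = 0

theorem mul_eq_one_of_omega_ne_zero {σ : Matrix.symplecticGroup (Fin n) ℂ}
    {v w : Fin n ⊕ Fin n → ℂ} {a b : ℂ} (hv : toEnd σ v = a • v) (hw : toEnd σ w = b • w)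
    (h : omega v w ≠ 0) : a * b = 1 := by
  have h1 := omega_toEnd σ v w
  rw [hv, hw, ← omegaForm_apply, map_smul, LinearMap.map_smul₂, omegaForm_apply, smul_eq_mul,
    smul_eq_mul] at h1
  exact mul_right_cancel₀ h (by linear_combination h1)

/-- A partial symplectic basis of eigenvectors that does not span can be enlarged: the projections
of eigenvectors on the orthogonal complement are eigenvectors, and span it. -/
theorem IsPartialEigenbasis.exists_orthogonal_pair {σ : Matrix.symplecticGroup (Fin n) ℂ}
    (hσ : IsDiagonalizable σ) {m : ℕ} (hm : m < n) {u w : Fin m → Fin n ⊕ Fin n → ℂ}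
    {a b : Fin m → ℂ} (h : IsPartialEigenbasis σ u w a b) :
    ∃ (z z' : Fin n ⊕ Fin n → ℂ) (c c' : ℂ), toEnd σ z = c • z ∧ toEnd σ z' = c' • z' ∧
      omega z z' = 1 ∧ ∀ i, omega z (u i) = 0 ∧ omega z (w i) = 0 ∧ omega z' (u i) = 0 ∧
        omega z' (w i) = 0 := by
  obtain ⟨e, he⟩ := hσ
  choose d hd using he
  let π : (Fin n ⊕ Fin n → ℂ) → Fin n ⊕ Fin n → ℂ := fun v =>
    v - ∑ i, (omega v (w i) • u i - omega v (u i) • w i)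
  have hwu : ∀ i j, omega (w i) (u j) = if i = j then -1 else 0 := by
    intro i j
    rw [omega_swap, h.uw]
    split_ifs with h1 h2 h2 <;> simp_all [eq_comm]
  have hπu : ∀ v j, omega (π v) (u j) = 0 := by
    intro v j
    have : omegaForm n (π v) (u j) = 0 := by
      simp only [π, map_sub, map_sum, map_smul, LinearMap.sub_apply, LinearMap.sum_apply,
        LinearMap.smul_apply, omegaForm_apply, h.uu, hwu, smul_eq_mul, mul_zero, mul_ite, mul_neg,
        mul_one, zero_sub, Finset.sum_neg_distrib, Finset.sum_ite_eq', Finset.mem_univ, if_true]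
      ring
    exact this
  have hπw : ∀ v j, omega (π v) (w j) = 0 := by
    intro v j
    have : omegaForm n (π v) (w j) = 0 := by
      simp only [π, map_sub, map_sum, map_smul, LinearMap.sub_apply, LinearMap.sum_apply,
        LinearMap.smul_apply, omegaForm_apply, h.ww, h.uw, smul_eq_mul, mul_zero, mul_ite,
        mul_one, sub_zero, Finset.sum_ite_eq', Finset.mem_univ, if_true, sub_self]
    exact this
  have hab : ∀ i, a i * b i = 1 := fun i =>
    mul_eq_one_of_omega_ne_zero (h.eigen_u i) (h.eigen_w i) (by rw [h.uw]; simp)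
  have heig : ∀ k, toEnd σ (π (e k)) = d k • π (e k) := by
    intro k
    simp only [π, map_sub, map_sum, map_smul, hd, h.eigen_u, h.eigen_w, smul_sub, Finset.smul_sum]
    congr 1
    refine Finset.sum_congr rfl fun i _ => ?_
    congr 1
    · by_cases h0 : omega (e k) (w i) = 0
      · simp [h0]
      · have h1 := mul_eq_one_of_omega_ne_zero (hd k) (h.eigen_w i) h0
        have hb : b i ≠ 0 := right_ne_zero_of_mul_eq_one h1
        rw [mul_right_cancel₀ hb ((hab i).trans h1.symm), smul_comm]
    · by_cases h0 : omega (e k) (u i) = 0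
      · simp [h0]
      · have h1 := mul_eq_one_of_omega_ne_zero (hd k) (h.eigen_u i) h0
        have ha : a i ≠ 0 := right_ne_zero_of_mul_eq_one h1
        rw [mul_right_cancel₀ ha (((mul_comm _ _).trans (hab i)).trans h1.symm), smul_comm]
  obtain ⟨k, hk⟩ : ∃ k, π (e k) ≠ 0 := by
    by_contra! hall
    -- otherwise the `2 m` vectors `u i`, `w i` span the space
    have hspan : Submodule.span ℂ (Set.range (Sum.elim u w)) = ⊤ := by
      rw [eq_top_iff, ← e.span_eq, Submodule.span_le]
      rintro _ ⟨k, rfl⟩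
      rw [sub_eq_zero.mp (hall k)]
      refine sum_mem fun i _ => sub_mem (Submodule.smul_mem _ _ (Submodule.subset_span ?_))
        (Submodule.smul_mem _ _ (Submodule.subset_span ?_))
      · exact ⟨Sum.inl i, rfl⟩
      · exact ⟨Sum.inr i, rfl⟩
    have h1 := finrank_range_le_card (R := ℂ) (Sum.elim u w)
    rw [Set.finrank, hspan, finrank_top, Module.finrank_fintype_fun_eq_card] at h1
    simp only [Fintype.card_sum, Fintype.card_fin] at h1
    omega
  obtain ⟨l, hl⟩ : ∃ l, omega (π (e k)) (e l) ≠ 0 := by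
    by_contra! hall
    refine hk (eq_zero_of_omega_eq_zero fun v => ?_)
    have h1 : omegaForm n (π (e k)) = 0 := e.ext hall
    rw [← omegaForm_apply, h1, LinearMap.zero_apply]
  have hl' : omega (π (e k)) (π (e l)) = omega (π (e k)) (e l) := by
    have h1 : omegaForm n (π (e k)) (π (e l)) = omegaForm n (π (e k)) (e l)
        - ∑ i, (omega (e l) (w i) • omegaForm n (π (e k)) (u i)
          - omega (e l) (u i) • omegaForm n (π (e k)) (w i)) := by
      generalize omegaForm n (π (e k)) = z
      simp only [π, map_sub, map_sum, map_smul]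
    simp only [omegaForm_apply, hπu, hπw, smul_zero, sub_zero, Finset.sum_const_zero] at h1
    exact h1
  have hsm : ∀ (c : ℂ) (v v' : Fin n ⊕ Fin n → ℂ), omega (c • v) v' = c * omega v v' :=
    fun c v v' => (LinearMap.map_smul₂ (omegaForm n) c v v')
  refine ⟨(omega (π (e k)) (e l))⁻¹ • π (e k), π (e l), d k, d l, ?_, heig l, ?_, fun i => ?_⟩
  · rw [map_smul, heig, smul_comm]
  · rw [hsm, hl', inv_mul_cancel₀ hl]
  · simp only [hsm, hπu, hπw, mul_zero, and_self]

theorem exists_partialEigenbasis {σ : Matrix.symplecticGroup (Fin n) ℂ}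
    (hσ : IsDiagonalizable σ) (m : ℕ) (hm : m ≤ n) :
    ∃ (u w : Fin m → Fin n ⊕ Fin n → ℂ) (a b : Fin m → ℂ), IsPartialEigenbasis σ u w a b := by
  induction m with
  | zero =>
    exact ⟨Fin.elim0, Fin.elim0, Fin.elim0, Fin.elim0, fun i => i.elim0, fun i => i.elim0,
      fun i => i.elim0, fun i => i.elim0, fun i => i.elim0⟩
  | succ m ih =>
    obtain ⟨u, w, a, b, h⟩ := ih (by omega)
    obtain ⟨z, z', c, c', hz, hz', h1, h2⟩ := h.exists_orthogonal_pair hσ (by omega)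
    have hself : ∀ v : Fin n ⊕ Fin n → ℂ, omega v v = 0 := fun v => by
      simp [omega, mul_comm]
    refine ⟨Fin.cons z u, Fin.cons z' w, Fin.cons c a, Fin.cons c' b, ?_, ?_, ?_, ?_, ?_⟩
    · exact Fin.cases hz h.eigen_u
    · exact Fin.cases hz' h.eigen_w
    · intro i j
      refine Fin.cases ?_ (fun i => ?_) i <;> refine Fin.cases ?_ (fun j => ?_) j
      · simpa using h1
      · simpa [(Fin.succ_ne_zero j).symm] using (h2 j).2.1
      · simp only [Fin.cons_succ, Fin.cons_zero, Fin.succ_ne_zero, if_false]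
        rw [omega_swap, (h2 i).2.2.1, neg_zero]
      · simpa using h.uw i j
    · intro i j
      refine Fin.cases ?_ (fun i => ?_) i <;> refine Fin.cases ?_ (fun j => ?_) j
      · exact hself z
      · exact (h2 j).1
      · rw [omega_swap]
        exact neg_eq_zero.mpr (h2 i).1
      · exact h.uu i j
    · intro i j
      refine Fin.cases ?_ (fun i => ?_) i <;> refine Fin.cases ?_ (fun j => ?_) j
      · exact hself z'
      · exact (h2 j).2.2.2
      · rw [omega_swap]
        exact neg_eq_zero.mpr (h2 i).2.2.2
      · exact h.ww i j

/-- A diagonalizable symplectic map has a symplectic basis of eigenvectors. -/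
theorem exists_eigenbasis {σ : Matrix.symplecticGroup (Fin n) ℂ} (hσ : IsDiagonalizable σ) :
    ∃ (g : Matrix.symplecticGroup (Fin n) ℂ) (c : Fin n ⊕ Fin n → ℂ),
      (∀ l, toEnd σ (g.1.col l) = c l • g.1.col l) ∧ ∀ l, c l * c l.swap = 1 := by
  obtain ⟨u, w, a, b, h⟩ := exists_partialEigenbasis hσ n le_rfl
  have hab : ∀ i, a i * b i = 1 := fun i =>
    mul_eq_one_of_omega_ne_zero (h.eigen_u i) (h.eigen_w i) (by rw [h.uw]; simp)
  let M : Matrix (Fin n ⊕ Fin n) (Fin n ⊕ Fin n) ℂ := Matrix.of fun i l => Sum.elim u w l i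
  have hcol : ∀ l, M.col l = Sum.elim u w l := fun l => rfl
  have hM : M ∈ Matrix.symplecticGroup (Fin n) ℂ := by
    rw [SymplecticGroup.mem_iff']
    ext i j
    have h1 : (M.transpose * Matrix.J (Fin n) ℂ * M) i j
        = -omega (Sum.elim u w i) (Sum.elim u w j) := by
      have h2 := omega_mulVec_mulVec M (Pi.single i 1) (Pi.single j 1)
      rw [Matrix.mulVec_single_one, Matrix.mulVec_single_one, Matrix.mulVec_single_one,
        single_one_dotProduct] at h2
      rw [← hcol, ← hcol, h2, neg_neg]
      rfl
    rw [h1]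
    rcases i with i | i <;> rcases j with j | j
    · simp [h.uu, Matrix.J]
    · simp [h.uw, Matrix.J, Matrix.one_apply]
    · rw [omega_swap]
      simp [h.uw, Matrix.J, Matrix.one_apply, eq_comm]
    · simp [h.ww, Matrix.J]
  refine ⟨⟨M, hM⟩, Sum.elim a b, ?_, ?_⟩
  · rintro (i | i)
    · exact h.eigen_u i
    · exact h.eigen_w i
  · rintro (i | i)
    · exact hab i
    · exact (mul_comm _ _).trans (hab i)

end SymplecticMap

/-! ### The volume form of the moved space -/

/-- The value of the Pfaffian pairing `⟨2 i, 2 i + 1⟩ = 1` on the points `a`, `b`. -/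
def pairing (a b : ℕ) : ℤ := if a / 2 = b / 2 then (b % 2 : ℕ) - (a % 2 : ℕ) else 0

/-- A permutation that maps pairs `{2 i, 2 i + 1}` to pairs is a permutation of the pairs followed
by transpositions inside pairs, and the former is even. So each nonzero term in the Pfaffian of the
standard pairing is `1`. -/
theorem sign_mul_prod_pairing {k : ℕ} (τ : Equiv.Perm (Fin k × Fin 2))
    (h : ∀ i, (τ (i, 0)).1 = (τ (i, 1)).1) :
    (Equiv.Perm.sign τ : ℤ) * ∏ i, (((τ (i, 1)).2 : ℕ) - ((τ (i, 0)).2 : ℕ) : ℤ) = 1 := by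
  have hfst : ∀ i j, (τ (i, j)).1 = (τ (i, 0)).1 := by
    intro i j
    fin_cases j
    · rfl
    · exact (h i).symm
  have hsurj : Function.Surjective fun i => (τ (i, 0)).1 := by
    intro m
    obtain ⟨⟨i, j⟩, hij⟩ := τ.surjective (m, 0)
    exact ⟨i, by simp only; rw [← hfst i j, hij]⟩
  let π : Equiv.Perm (Fin k) := Equiv.ofBijective _ (Finite.surjective_iff_bijective.mp hsurj)
  have hinj : ∀ i, Function.Injective fun j => (τ (i, j)).2 := by
    intro i j j' hj
    have : τ (i, j) = τ (i, j') := Prod.ext (by rw [hfst, hfst i j']) hj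
    simpa using this
  let φ : Fin k → Equiv.Perm (Fin 2) := fun i =>
    Equiv.ofBijective _ (Finite.injective_iff_bijective.mp (hinj i))
  have hτ : τ = Equiv.prodCongrLeft (fun _ => π) * Equiv.prodCongrRight φ := by
    ext1 ⟨i, j⟩
    rw [Equiv.Perm.mul_apply, Equiv.prodCongrRight_apply, Equiv.prodCongrLeft_apply]
    exact Prod.ext (hfst i j) rfl
  have hφ : ∀ ψ : Equiv.Perm (Fin 2),
      (Equiv.Perm.sign ψ : ℤ) * (((ψ 1 : Fin 2) : ℕ) - ((ψ 0 : Fin 2) : ℕ) : ℤ) = 1 := by decide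
  have hsign : (Equiv.Perm.sign τ : ℤ) = ∏ i, (Equiv.Perm.sign (φ i) : ℤ) := by
    conv_lhs => rw [hτ]
    rw [Equiv.Perm.sign_mul, Equiv.Perm.sign_prodCongrLeft, Equiv.Perm.sign_prodCongrRight,
      Fin.prod_univ_two, Int.units_mul_self, one_mul, Units.coe_prod]
  rw [hsign, ← Finset.prod_mul_distrib]
  exact Finset.prod_eq_one fun i _ => hφ (φ i)

/-- All terms of this sum are `0` or `1`, and that of the identity is `1`. -/
theorem sum_sign_mul_prod_pairing_ne_zero (k : ℕ) :
    ∑ τ : Equiv.Perm (Fin (2 * k)), (Equiv.Perm.sign τ : ℤ) *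
      ∏ i : Fin k, pairing (τ ⟨2 * i, by omega⟩) (τ ⟨2 * i + 1, by omega⟩) ≠ 0 := by
  have hterm : ∀ τ : Equiv.Perm (Fin (2 * k)), 0 ≤ (Equiv.Perm.sign τ : ℤ) *
      ∏ i : Fin k, pairing (τ ⟨2 * i, by omega⟩) (τ ⟨2 * i + 1, by omega⟩) := by
    intro τ
    by_cases h : ∀ i : Fin k, (τ ⟨2 * i, by omega⟩ : ℕ) / 2 = (τ ⟨2 * i + 1, by omega⟩ : ℕ) / 2
    · let E : Fin k × Fin 2 ≃ Fin (2 * k) := finProdFinEquiv.trans (finCongr (mul_comm k 2))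
      have hE : ∀ i j, ((E (i, j) : Fin (2 * k)) : ℕ) = 2 * i + j := fun i j => by
        simp [E, finProdFinEquiv, add_comm]
      have hE1 : ∀ x, ((E.symm x).1 : ℕ) = (x : ℕ) / 2 ∧ ((E.symm x).2 : ℕ) = (x : ℕ) % 2 := by
        intro x
        have h1 := hE (E.symm x).1 (E.symm x).2
        rw [Prod.mk.eta, Equiv.apply_symm_apply] at h1
        omega
      have h0 : ∀ i : Fin k, (⟨2 * i, by omega⟩ : Fin (2 * k)) = E (i, 0) := fun i =>
        Fin.ext (by rw [hE]; simp)
      have h0' : ∀ i : Fin k, (⟨2 * i + 1, by omega⟩ : Fin (2 * k)) = E (i, 1) := fun i =>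
        Fin.ext (by rw [hE]; simp)
      have h1 := sign_mul_prod_pairing ((E.trans τ).trans E.symm) (by
        intro i
        refine Fin.ext ?_
        simp only [Equiv.trans_apply, (hE1 _).1, ← h0, ← h0']
        exact h i)
      have h2 : Equiv.Perm.sign ((E.trans τ).trans E.symm) = Equiv.Perm.sign τ :=
        Equiv.Perm.sign_symm_trans_trans τ E.symm
      rw [h2] at h1
      simp only [Equiv.trans_apply, (hE1 _).2, ← h0, ← h0'] at h1
      have h3 : ∀ i : Fin k, pairing (τ ⟨2 * i, by omega⟩) (τ ⟨2 * i + 1, by omega⟩)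
          = (((τ ⟨2 * i + 1, by omega⟩ : ℕ) % 2 : ℕ) : ℤ) - ((τ ⟨2 * i, by omega⟩ : ℕ) % 2 : ℕ) :=
        fun i => by rw [pairing, if_pos (h i)]
      simp only [h3]
      rw [h1]
      exact zero_le_one
    · push Not at h
      obtain ⟨i, hi⟩ := h
      rw [Finset.prod_eq_zero (Finset.mem_univ i) (by rw [pairing, if_neg hi]), mul_zero]
  refine (Finset.sum_pos' (fun τ _ => hterm τ) ⟨1, Finset.mem_univ _, ?_⟩).ne'
  have h1 : ∀ i : Fin k, pairing (2 * i) (2 * i + 1) = 1 := by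
    intro i
    rw [pairing, if_pos (by omega)]
    have h1 : (2 * (i : ℕ) + 1) % 2 = 1 := by omega
    have h2 : 2 * (i : ℕ) % 2 = 0 := by omega
    rw [h1, h2]
    rfl
  simp [h1]

namespace SymplecticMap

variable {n : ℕ}

/-- The multilinear form `∏ i, ω (v (2 i), v (2 i + 1))`. -/
def prodOmega (n k : ℕ) : MultilinearMap ℂ (fun _ : Fin (2 * k) => Fin n ⊕ Fin n → ℂ) ℂ :=
  have key : ∀ (v : Fin (2 * k) → Fin n ⊕ Fin n → ℂ) (j : Fin (2 * k)),
      ∃ L : (Fin n ⊕ Fin n → ℂ) →ₗ[ℂ] ℂ, ∀ x, ∏ i : Fin k,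
        omega (Function.update v j x ⟨2 * i, by omega⟩)
          (Function.update v j x ⟨2 * i + 1, by omega⟩) = L x := by
    intro v j
    let i₀ : Fin k := ⟨j / 2, by omega⟩
    have hne : ∀ x, ∏ i ∈ Finset.univ.erase i₀, omega (Function.update v j x ⟨2 * i, by omega⟩)
        (Function.update v j x ⟨2 * i + 1, by omega⟩) = ∏ i ∈ Finset.univ.erase i₀,
          omega (v ⟨2 * i, by omega⟩) (v ⟨2 * i + 1, by omega⟩) := by
      intro x
      refine Finset.prod_congr rfl fun i hi => ?_
      have hi' : (i : ℕ) ≠ (j : ℕ) / 2 := fun h => Finset.ne_of_mem_erase hi (Fin.ext h)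
      rw [Function.update_of_ne, Function.update_of_ne]
      · rw [Ne, Fin.ext_iff]
        simp only
        omega
      · rw [Ne, Fin.ext_iff]
        simp only
        omega
    rcases Nat.mod_two_eq_zero_or_one j with h | h
    · refine ⟨(∏ i ∈ Finset.univ.erase i₀, omega (v ⟨2 * i, by omega⟩) (v ⟨2 * i + 1, by omega⟩))
        • (omegaForm n).flip (v ⟨2 * i₀ + 1, by omega⟩), fun x => ?_⟩
      rw [← Finset.prod_erase_mul _ _ (Finset.mem_univ i₀), hne]
      have h1 : (⟨2 * i₀, by omega⟩ : Fin (2 * k)) = j := Fin.ext (by simp only [i₀]; omega)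
      rw [h1, Function.update_self, Function.update_of_ne]
      · rfl
      · rw [Ne, Fin.ext_iff]
        simp only [i₀]
        omega
    · refine ⟨(∏ i ∈ Finset.univ.erase i₀, omega (v ⟨2 * i, by omega⟩) (v ⟨2 * i + 1, by omega⟩))
        • omegaForm n (v ⟨2 * i₀, by omega⟩), fun x => ?_⟩
      rw [← Finset.prod_erase_mul _ _ (Finset.mem_univ i₀), hne]
      have h1 : (⟨2 * i₀ + 1, by omega⟩ : Fin (2 * k)) = j := Fin.ext (by simp only [i₀]; omega)
      rw [h1, Function.update_self, Function.update_of_ne]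
      · rfl
      · rw [Ne, Fin.ext_iff]
        simp only [i₀]
        omega
  { toFun v := ∏ i : Fin k, omega (v ⟨2 * i, by omega⟩) (v ⟨2 * i + 1, by omega⟩)
    map_update_add' {inst} v j x y := by
      rw [Subsingleton.elim inst (instDecidableEqFin (2 * k))]
      obtain ⟨L, hL⟩ := key v j
      rw [hL, hL, hL, map_add]
    map_update_smul' {inst} v j c x := by
      rw [Subsingleton.elim inst (instDecidableEqFin (2 * k))]
      obtain ⟨L, hL⟩ := key v j
      rw [hL, hL, map_smul] }

theorem prodOmega_apply (k : ℕ) (v : Fin (2 * k) → Fin n ⊕ Fin n → ℂ) :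
    prodOmega n k v = ∏ i : Fin k, omega (v ⟨2 * i, by omega⟩) (v ⟨2 * i + 1, by omega⟩) := rfl

theorem omegaPow_eq (k : ℕ) (v : Fin (2 * k) → Fin n ⊕ Fin n → ℂ) :
    omegaPow k v = ((2 : ℂ) ^ k)⁻¹ * MultilinearMap.alternatization (prodOmega n k) v := by
  rw [omegaPow, MultilinearMap.alternatization_apply]
  congr 1
  refine Finset.sum_congr rfl fun τ _ => ?_
  rw [MultilinearMap.domDomCongr_apply, prodOmega_apply, Units.smul_def, zsmul_eq_mul]

variable {σ g : Matrix.symplecticGroup (Fin n) ℂ} {c : Fin n ⊕ Fin n → ℂ}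

/-- The coordinates in the basis of the columns of `g`. -/
def coord (g : Matrix.symplecticGroup (Fin n) ℂ) (l : Fin n ⊕ Fin n) :
    (Fin n ⊕ Fin n → ℂ) →ₗ[ℂ] ℂ :=
  LinearMap.proj l ∘ₗ toEnd g⁻¹

theorem toEnd_mul (s t : Matrix.symplecticGroup (Fin n) ℂ) (v : Fin n ⊕ Fin n → ℂ) :
    toEnd (s * t) v = toEnd s (toEnd t v) := by
  simp [toEnd, Matrix.toLin'_apply, Matrix.mulVec_mulVec]

theorem toEnd_one (v : Fin n ⊕ Fin n → ℂ) :
    toEnd (1 : Matrix.symplecticGroup (Fin n) ℂ) v = v := by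
  simp [toEnd]

theorem toEnd_single (l : Fin n ⊕ Fin n) : toEnd g (Pi.single l 1) = g.1.col l := by
  simp [toEnd, Matrix.toLin'_apply]

theorem coord_col (l m : Fin n ⊕ Fin n) : coord g l (g.1.col m) = if l = m then 1 else 0 := by
  rw [← toEnd_single, coord, LinearMap.comp_apply, ← toEnd_mul, inv_mul_cancel, toEnd_one]
  simp [Pi.single_apply]

theorem sum_coord_smul_col (v : Fin n ⊕ Fin n → ℂ) : ∑ l, coord g l v • g.1.col l = v := by
  have h1 : toEnd g (toEnd g⁻¹ v) = v := by rw [← toEnd_mul, mul_inv_cancel, toEnd_one]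
  conv_rhs => rw [← h1]
  simp only [← toEnd_single, ← map_smul, ← map_sum]
  congr 1
  ext i
  simp [coord, Pi.single_apply]

/-- The basis of the columns of a symplectic matrix. -/
def colBasis (g : Matrix.symplecticGroup (Fin n) ℂ) :
    Module.Basis (Fin n ⊕ Fin n) ℂ (Fin n ⊕ Fin n → ℂ) :=
  Module.Basis.ofEquivFun (LinearEquiv.ofLinearMap (toEnd g⁻¹) (toEnd g)
    (LinearMap.ext fun v => by
      rw [LinearMap.comp_apply, ← toEnd_mul, inv_mul_cancel, toEnd_one, LinearMap.id_apply])
    (LinearMap.ext fun v => by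
      rw [LinearMap.comp_apply, ← toEnd_mul, mul_inv_cancel, toEnd_one, LinearMap.id_apply]))

theorem colBasis_apply (l : Fin n ⊕ Fin n) : colBasis g l = g.1.col l := by
  rw [← toEnd_single]
  simp [colBasis]

theorem omega_col (i j : Fin n ⊕ Fin n) :
    omega (g.1.col i) (g.1.col j) = -Matrix.J (Fin n) ℂ i j := by
  rw [← toEnd_single, ← toEnd_single, omega_toEnd, omega_eq_dotProduct, Matrix.mulVec_single_one,
    single_one_dotProduct]
  rfl

theorem smul_sub_self (a : ℂ) (v : Fin n ⊕ Fin n → ℂ) : a • v - v = (a - 1) • v := by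
  rw [sub_smul, one_smul]

theorem col_mem_movedSpace (hg : ∀ l, toEnd σ (g.1.col l) = c l • g.1.col l) {l : Fin n ⊕ Fin n}
    (hl : c l ≠ 1) : g.1.col l ∈ movedSpace σ := by
  refine ⟨(c l - 1)⁻¹ • g.1.col l, ?_⟩
  rw [map_smul, LinearMap.sub_apply, hg, Module.End.one_apply, smul_sub_self, smul_smul,
    inv_mul_cancel₀ (sub_ne_zero.mpr hl), one_smul]

theorem col_mem_fixedSpace (hg : ∀ l, toEnd σ (g.1.col l) = c l • g.1.col l) {l : Fin n ⊕ Fin n}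
    (hl : c l = 1) : g.1.col l ∈ fixedSpace σ := by
  simp [fixedSpace, hg, hl]

theorem movedSpace_eq_span (hg : ∀ l, toEnd σ (g.1.col l) = c l • g.1.col l) :
    movedSpace σ = Submodule.span ℂ (Set.range fun l : {l // c l ≠ 1} => g.1.col l) := by
  apply le_antisymm
  · rintro _ ⟨v, rfl⟩
    rw [← sum_coord_smul_col (g := g) v, map_sum]
    refine sum_mem fun l _ => ?_
    rw [map_smul, LinearMap.sub_apply, hg, Module.End.one_apply, smul_sub_self]
    by_cases hl : c l = 1
    · simp [hl]
    · exact Submodule.smul_mem _ _ (Submodule.smul_mem _ _ (Submodule.subset_span ⟨⟨l, hl⟩, rfl⟩))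
  · rw [Submodule.span_le]
    rintro _ ⟨l, rfl⟩
    exact col_mem_movedSpace hg l.2

theorem finrank_movedSpace (hg : ∀ l, toEnd σ (g.1.col l) = c l • g.1.col l) :
    Module.finrank ℂ (movedSpace σ) = Fintype.card {l // c l ≠ 1} := by
  rw [movedSpace_eq_span hg]
  refine finrank_span_eq_card ?_
  have h := (colBasis g).linearIndependent.comp (fun l : {l // c l ≠ 1} => l.1)
    Subtype.val_injective
  convert h using 1
  ext1 l
  exact (colBasis_apply l.1).symm

theorem inr_ne_one_iff (hc : ∀ l, c l * c l.swap = 1) (i : Fin n) :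
    c (Sum.inr i) ≠ 1 ↔ c (Sum.inl i) ≠ 1 := by
  have h := hc (Sum.inl i)
  rw [Sum.swap_inl] at h
  constructor
  · intro h1 h2
    rw [h2, one_mul] at h
    exact h1 h
  · intro h1 h2
    rw [h2, mul_one] at h
    exact h1 h

/-- The moved coordinates come in pairs `pᵢ`, `qᵢ`. -/
theorem card_moved (hc : ∀ l, c l * c l.swap = 1) :
    Fintype.card {l // c l ≠ 1} = 2 * Fintype.card {i // c (Sum.inl i) ≠ 1} := by
  rw [Fintype.card_subtype, Fintype.card_subtype, Finset.card_filter, Finset.card_filter,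
    Fintype.sum_sum_type, two_mul]
  simp only [inr_ne_one_iff hc]

theorem finrank_movedSpace_eq (hg : ∀ l, toEnd σ (g.1.col l) = c l • g.1.col l)
    (hc : ∀ l, c l * c l.swap = 1) :
    Module.finrank ℂ (movedSpace σ) = 2 * halfDim σ := by
  rw [halfDim, finrank_movedSpace hg, card_moved hc]
  omega

theorem projection_col (hg : ∀ l, toEnd σ (g.1.col l) = c l • g.1.col l) (hσ : IsDiagonalizable σ)
    (l : Fin n ⊕ Fin n) : (movedSpace σ).projection (fixedSpace σ) (isCompl hσ) (g.1.col l)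
      = if c l ≠ 1 then g.1.col l else 0 := by
  split_ifs with hl
  · exact Submodule.projection_apply_of_mem_left _ (col_mem_movedSpace hg hl)
  · exact Submodule.projection_apply_of_mem_right _ (col_mem_fixedSpace hg (not_not.mp hl))

/-- The projection on `V_σ` drops the fixed coordinates. -/
theorem projection_eq_sum (hg : ∀ l, toEnd σ (g.1.col l) = c l • g.1.col l)
    (hσ : IsDiagonalizable σ) {q : ℕ} {e : Fin q → Fin n ⊕ Fin n} (he : Function.Injective e)
    (hr : ∀ l, l ∈ Set.range e ↔ c l ≠ 1) (v : Fin n ⊕ Fin n → ℂ) :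
    (movedSpace σ).projection (fixedSpace σ) (isCompl hσ) v
      = ∑ i, coord g (e i) v • g.1.col (e i) := by
  conv_lhs => rw [← sum_coord_smul_col (g := g) v]
  simp only [map_sum, map_smul, projection_col hg hσ, smul_ite, smul_zero, ← Finset.sum_filter]
  have h1 : (Finset.univ.filter fun l => c l ≠ 1) = Finset.univ.image e := by
    ext l
    simpa using (hr l).symm
  rw [h1, Finset.sum_image fun _ _ _ _ h => he h]

/-- The volume form does not vanish: on the moved columns, listed as `p, q, p, q, …`, it is a
positive multiple of the Pfaffian sum of the standard pairing. -/
theorem exists_volumeForm_ne_zero (hg : ∀ l, toEnd σ (g.1.col l) = c l • g.1.col l)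
    (hc : ∀ l, c l * c l.swap = 1) (hσ : IsDiagonalizable σ) :
    ∃ v, volumeForm σ hσ v ≠ 0 := by
  have hcard : Fintype.card {i // c (Sum.inl i) ≠ 1} = halfDim σ := by
    have h1 := finrank_movedSpace hg
    rw [finrank_movedSpace_eq hg hc, card_moved hc] at h1
    omega
  let ε : Fin (halfDim σ) ≃ {i // c (Sum.inl i) ≠ 1} := (Fintype.equivFinOfCardEq hcard).symm
  let f : Fin (2 * halfDim σ) → Fin n ⊕ Fin n := fun j =>
    if (j : ℕ) % 2 = 0 then Sum.inl (ε ⟨j / 2, by omega⟩).1 else Sum.inr (ε ⟨j / 2, by omega⟩).1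
  have hf : ∀ j, c (f j) ≠ 1 := by
    intro j
    simp only [f]
    split_ifs
    · exact (ε _).2
    · exact (inr_ne_one_iff hc _).mpr (ε _).2
  have hω : ∀ a b, omega (g.1.col (f a)) (g.1.col (f b)) = (pairing a b : ℂ) := by
    intro a b
    have hε : (ε ⟨a / 2, by omega⟩).1 = (ε ⟨b / 2, by omega⟩).1 ↔ (a : ℕ) / 2 = b / 2 := by
      rw [Subtype.val_inj, ε.apply_eq_iff_eq, Fin.mk.injEq]
    rw [omega_col, pairing]
    simp only [f]
    rcases Nat.mod_two_eq_zero_or_one a with ha | ha <;>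
      rcases Nat.mod_two_eq_zero_or_one b with hb | hb <;>
      simp [ha, hb, Matrix.J, Matrix.one_apply, hε, apply_ite]
  refine ⟨fun j => g.1.col (f j), ?_⟩
  simp only [volumeForm, projection_col hg hσ, if_pos (hf _), omegaPow, hω]
  have h := sum_sign_mul_prod_pairing_ne_zero (halfDim σ)
  refine mul_ne_zero (inv_ne_zero (Nat.cast_ne_zero.mpr (Nat.factorial_ne_zero _)))
    (mul_ne_zero (inv_ne_zero (pow_ne_zero _ two_ne_zero)) ?_)
  exact_mod_cast h

/-- The volume form is a nonzero multiple of the determinant of the moved coordinates, in any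
order. -/
theorem volumeForm_eq_det (hg : ∀ l, toEnd σ (g.1.col l) = c l • g.1.col l)
    (hc : ∀ l, c l * c l.swap = 1) (hσ : IsDiagonalizable σ)
    {e : Fin (2 * halfDim σ) → Fin n ⊕ Fin n} (he : Function.Injective e)
    (hr : ∀ l, l ∈ Set.range e ↔ c l ≠ 1) :
    ∃ κ : ℂ, κ ≠ 0 ∧ ∀ v, volumeForm σ hσ v
      = κ * ∑ τ : Equiv.Perm (Fin (2 * halfDim σ)), ((Equiv.Perm.sign τ : ℤ) : ℂ) *
        ∏ i, coord g (e i) (v (τ i)) := by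
  -- the embedding of the coordinate space onto the moved space
  let L : (Fin (2 * halfDim σ) → ℂ) →ₗ[ℂ] Fin n ⊕ Fin n → ℂ :=
    ∑ i, (LinearMap.proj i).smulRight (g.1.col (e i))
  let F := (MultilinearMap.alternatization (prodOmega n (halfDim σ))).compLinearMap L
  let b := Pi.basisFun ℂ (Fin (2 * halfDim σ))
  let κ := ((halfDim σ).factorial : ℂ)⁻¹ * (((2 : ℂ) ^ halfDim σ)⁻¹ * F b)
  have h1 : ∀ v, volumeForm σ hσ v = κ * ∑ τ : Equiv.Perm (Fin (2 * halfDim σ)),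
      ((Equiv.Perm.sign τ : ℤ) : ℂ) * ∏ i, coord g (e i) (v (τ i)) := by
    intro v
    have h2 : (fun i => (movedSpace σ).projection (fixedSpace σ) (isCompl hσ) (v i))
        = fun j => L fun i => coord g (e i) (v j) := by
      ext1 j
      rw [projection_eq_sum hg hσ he hr]
      simp [L]
    have h3 : F (fun j i => coord g (e i) (v j)) = F b * ∑ τ : Equiv.Perm (Fin (2 * halfDim σ)),
        ((Equiv.Perm.sign τ : ℤ) : ℂ) * ∏ i, coord g (e i) (v (τ i)) := by
      conv_lhs => rw [AlternatingMap.eq_smul_basis_det b F]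
      rw [AlternatingMap.smul_apply, Pi.basisFun_det_apply, Matrix.det_apply, smul_eq_mul]
      simp only [Units.smul_def, zsmul_eq_mul, Matrix.of_apply]
    have h4 : MultilinearMap.alternatization (prodOmega n (halfDim σ))
        (fun j => L fun i => coord g (e i) (v j)) = F (fun j i => coord g (e i) (v j)) := rfl
    rw [volumeForm, omegaPow_eq, h2, h4, h3]
    simp only [κ]
    ring
  refine ⟨κ, ?_, h1⟩
  intro h0
  obtain ⟨v, hv⟩ := exists_volumeForm_ne_zero hg hc hσ
  exact hv (by rw [h1, h0, zero_mul])

/-- The volume form is invariant under symplectic maps that commute with `σ`. -/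
theorem volumeForm_comp (hσ : IsDiagonalizable σ) {s : Matrix.symplecticGroup (Fin n) ℂ}
    (hs : s * σ = σ * s) (v : Fin (2 * halfDim σ) → Fin n ⊕ Fin n → ℂ) :
    volumeForm σ hσ (fun i => toEnd s (v i)) = volumeForm σ hσ v := by
  have hcomm : ∀ w, toEnd s (toEnd σ w) = toEnd σ (toEnd s w) := fun w => by
    rw [← toEnd_mul, hs, toEnd_mul]
  have h1 : ∀ w, (movedSpace σ).projection (fixedSpace σ) (isCompl hσ) (toEnd s w)
      = toEnd s ((movedSpace σ).projection (fixedSpace σ) (isCompl hσ) w) := by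
    intro w
    obtain ⟨x, hx, y, hy, rfl⟩ : ∃ x ∈ movedSpace σ, ∃ y ∈ fixedSpace σ, x + y = w :=
      Submodule.mem_sup.mp (by rw [(isCompl hσ).sup_eq_top]; trivial)
    have hx' : toEnd s x ∈ movedSpace σ := by
      obtain ⟨z, rfl⟩ := hx
      exact ⟨toEnd s z, by simp [hcomm]⟩
    have hy' : toEnd s y ∈ fixedSpace σ := by
      have hy1 : toEnd σ y = y := by simpa [fixedSpace, sub_eq_zero] using hy
      simp [fixedSpace, ← hcomm, hy1]
    rw [map_add, map_add, map_add, Submodule.projection_apply_of_mem_left _ hx',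
      Submodule.projection_apply_of_mem_right _ hy', Submodule.projection_apply_of_mem_left _ hx,
      Submodule.projection_apply_of_mem_right _ hy, add_zero, add_zero]
  simp only [volumeForm, omegaPow, h1, omega_toEnd]

end SymplecticMap

/-! ### The Koszul resolution of the twisted bimodule -/

namespace WeylAlgebra

variable {n : ℕ} {σ g : Matrix.symplecticGroup (Fin n) ℂ} {c : Fin n ⊕ Fin n → ℂ}

/-- The coinduced bimodule of `W_σ`. -/
abbrev TwistedCoind (σ : Matrix.symplecticGroup (Fin n) ℂ) : Type :=
  Coind ℂ (WeylAlgebra n) (Twisted σ)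

/-- The elements of the coinduced bimodule as linear maps between polynomials. -/
def toPolyEnd (σ : Matrix.symplecticGroup (Fin n) ℂ) :
    TwistedCoind σ ≃ₗ[ℂ] (WeylPoly n →ₗ[ℂ] WeylPoly n) :=
  LinearEquiv.refl ℂ (WeylPoly n →ₗ[ℂ] WeylPoly n)

/-- The commutator with the left multiplication by a vector. -/
def coindComm (σ : Matrix.symplecticGroup (Fin n) ℂ) (v : Fin n ⊕ Fin n → ℂ) :
    Module.End ℂ (TwistedCoind σ) :=
  (toPolyEnd σ).symm.conj (WeylPoly.comm (WeylPoly.lin n v))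

theorem coindComm_apply (v : Fin n ⊕ Fin n → ℂ) (φ : TwistedCoind σ) (b : WeylAlgebra n) :
    coindComm σ v φ b = ofVec n v • φ b - φ (ofVec n v * b) := rfl

/-- A right inverse of `coindComm σ (g.1.col l)`. -/
def coindSection (σ g : Matrix.symplecticGroup (Fin n) ℂ) (l : Fin n ⊕ Fin n) :
    Module.End ℂ (TwistedCoind σ) :=
  (toPolyEnd σ).symm.conj (WeylPoly.commSection g l)

theorem coindSection_apply_one (l : Fin n ⊕ Fin n) (φ : TwistedCoind σ) :
    coindSection σ g l φ 1 = 0 := WeylPoly.commSection_one g l (toPolyEnd σ φ)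

theorem coindSection_apply_ofVec (l : Fin n ⊕ Fin n) (φ : TwistedCoind σ)
    (v : Fin n ⊕ Fin n → ℂ) :
    coindSection σ g l φ (ofVec n v) = -(SymplecticMap.coord g l v • φ 1) :=
  WeylPoly.commSection_lin g l (toPolyEnd σ φ) v

theorem coindComm_smul (v : Fin n ⊕ Fin n → ℂ) (a : WeylAlgebra n) (φ : TwistedCoind σ) :
    coindComm σ v (a • φ) = a • coindComm σ v φ := by
  ext b
  simp [coindComm_apply, mul_assoc]

theorem coindComm_op_smul (v : Fin n ⊕ Fin n → ℂ) (a : WeylAlgebra n) (φ : TwistedCoind σ) :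
    coindComm σ v (MulOpposite.op a • φ) = MulOpposite.op a • coindComm σ v φ := by
  ext b
  simp [coindComm_apply, smul_sub, smul_comm]

end WeylAlgebra

namespace Hochschild

variable {𝕜 A M : Type*} [CommRing 𝕜] [Ring A] [Algebra 𝕜 A] [AddCommGroup M] [Module 𝕜 M]

/-- Composition of normalized cochains with an endomorphism of the coefficients. -/
def compNormalized (β : Module.End 𝕜 M) (k : ℕ) : Module.End 𝕜 (normalized 𝕜 A M k) where
  toFun f := ⟨β.compMultilinearMap f.1, comp_mem_normalized β f.2⟩
  map_add' f f' := Subtype.ext (by ext a; exact map_add β (f.1 a) (f'.1 a))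
  map_smul' c f := Subtype.ext (by ext a; exact map_smul β c (f.1 a))

end Hochschild

namespace WeylAlgebra

variable {n : ℕ} {σ g : Matrix.symplecticGroup (Fin n) ℂ} {c : Fin n ⊕ Fin n → ℂ}

/-- The complex of normalized cochains of the coinduced bimodule, with the commutators with the
left multiplications by the columns of `g`. -/
def coindKoszul (σ g : Matrix.symplecticGroup (Fin n) ℂ) : SplitKoszul ℂ (Fin n ⊕ Fin n)
    fun k => Hochschild.normalized ℂ (WeylAlgebra n) (TwistedCoind σ) k where
  d k := (Hochschild.d ℂ (WeylAlgebra n) (TwistedCoind σ) k).restrict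
    fun _ hf => Hochschild.d_mem_normalized.{0, 0, 0} hf
  d_d k f := Subtype.ext (Hochschild.d_d.{0, 0, 0} f.1)
  x l k := Hochschild.compNormalized (coindComm σ (g.1.col l)) k
  s l k := Hochschild.compNormalized (coindSection σ g l) k
  x_d l k f := Subtype.ext (Hochschild.d_comp _ (coindComm_smul _) (coindComm_op_smul _) f.1).symm
  x_comm l m k f := Subtype.ext (by
    ext1 a
    exact WeylPoly.comm_comm (g.1.col l) (g.1.col m) (toPolyEnd σ (f.1 a)))
  x_s_self l k f := Subtype.ext (by
    ext1 a
    exact WeylPoly.comm_commSection g l (toPolyEnd σ (f.1 a)))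
  x_s l m k f h := Subtype.ext (by
    ext1 a
    exact WeylPoly.comm_commSection_of_ne g h (toPolyEnd σ (f.1 a)))

theorem coindKoszul_d (k : ℕ)
    (f : Hochschild.normalized ℂ (WeylAlgebra n) (TwistedCoind σ) k) :
    ((coindKoszul σ g).d k f).1 = Hochschild.d ℂ (WeylAlgebra n) (TwistedCoind σ) k f.1 := rfl

theorem coindKoszul_x (l : Fin n ⊕ Fin n) (k : ℕ)
    (f : Hochschild.normalized ℂ (WeylAlgebra n) (TwistedCoind σ) k)
    (a : Fin k → WeylAlgebra n) :
    ((coindKoszul σ g).x l k f).1 a = coindComm σ (g.1.col l) (f.1 a) := rfl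

theorem coindKoszul_s (l : Fin n ⊕ Fin n) (k : ℕ)
    (f : Hochschild.normalized ℂ (WeylAlgebra n) (TwistedCoind σ) k)
    (a : Fin k → WeylAlgebra n) :
    ((coindKoszul σ g).s l k f).1 a = coindSection σ g l (f.1 a) := rfl

theorem act_ofVec (s : Matrix.symplecticGroup (Fin n) ℂ) (v : Fin n ⊕ Fin n → ℂ) :
    act s (ofVec n v) = ofVec n (SymplecticMap.toEnd s v) := by
  refine Eq.trans (WeylPoly.subst_lin (n := n) s.1 v) ?_
  rw [SymplecticMap.toEnd, Matrix.toLin'_apply]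
  rfl

theorem act_ofPoly_X (l : Fin n ⊕ Fin n) :
    act g (ofPoly n (MvPolynomial.X l)) = ofVec n (g.1.col l) :=
  WeylPoly.subst_X_eq_lin (n := n) g.1 l

/-- In the coordinates given by eigenvectors, the twisted commutators become those of a diagonal
map. -/
theorem act_twistComm (hg : ∀ l, SymplecticMap.toEnd σ (g.1.col l) = c l • g.1.col l)
    (l : Fin n ⊕ Fin n) (P : WeylPoly n) :
    act g (ofPoly n (WeylPoly.twistComm c l P))
      = ofVec n (g.1.col l) * act g (ofPoly n P)
        - act g (ofPoly n P) * act σ (ofVec n (g.1.col l)) := by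
  have h1 : ofPoly n (WeylPoly.twistComm c l P)
      = ofPoly n (MvPolynomial.X l) * ofPoly n P
        - c l • (ofPoly n P * ofPoly n (MvPolynomial.X l)) := rfl
  rw [h1, map_sub, map_smul, map_mul, map_mul, act_ofPoly_X, act_ofVec, hg, map_smul,
    mul_smul_comm]

/-- The zero-cochains `b ↦ P * σ b`, in the coordinates given by `g`. They are the zero-cocycles of
the coinduced bimodule. -/
def zeroCocycle (σ g : Matrix.symplecticGroup (Fin n) ℂ) : WeylPoly n →ₗ[ℂ]
    Hochschild.normalized ℂ (WeylAlgebra n) (TwistedCoind σ) 0 where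
  toFun P := ⟨MultilinearMap.constOfIsEmpty ℂ _
    (Coind.of ((TwistedBimodule.of (act σ)).toLinearMap ∘ₗ
      LinearMap.mulLeft ℂ (act g (ofPoly n P)) ∘ₗ (act σ).toLinearMap)),
    fun _ h => h.elim fun i _ => i.elim0⟩
  map_add' P Q := Subtype.ext (by
    ext a b
    exact congrArg (TwistedBimodule.of (act σ)) (show act g (ofPoly n (P + Q)) * act σ b
      = act g (ofPoly n P) * act σ b + act g (ofPoly n Q) * act σ b by
        rw [map_add, map_add, add_mul]))
  map_smul' r P := Subtype.ext (by
    ext a b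
    exact congrArg (TwistedBimodule.of (act σ)) (show act g (ofPoly n (r • P)) * act σ b
      = r • (act g (ofPoly n P) * act σ b) by rw [map_smul, map_smul, smul_mul_assoc]))

theorem zeroCocycle_apply (P : WeylPoly n) (a : Fin 0 → WeylAlgebra n) (b : WeylAlgebra n) :
    (zeroCocycle σ g P).1 a b = TwistedBimodule.of (act σ) (act g (ofPoly n P) * act σ b) := rfl

theorem d_zeroCocycle (P : WeylPoly n) : (coindKoszul σ g).d 0 (zeroCocycle σ g P) = 0 := by
  refine Subtype.ext ?_
  ext a b
  rw [coindKoszul_d, Hochschild.d_zero_apply]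
  simp only [Coind.sub_apply, Coind.left_smul_apply, Coind.right_smul_apply, zeroCocycle_apply,
    TwistedBimodule.op_smul_of, map_mul, mul_assoc, sub_self]
  rfl

theorem x_zeroCocycle (hg : ∀ l, SymplecticMap.toEnd σ (g.1.col l) = c l • g.1.col l)
    (l : Fin n ⊕ Fin n) (P : WeylPoly n) :
    (coindKoszul σ g).x l 0 (zeroCocycle σ g P) = zeroCocycle σ g (WeylPoly.twistComm c l P) := by
  refine Subtype.ext ?_
  ext a b
  rw [coindKoszul_x, coindComm_apply, zeroCocycle_apply, zeroCocycle_apply, zeroCocycle_apply,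
    act_twistComm hg, TwistedBimodule.smul_of, ← map_sub, map_mul, sub_mul, mul_assoc, mul_assoc]

/-- The cohomology of the coinduced bimodule. -/
theorem computes_empty : (coindKoszul σ g).Computes ∅ 0 (WeylPoly.hamKer ∅) (zeroCocycle σ g) where
  mem P _ l hl := (Set.notMem_empty l hl).elim
  cocycle P _ := d_zeroCocycle P
  exact k hk f _ hd := by
    obtain ⟨k, rfl⟩ := Nat.exists_eq_succ_of_ne_zero hk
    obtain ⟨h, hh, hd'⟩ := Hochschild.exists_d_eq_of_d_eq_zero f.2 (congrArg Subtype.val hd)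
    exact ⟨⟨h, hh⟩, fun l hl => (Set.notMem_empty l hl).elim, Subtype.ext hd'⟩
  surj f _ hd := by
    have h1 : ∀ b, f.1 ![] b = MulOpposite.op b • f.1 ![] 1 :=
      Hochschild.eq_of_d_eq_zero (congrArg Subtype.val hd)
    refine ⟨(ofPoly n).symm ((act g).symm ((TwistedBimodule.of (act σ)).symm (f.1 ![] 1))),
      fun l hl => (Set.notMem_empty l hl).elim, ?_⟩
    have h2 : f = zeroCocycle σ g
        ((ofPoly n).symm ((act g).symm ((TwistedBimodule.of (act σ)).symm (f.1 ![] 1)))) := by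
      refine Subtype.ext ?_
      ext a b
      rw [Subsingleton.elim a ![], h1, zeroCocycle_apply, LinearEquiv.apply_symm_apply,
        AlgEquiv.apply_symm_apply, ← TwistedBimodule.op_smul_of, LinearEquiv.apply_symm_apply]
    rw [← h2, sub_self]
    exact zero_mem _
  inj P _ hb := by
    have h1 := congrArg (fun f => f.1 ![] 1) ((Submodule.mem_bot ℂ).mp hb)
    have h2 : act g (ofPoly n P) = 0 := by
      rw [← mul_one (act g (ofPoly n P)), ← map_one (act σ)]
      exact h1
    exact (ofPoly n).map_eq_zero_iff.mp ((act g).map_eq_zero_iff.mp h2)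

end WeylAlgebra

/-! ### The cohomology of the twisted bimodule -/

namespace WeylAlgebra

open SymplecticMap WeylPoly

variable {n : ℕ} {σ g : Matrix.symplecticGroup (Fin n) ℂ} {c : Fin n ⊕ Fin n → ℂ}

/-- The fixed coordinates act by surjective maps on cohomology, which stays in degree zero. -/
theorem computes_fixed (hg : ∀ l, toEnd σ (g.1.col l) = c l • g.1.col l)
    (s : Finset (Fin n ⊕ Fin n)) (hs : ∀ l ∈ s, c l = 1) :
    (coindKoszul σ g).Computes (↑s) 0 (hamKer ↑s) (zeroCocycle σ g) := by
  induction s using Finset.induction_on with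
  | empty =>
    rw [Finset.coe_empty]
    exact computes_empty
  | insert l s hl ih =>
    have hl1 : c l = 1 := hs l (Finset.mem_insert_self l s)
    have h := ih fun m hm => hs m (Finset.mem_insert_of_mem hm)
    have hT := twistComm_apply_of_eq_one hl1
    rw [Finset.coe_insert]
    refine h.of_surjective (by simpa using hl) (twistComm c l) (fun P hP m hm => ?_)
      (fun P _ => x_zeroCocycle hg l P) (fun P => ?_) (fun P hP => ?_)
    · rw [hT, ham_comm, hP m hm, map_zero]
    · rw [hT, mem_hamKer, mem_hamKer]
      simp [and_comm]
    · obtain ⟨Q, hQ, hQ'⟩ := exists_ham_eq (by simpa using hl) hP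
      exact ⟨Q, hQ, by rw [hT, hQ']⟩

/-- The coordinates with eigenvalue different from `1`. -/
def movedCoords (c : Fin n ⊕ Fin n → ℂ) : Finset (Fin n ⊕ Fin n) :=
  Finset.univ.filter fun l => c l ≠ 1

theorem mem_movedCoords {l : Fin n ⊕ Fin n} : l ∈ movedCoords c ↔ c l ≠ 1 := by
  simp [movedCoords]

/-- Each moved coordinate acts by an injective map on cohomology, and raises its degree by one.
The value of the generator at vectors is multiplied by the coordinate. -/
theorem computes_moved (hg : ∀ l, toEnd σ (g.1.col l) = c l • g.1.col l)
    (hc : ∀ l, c l * c l.swap = 1) (s : Finset (Fin n ⊕ Fin n)) (hs : s ⊆ movedCoords c) (q : ℕ)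
    (hq : s.card = q) :
    ∃ θ : WeylPoly n →ₗ[ℂ] Hochschild.normalized ℂ (WeylAlgebra n) (TwistedCoind σ) q,
      (coindKoszul σ g).Computes (↑(movedCoords c)ᶜ ∪ ↑s) q (polyIn (↑(movedCoords c) \ ↑s)) θ ∧
      (∀ m ∈ movedCoords c, m ∉ s → ∀ P ∈ polyIn (↑(movedCoords c) \ ↑s),
        (coindKoszul σ g).x m q (θ P) - θ (twistComm c m P)
          ∈ (coindKoszul σ g).bdry (↑(movedCoords c)ᶜ ∪ ↑s) q) ∧
      ∃ e : Fin q → Fin n ⊕ Fin n, Function.Injective e ∧ (∀ l, l ∈ Set.range e ↔ l ∈ s) ∧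
        ∀ v : Fin q → Fin n ⊕ Fin n → ℂ, (θ 1).1 (fun i => ofVec n (v i)) 1
          = (∏ i, -coord g (e i) (v i)) • TwistedBimodule.of (act σ) 1 := by
  induction s using Finset.induction_on generalizing q with
  | empty =>
    rw [Finset.card_empty] at hq
    subst hq
    have h := computes_fixed hg (movedCoords c)ᶜ
      (fun l hl => by simpa [mem_movedCoords] using hl)
    rw [hamKer_eq_polyIn] at h
    · rw [Finset.coe_compl, compl_compl] at h
      refine ⟨zeroCocycle σ g, ?_, fun m _ _ P _ => ?_, Fin.elim0, fun i => i.elim0, by simp,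
        fun v => ?_⟩
      · rw [Finset.coe_empty, Set.union_empty, Set.sdiff_empty, Finset.coe_compl]
        exact h
      · rw [x_zeroCocycle hg, sub_self]
        exact zero_mem _
      · have h1 : act g (ofPoly n 1) = 1 := map_one (act g)
        rw [zeroCocycle_apply, h1, map_one (act σ), one_mul, Fin.prod_univ_zero, one_smul]
    · intro l
      simp only [Finset.coe_compl, Set.mem_compl_iff, Finset.mem_coe, mem_movedCoords, not_not]
      have h := hc l
      constructor
      · intro h1
        rwa [h1, one_mul] at h
      · intro h1
        rwa [h1, mul_one] at h
  | insert l s hl ih =>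
    rw [Finset.card_insert_of_notMem hl] at hq
    subst hq
    obtain ⟨θ, hθ, hx, e, he, hr, hv⟩ := ih
      (fun m hm => hs (Finset.mem_insert_of_mem hm)) _ rfl
    have hlM : l ∈ movedCoords c := hs (Finset.mem_insert_self l s)
    have hl1 : c l ≠ 1 := mem_movedCoords.mp hlM
    have hlJ : l ∉ ((↑(movedCoords c)ᶜ ∪ ↑s : Set (Fin n ⊕ Fin n))) := by
      simp [hlM, hl]
    have hJ : (↑(movedCoords c)ᶜ ∪ ↑(insert l s) : Set (Fin n ⊕ Fin n))
        = insert l (↑(movedCoords c)ᶜ ∪ ↑s) := by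
      rw [Finset.coe_insert, Set.union_insert]
    have hA : (↑(movedCoords c) \ ↑(insert l s) : Set (Fin n ⊕ Fin n))
        = (↑(movedCoords c) \ ↑s) \ {l} := by
      rw [Finset.coe_insert, Set.sdiff_sdiff, Set.union_singleton]
    have hlA : l ∈ (↑(movedCoords c) \ ↑s : Set (Fin n ⊕ Fin n)) := ⟨hlM, hl⟩
    have hsub : polyIn (↑(movedCoords c) \ ↑(insert l s) : Set (Fin n ⊕ Fin n))
        ≤ polyIn (↑(movedCoords c) \ ↑s : Set (Fin n ⊕ Fin n)) := by
      rw [hA]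
      exact polyIn_mono Set.sdiff_subset
    refine ⟨(coindKoszul σ g).d _ ∘ₗ (coindKoszul σ g).s l _ ∘ₗ θ, ?_, fun m hm hm' P hP => ?_,
      Fin.cons l e, ?_, fun m => ?_, fun v => ?_⟩
    · rw [hJ]
      refine hθ.of_injective hlJ (twistComm c l) (fun P hP => twistComm_mem_polyIn hlA hP)
        (hx l hlM hl) hsub ?_ ?_ <;> rw [hA]
      · exact fun P hP => exists_sub_twistComm_mem hl1 hP
      · exact fun P _ hP' => eq_zero_of_twistComm_mem hl1 hP'
    · rw [hJ]
      rw [Finset.mem_insert, not_or] at hm'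
      exact SplitKoszul.x_connecting hlJ (Ne.symm hm'.1) (twistComm c m) (hx m hm hm'.2 P (hsub hP))
    · rw [Fin.cons_injective_iff]
      exact ⟨fun h => hl ((hr l).mp h), he⟩
    · rw [Fin.range_cons, Set.mem_insert_iff, hr, Finset.mem_insert]
    · rw [LinearMap.comp_apply, LinearMap.comp_apply, coindKoszul_d,
        Hochschild.d_coind_apply_one _ fun a => coindSection_apply_one l _, coindKoszul_s,
        coindSection_apply_ofVec]
      have h1 : (Fin.tail fun i => ofVec n (v i)) = fun i => ofVec n (Fin.tail v i) := rfl
      rw [h1, hv, smul_smul, ← neg_smul, Fin.prod_univ_succ, Fin.cons_zero, neg_mul]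
      rfl

/-- An element of the coinduced bimodule that commutes with all vectors comes from the twisted
bimodule. -/
theorem eq_incl_of_coindComm_eq_zero {φ : TwistedCoind σ}
    (h : ∀ l, coindComm σ (g.1.col l) φ = 0) :
    φ = Coind.incl ℂ (WeylAlgebra n) (Twisted σ) (φ 1) := by
  have h1 : ∀ v, comm (lin n v) (toPolyEnd σ φ) = 0 := by
    intro v
    have h2 : ∀ l, comm (lin n (g.1.col l)) (toPolyEnd σ φ) = 0 := h
    rw [← sum_coord_smul_col (g := g) v]
    simp only [map_sum, map_smul, LinearMap.sum_apply, LinearMap.smul_apply, h2, smul_zero,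
      Finset.sum_const_zero]
  have h3 : ∀ v m, comm (lin n v) (toPolyEnd σ (Coind.incl ℂ (WeylAlgebra n) (Twisted σ) m))
      = 0 := by
    intro v m
    have h4 : ∀ b, coindComm σ v (Coind.incl ℂ (WeylAlgebra n) (Twisted σ) m) b = 0 := fun b => by
      rw [coindComm_apply, Coind.incl_apply, Coind.incl_apply, mul_smul, sub_self]
    exact LinearMap.ext fun b => h4 b
  rw [← sub_eq_zero]
  apply (toPolyEnd σ).injective
  rw [map_zero]
  refine eq_zero_of_comm_eq_zero (fun v => ?_) ?_
  · rw [map_sub, map_sub, h1, h3, sub_zero]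
  · have h5 : (φ - Coind.incl ℂ (WeylAlgebra n) (Twisted σ) (φ 1)) 1 = 0 := by
      rw [Coind.sub_apply, Coind.incl_apply, one_smul, sub_self]
    exact h5

theorem d_incl {k : ℕ} (f : MultilinearMap ℂ (fun _ : Fin k => WeylAlgebra n) (Twisted σ)) :
    Hochschild.d ℂ (WeylAlgebra n) (TwistedCoind σ) k
        ((Coind.incl ℂ (WeylAlgebra n) (Twisted σ)).compMultilinearMap f)
      = (Coind.incl ℂ (WeylAlgebra n) (Twisted σ)).compMultilinearMap
        (Hochschild.d ℂ (WeylAlgebra n) (Twisted σ) k f) :=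
  Hochschild.d_comp _ Coind.incl_smul (fun _ => Coind.incl_op_smul _) f

/-- The cochains of the twisted bimodule as cochains of the coinduced one. -/
def inclCochain {k : ℕ} (f : cochains σ k) :
    Hochschild.normalized ℂ (WeylAlgebra n) (TwistedCoind σ) k :=
  ⟨(Coind.incl ℂ (WeylAlgebra n) (Twisted σ)).compMultilinearMap f.1,
    Hochschild.comp_mem_normalized _ f.2⟩

theorem inclCochain_apply {k : ℕ} (f : cochains σ k) (a : Fin k → WeylAlgebra n)
    (b : WeylAlgebra n) : (inclCochain f).1 a b = b • f.1 a := rfl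

theorem inclCochain_injective {k : ℕ} : Function.Injective (inclCochain (σ := σ) (k := k)) := by
  intro f f' h
  refine Subtype.ext ?_
  ext1 a
  exact Coind.incl_injective (congrArg (fun F => F.1 a) h)

theorem inclCochain_mem_sub {k : ℕ} (f : cochains σ k) (J : Set (Fin n ⊕ Fin n)) :
    inclCochain f ∈ (coindKoszul σ g).sub J k := by
  intro l _
  refine Subtype.ext ?_
  ext a b
  rw [coindKoszul_x, coindComm_apply, inclCochain_apply, inclCochain_apply, mul_smul, sub_self]
  rfl

/-- The cochains on which all the Koszul endomorphisms vanish come from the twisted bimodule. -/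
theorem exists_inclCochain_eq {k : ℕ}
    {F : Hochschild.normalized ℂ (WeylAlgebra n) (TwistedCoind σ) k}
    (hF : F ∈ (coindKoszul σ g).sub Set.univ k) : ∃ f : cochains σ k, inclCochain f = F := by
  refine ⟨⟨(Coind.eval (1 : WeylAlgebra n)).compMultilinearMap F.1,
    Hochschild.comp_mem_normalized _ F.2⟩, Subtype.ext ?_⟩
  ext1 a
  exact (eq_incl_of_coindComm_eq_zero (g := g) fun l =>
    congrArg (fun F => F.1 a) (hF l (Set.mem_univ l))).symm

theorem d_inclCochain_eq_iff {k : ℕ} (f : cochains σ k) (f' : cochains σ (k + 1)) :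
    (coindKoszul σ g).d k (inclCochain f) = inclCochain f'
      ↔ Hochschild.d ℂ (WeylAlgebra n) (Twisted σ) k f.1 = f'.1 := by
  rw [Subtype.ext_iff, coindKoszul_d]
  simp only [inclCochain, d_incl]
  constructor
  · intro h
    ext1 a
    exact Coind.incl_injective (congrArg (fun F => F a) h)
  · intro h
    rw [h]

theorem d_inclCochain_eq_zero_iff {k : ℕ} (f : cochains σ k) :
    (coindKoszul σ g).d k (inclCochain f) = 0
      ↔ Hochschild.d ℂ (WeylAlgebra n) (Twisted σ) k f.1 = 0 := by
  have h : inclCochain (0 : cochains σ (k + 1)) = 0 := by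
    refine Subtype.ext ?_
    ext a b
    exact smul_zero b
  have h1 := d_inclCochain_eq_iff (g := g) f (0 : cochains σ (k + 1))
  rw [h] at h1
  exact h1

theorem inclCochain_mem_bdry_iff : ∀ {k : ℕ} (f : cochains σ k),
    inclCochain f ∈ (coindKoszul σ g).bdry Set.univ k
      ↔ f.1 ∈ Hochschild.coboundaries (cochains σ) k
  | 0, f => by
    have h : inclCochain (0 : cochains σ 0) = 0 := by
      refine Subtype.ext ?_
      ext a b
      exact smul_zero b
    constructor
    · intro hf
      have hf' := (Submodule.mem_bot ℂ).mp hf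
      rw [← h] at hf'
      rw [inclCochain_injective hf']
      exact zero_mem _
    · intro hf
      have hf' : f = 0 := Subtype.ext ((Submodule.mem_bot ℂ).mp hf)
      rw [hf', h]
      exact zero_mem _
  | k + 1, f => by
    constructor
    · rintro ⟨F, hF, h⟩
      obtain ⟨f', rfl⟩ := exists_inclCochain_eq hF
      exact ⟨f'.1, f'.2, (d_inclCochain_eq_iff f' f).mp h⟩
    · rintro ⟨f', hf', h⟩
      exact ⟨inclCochain ⟨f', hf'⟩, inclCochain_mem_sub _ _,
        (d_inclCochain_eq_iff ⟨f', hf'⟩ f).mpr h⟩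

theorem inclCochain_sub_smul {k : ℕ} (f f' : cochains σ k) (a : ℂ) :
    inclCochain (f - a • f') = inclCochain f - a • inclCochain f' := by
  refine Subtype.ext ?_
  ext b c
  simp only [inclCochain_apply]
  change c • (f.1 b - a • f'.1 b) = c • f.1 b - a • c • f'.1 b
  rw [smul_sub, smul_comm c a]

/-- The cohomology of the twisted bimodule is spanned by one class, whose values at vectors are the
products of the moved coordinates. -/
theorem exists_generator (hg : ∀ l, toEnd σ (g.1.col l) = c l • g.1.col l)
    (hc : ∀ l, c l * c l.swap = 1) :
    ∃ (Ω : MultilinearMap ℂ (fun _ : Fin (2 * halfDim σ) => WeylAlgebra n) (Twisted σ))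
      (e : Fin (2 * halfDim σ) → Fin n ⊕ Fin n),
      Ω ∈ Hochschild.cocycles (cochains σ) (2 * halfDim σ) ∧ Function.Injective e ∧
      (∀ l, l ∈ Set.range e ↔ c l ≠ 1) ∧
      (∀ v : Fin (2 * halfDim σ) → Fin n ⊕ Fin n → ℂ, Ω (fun i => ofVec n (v i))
        = (∏ i, -coord g (e i) (v i)) • TwistedBimodule.of (act σ) 1) ∧
      (∀ k, k ≠ 2 * halfDim σ → ∀ f ∈ Hochschild.cocycles (cochains σ) k,
        f ∈ Hochschild.coboundaries (cochains σ) k) ∧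
      ∀ f ∈ Hochschild.cocycles (cochains σ) (2 * halfDim σ), ∃ a : ℂ,
        f - a • Ω ∈ Hochschild.coboundaries (cochains σ) (2 * halfDim σ) := by
  have hcard : (movedCoords c).card = 2 * halfDim σ := by
    rw [← finrank_movedSpace_eq hg hc, finrank_movedSpace hg, Fintype.card_subtype]
    rfl
  obtain ⟨θ, hθ, -, e, he, hr, hv⟩ := computes_moved hg hc (movedCoords c) subset_rfl _ hcard
  rw [Finset.coe_compl, Set.compl_union_self, Set.sdiff_self] at hθ
  obtain ⟨Ω, hΩ⟩ := exists_inclCochain_eq (hθ.mem 1 (one_mem_polyIn _))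
  refine ⟨Ω.1, e, ⟨Ω.2, ?_⟩, he, fun l => (hr l).trans mem_movedCoords, fun v => ?_,
    fun k hk f hf => ?_, fun f hf => ?_⟩
  · exact (d_inclCochain_eq_zero_iff Ω).mp (by rw [hΩ]; exact hθ.cocycle 1 (one_mem_polyIn _))
  · rw [← hv, ← hΩ, inclCochain_apply, one_smul]
  · refine (inclCochain_mem_bdry_iff (g := g) ⟨f, hf.1⟩).mp (hθ.exact k hk _ ?_ ?_)
    · exact inclCochain_mem_sub _ _
    · exact (d_inclCochain_eq_zero_iff _).mpr hf.2
  · obtain ⟨P, hP, h⟩ := hθ.surj (inclCochain ⟨f, hf.1⟩) (inclCochain_mem_sub _ _)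
      ((d_inclCochain_eq_zero_iff _).mpr hf.2)
    obtain ⟨a, rfl⟩ := mem_polyIn_empty.mp hP
    refine ⟨a, ?_⟩
    rw [map_smul, ← hΩ, ← inclCochain_sub_smul] at h
    exact (inclCochain_mem_bdry_iff _).mp h

end WeylAlgebra

/-! ### Antisymmetrization of coboundaries -/

namespace Hochschild

variable {𝕜 A M : Type*} [CommRing 𝕜] [Ring A] [Algebra 𝕜 A] [AddCommGroup M] [Module 𝕜 M]

theorem contractNth_eq_update {k : ℕ} (i : Fin k) (b : Fin (k + 1) → A) :
    Fin.contractNth i.castSucc (· * ·) b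
      = Function.update (Fin.contractNth i.castSucc (· * ·) b) i (b i.castSucc * b i.succ) := by
  ext l
  by_cases h : l = i
  · subst h
    simp [Fin.contractNth]
  · rw [Function.update_of_ne h]

theorem contractNth_comp_swap {k : ℕ} (i : Fin k) (b : Fin (k + 1) → A) :
    Fin.contractNth i.castSucc (· * ·) (b ∘ Equiv.swap i.castSucc i.succ)
      = Function.update (Fin.contractNth i.castSucc (· * ·) b) i (b i.succ * b i.castSucc) := by
  ext l
  by_cases h : l = i
  · subst h
    simp [Fin.contractNth]
  · rw [Function.update_of_ne h]
    have h' : (l : ℕ) ≠ i := fun h' => h (Fin.ext h')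
    simp only [Fin.contractNth, Function.comp_apply, Fin.val_castSucc, if_neg h']
    split_ifs with h1
    · rw [Equiv.swap_apply_of_ne_of_ne]
      · exact fun h2 => h (Fin.castSucc_injective _ h2)
      · simp only [ne_eq, Fin.ext_iff, Fin.val_castSucc, Fin.val_succ]
        omega
    · rw [Equiv.swap_apply_of_ne_of_ne]
      · simp only [ne_eq, Fin.ext_iff, Fin.val_castSucc, Fin.val_succ]
        omega
      · exact fun h2 => h (Fin.succ_injective _ h2)

/-- When the commutators of the arguments are scalars, the inner terms of the differential of a
normalized cochain are symmetric in two neighbouring arguments. -/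
theorem apply_contractNth_comp_swap {k : ℕ}
    {f : MultilinearMap 𝕜 (fun _ : Fin k => A) M} (hf : f ∈ normalized 𝕜 A M k) (i : Fin k)
    (b : Fin (k + 1) → A)
    (hb : b i.succ * b i.castSucc - b i.castSucc * b i.succ ∈ Set.range (algebraMap 𝕜 A)) :
    f (Fin.contractNth i.castSucc (· * ·) (b ∘ Equiv.swap i.castSucc i.succ))
      = f (Fin.contractNth i.castSucc (· * ·) b) := by
  rw [contractNth_comp_swap, contractNth_eq_update, Function.update_idem, ← sub_eq_zero,
    ← f.map_update_sub]
  exact hf _ ⟨i, by rwa [Function.update_self]⟩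

variable [Module A M] [Module Aᵐᵒᵖ M] [IsScalarTower 𝕜 A M] [IsScalarTower 𝕜 Aᵐᵒᵖ M]

/-- On arguments with scalar commutators, the antisymmetrization of a coboundary only involves the
commutators with the first argument. -/
theorem sum_sign_smul_d {k : ℕ} {f : MultilinearMap 𝕜 (fun _ : Fin k => A) M}
    (hf : f ∈ normalized 𝕜 A M k) (a : Fin (k + 1) → A)
    (ha : ∀ i j, a i * a j - a j * a i ∈ Set.range (algebraMap 𝕜 A)) :
    ∑ τ : Equiv.Perm (Fin (k + 1)), ((Equiv.Perm.sign τ : ℤ) : 𝕜) • d 𝕜 A M k f (a ∘ τ)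
      = ∑ τ : Equiv.Perm (Fin (k + 1)), ((Equiv.Perm.sign τ : ℤ) : 𝕜) •
        (a (τ 0) • f (fun i => a (τ i.succ))
          - MulOpposite.op (a (τ 0)) • f fun i => a (τ i.succ)) := by
  -- the inner terms cancel in pairs that differ by the transposition of two neighbours
  have hinner : ∀ i : Fin k, ∑ τ : Equiv.Perm (Fin (k + 1)), ((Equiv.Perm.sign τ : ℤ) : 𝕜) •
      f (Fin.contractNth i.castSucc (· * ·) (a ∘ τ)) = 0 := by
    intro i
    have hne : i.castSucc ≠ i.succ := (Fin.castSucc_lt_succ).ne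
    refine Finset.sum_involution (fun τ _ => τ * Equiv.swap i.castSucc i.succ) (fun τ _ => ?_)
      (fun τ _ _ h => ?_) (fun τ _ => Finset.mem_univ _) fun τ _ => ?_
    · have h := apply_contractNth_comp_swap hf i (a ∘ τ) (ha _ _)
      rw [Equiv.Perm.coe_mul, ← Function.comp_assoc, h, Equiv.Perm.sign_mul,
        Equiv.Perm.sign_swap hne]
      simp
    · exact hne (Equiv.swap_eq_one_iff.mp (mul_eq_left.mp h))
    · rw [mul_assoc, Equiv.swap_mul_self, mul_one]
  -- a cyclic rotation moves the last argument to the first place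
  have hright : ∑ τ : Equiv.Perm (Fin (k + 1)), ((Equiv.Perm.sign τ : ℤ) : 𝕜) •
      ((-1 : 𝕜) ^ (k + 1) • (MulOpposite.op ((a ∘ τ) (Fin.last k)) • f (Fin.init (a ∘ τ))))
      = ∑ τ : Equiv.Perm (Fin (k + 1)), ((Equiv.Perm.sign τ : ℤ) : 𝕜) •
        -(MulOpposite.op (a (τ 0)) • f fun i => a (τ i.succ)) := by
    rw [← Equiv.sum_comp (Equiv.mulRight (finRotate (k + 1)))]
    refine Finset.sum_congr rfl fun τ _ => ?_
    have h1 : Fin.init (a ∘ ⇑(τ * finRotate (k + 1))) = fun i => a (τ i.succ) := by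
      ext i
      simp only [Fin.init, Function.comp_apply, Equiv.Perm.mul_apply]
      rw [finRotate_apply, Fin.coeSucc_eq_succ]
    have h2 : (-1 : 𝕜) ^ k * (-1) ^ (k + 1) = -1 := by
      rw [← pow_add, Odd.neg_one_pow ⟨k, by ring⟩]
    rw [Equiv.coe_mulRight, h1, Equiv.Perm.sign_mul, sign_finRotate, Function.comp_apply,
      Equiv.Perm.mul_apply, finRotate_last, smul_smul]
    push_cast
    rw [mul_assoc, h2, mul_smul, neg_one_smul]
  simp only [d_apply, smul_add, Finset.sum_add_distrib, hright]
  have hinner' : ∑ τ : Equiv.Perm (Fin (k + 1)), ((Equiv.Perm.sign τ : ℤ) : 𝕜) •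
      ∑ i : Fin k, (-1 : 𝕜) ^ ((i : ℕ) + 1) • f (Fin.contractNth i.castSucc (· * ·) (a ∘ τ))
      = 0 := by
    simp only [Finset.smul_sum]
    rw [Finset.sum_comm]
    refine Finset.sum_eq_zero fun i _ => ?_
    simp only [smul_comm _ ((-1 : 𝕜) ^ ((i : ℕ) + 1))]
    rw [← Finset.smul_sum, hinner, smul_zero]
  rw [hinner', add_zero, ← Finset.sum_add_distrib]
  refine Finset.sum_congr rfl fun τ _ => ?_
  rw [← smul_add, ← sub_eq_add_neg]
  rfl

end Hochschild

/-! ### The restriction to vectors detects the class -/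

namespace WeylAlgebra

open SymplecticMap WeylPoly

variable {n : ℕ} {σ g : Matrix.symplecticGroup (Fin n) ℂ} {c : Fin n ⊕ Fin n → ℂ}

theorem restrict_smul {k : ℕ} (r : ℂ)
    (f : MultilinearMap ℂ (fun _ : Fin k => WeylAlgebra n) (Twisted σ))
    (v : Fin k → Fin n ⊕ Fin n → ℂ) : restrict σ (r • f) v = r • restrict σ f v := by
  simp only [restrict, smul_apply, map_smul, Finset.smul_sum]
  exact Finset.sum_congr rfl fun τ _ => smul_comm _ _ _

theorem ofVec_commutator (v w : Fin n ⊕ Fin n → ℂ) :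
    ofVec n v * ofVec n w - ofVec n w * ofVec n v ∈ Set.range (algebraMap ℂ (WeylAlgebra n)) := by
  have h1 : ∀ i j, moyal n (MvPolynomial.X i) (MvPolynomial.X j)
      - moyal n (MvPolynomial.X j) (MvPolynomial.X i)
      = -Matrix.J (Fin n) ℂ i j • (1 : WeylPoly n) := by
    intro i j
    have h2 : ham i (MvPolynomial.X j) = -Matrix.J (Fin n) ℂ i j • (1 : WeylPoly n) := by
      rw [ham_X, MvPolynomial.smul_eq_C_mul, mul_one]
    rw [X_moyal, moyal_X, h2]
    module
  refine ⟨∑ i, ∑ j, v i * (w j * -Matrix.J (Fin n) ℂ i j), ?_⟩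
  rw [Algebra.algebraMap_eq_smul_one]
  change (∑ i, ∑ j, v i * (w j * -Matrix.J (Fin n) ℂ i j)) • (1 : WeylPoly n)
    = moyal n (lin n v) (lin n w) - (moyal n).flip (lin n v) (lin n w)
  rw [← LinearMap.sub_apply, ← LinearMap.sub_apply]
  simp only [lin_apply, map_sum, map_smul, LinearMap.sum_apply, LinearMap.smul_apply,
    LinearMap.sub_apply, LinearMap.flip_apply, Finset.sum_smul, mul_smul, ← h1, smul_sub,
    Finset.sum_sub_distrib, Finset.smul_sum]
  congr 1 <;>
  · rw [Finset.sum_comm]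
    exact Finset.sum_congr rfl fun i _ => Finset.sum_congr rfl fun j _ => smul_comm _ _ _

/-- A coboundary cannot take the value `1` at eigenvectors with eigenvalues different from `1`: its
value lies in the sum of the images of the twisted commutators. -/
theorem restrict_ne_one_of_mem_coboundaries (hg : ∀ l, toEnd σ (g.1.col l) = c l • g.1.col l)
    (hc : ∀ l, c l * c l.swap = 1) : ∀ {q : ℕ} (e : Fin q → Fin n ⊕ Fin n), (∀ i, c (e i) ≠ 1) →
    ∀ f ∈ Hochschild.coboundaries (cochains σ) q, restrict σ f (fun i => g.1.col (e i)) ≠ 1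
  | 0, e, _, f, hf => by
    obtain rfl : f = 0 := (Submodule.mem_bot ℂ).mp hf
    have h := restrict_smul (σ := σ) 0 0 (fun i => g.1.col (e i))
    rw [zero_smul, zero_smul] at h
    rw [h]
    exact zero_ne_one (α := WeylPoly n)
  | q + 1, e, he, _, ⟨f, hf, rfl⟩ => by
    intro h
    let P : Equiv.Perm (Fin (q + 1)) → WeylPoly n := fun τ => (ofPoly n).symm ((act g).symm
      ((TwistedBimodule.of (act σ)).symm (f fun i => ofVec n (g.1.col (e (τ i.succ))))))
    have hP : ∀ τ, f (fun i => ofVec n (g.1.col (e (τ i.succ))))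
        = TwistedBimodule.of (act σ) (act g (ofPoly n (P τ))) := fun τ => by
      rw [LinearEquiv.apply_symm_apply, AlgEquiv.apply_symm_apply, LinearEquiv.apply_symm_apply]
    have h1 := congrArg (TwistedBimodule.of (act σ)).symm (Hochschild.sum_sign_smul_d hf
      (fun i => ofVec n (g.1.col (e i))) fun i j => ofVec_commutator _ _)
    rw [map_sum] at h1
    simp only [map_smul, hP, TwistedBimodule.smul_of, TwistedBimodule.op_smul_of, map_sum] at h1
    have h2 : restrict σ (Hochschild.d ℂ (WeylAlgebra n) (Twisted σ) q f)
        (fun i => g.1.col (e i)) = act g (ofPoly n (∑ τ : Equiv.Perm (Fin (q + 1)),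
          ((Equiv.Perm.sign τ : ℤ) : ℂ) • twistComm c (e (τ 0)) (P τ))) := by
      refine h1.trans ?_
      simp only [map_sum, map_smul]
      refine Finset.sum_congr rfl fun τ _ => ?_
      rw [act_twistComm hg]
      rfl
    rw [h2, ← map_one (act g)] at h
    have h3 := (ofPoly n).injective ((act g).injective h : _ = ofPoly n 1)
    -- the terms are collected according to the first eigenvector
    have h4 : ∀ τ ∈ (Finset.univ : Finset (Equiv.Perm (Fin (q + 1)))), e (τ 0) ∈ movedCoords c :=
      fun τ _ => mem_movedCoords.mpr (he _)
    refine one_ne_sum_twistComm hc (movedCoords c) (fun l hl => mem_movedCoords.mp hl) Set.univ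
      (Set.subset_univ _) (fun l => ∑ τ : Equiv.Perm (Fin (q + 1)) with e (τ 0) = l,
        ((Equiv.Perm.sign τ : ℤ) : ℂ) • P τ) (fun l _ => ?_) ?_
    · rw [polyIn_univ]
      trivial
    · rw [← h3, ← Finset.sum_fiberwise_of_maps_to h4]
      refine Finset.sum_congr rfl fun l _ => ?_
      rw [map_sum]
      refine Finset.sum_congr rfl fun τ hτ => ?_
      rw [map_smul, (Finset.mem_filter.mp hτ).2]

/-- There is a cocycle that restricts to the volume form, and every such cocycle is not a coboundary
and spans the cohomology in its degree. In other degrees all cocycles are coboundaries. -/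
theorem exists_restrict_eq_volumeForm (hσ : IsDiagonalizable σ) :
    (∃ Ω ∈ Hochschild.cocycles (cochains σ) (2 * halfDim σ), ∀ v, restrict σ Ω v
      = algebraMap ℂ (WeylAlgebra n) (volumeForm σ hσ v)) ∧
    (∀ Ω ∈ Hochschild.cocycles (cochains σ) (2 * halfDim σ), (∀ v, restrict σ Ω v
      = algebraMap ℂ (WeylAlgebra n) (volumeForm σ hσ v)) →
      Ω ∉ Hochschild.coboundaries (cochains σ) (2 * halfDim σ) ∧
      ∀ f ∈ Hochschild.cocycles (cochains σ) (2 * halfDim σ), ∃ a : ℂ,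
        f - a • Ω ∈ Hochschild.coboundaries (cochains σ) (2 * halfDim σ)) ∧
    ∀ k, k ≠ 2 * halfDim σ → Hochschild.cocycles (cochains σ) k
      ≤ Hochschild.coboundaries (cochains σ) k := by
  obtain ⟨g, c, hg, hc⟩ := exists_eigenbasis hσ
  obtain ⟨Ω₀, e, hΩ₀, he, hr, hv, hk, hspan⟩ := exists_generator hg hc
  obtain ⟨κ, hκ, hvol⟩ := volumeForm_eq_det hg hc hσ he hr
  refine ⟨⟨κ • Ω₀, Submodule.smul_mem _ κ hΩ₀, fun v => ?_⟩, fun Ω hΩ hΩv => ?_, hk⟩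
  -- the signs cancel because the number of moved coordinates is even
  · have h1 : ∀ w : Fin (2 * halfDim σ) → Fin n ⊕ Fin n → ℂ,
        ∏ i, -coord g (e i) (w i) = ∏ i, coord g (e i) (w i) := by
      intro w
      rw [Finset.prod_neg, Finset.card_univ, Fintype.card_fin, pow_mul, neg_one_sq, one_pow,
        one_mul]
    rw [restrict_smul, restrict, hvol, Algebra.algebraMap_eq_smul_one, mul_smul, Finset.sum_smul]
    congr 1
    refine Finset.sum_congr rfl fun τ _ => ?_
    rw [hv (fun i => v (τ i)), h1 (fun i => v (τ i)), map_smul, LinearEquiv.symm_apply_apply,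
      mul_smul]
  · have hΩB : Ω ∉ Hochschild.coboundaries (cochains σ) (2 * halfDim σ) := by
      intro h
      refine restrict_ne_one_of_mem_coboundaries hg hc e (fun i => (hr _).mp ⟨i, rfl⟩) (κ⁻¹ • Ω)
        (Submodule.smul_mem _ _ h) ?_
      -- at the moved eigenvectors the volume form is `κ`
      have h1 : ∑ τ : Equiv.Perm (Fin (2 * halfDim σ)), ((Equiv.Perm.sign τ : ℤ) : ℂ) *
          ∏ i, coord g (e i) (g.1.col (e (τ i))) = 1 := by
        rw [Finset.sum_eq_single 1]
        · simp [coord_col]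
        · intro τ _ hτ
          obtain ⟨i, hi⟩ := not_forall.mp fun h => hτ (Equiv.ext h)
          rw [Finset.prod_eq_zero (Finset.mem_univ i), mul_zero]
          rw [coord_col, if_neg]
          exact fun h => hi (he h).symm
        · exact fun h => (h (Finset.mem_univ _)).elim
      rw [restrict_smul, hΩv, hvol, h1, mul_one, Algebra.algebraMap_eq_smul_one, smul_smul,
        inv_mul_cancel₀ hκ, one_smul]
    refine ⟨hΩB, fun f hf => ?_⟩
    obtain ⟨b, hb⟩ := hspan Ω hΩ
    obtain ⟨a, ha⟩ := hspan f hf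
    have hb0 : b ≠ 0 := by
      rintro rfl
      rw [zero_smul, sub_zero] at hb
      exact hΩB hb
    refine ⟨a * b⁻¹, ?_⟩
    have h := sub_mem ha (Submodule.smul_mem _ (a * b⁻¹) hb)
    rw [smul_sub, smul_smul, mul_assoc, inv_mul_cancel₀ hb0, mul_one] at h
    convert h using 1
    abel

/-! ### Averaging over a finite group -/

/-- The action `f ↦ s ∘ f ∘ s⁻¹` of a symplectic map on cochains. -/
def actCochain (σ s : Matrix.symplecticGroup (Fin n) ℂ) (k : ℕ) :
    Module.End ℂ (MultilinearMap ℂ (fun _ : Fin k => WeylAlgebra n) (Twisted σ)) where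
  toFun f := ((TwistedBimodule.of (act σ)).toLinearMap ∘ₗ (act s).toLinearMap ∘ₗ
    (TwistedBimodule.of (act σ)).symm.toLinearMap).compMultilinearMap
      (f.compLinearMap fun _ => (actHom s⁻¹).toLinearMap)
  map_add' f f' := by
    ext a
    exact congrArg (TwistedBimodule.of (act σ)) (map_add (act s) _ _)
  map_smul' r f := by
    ext a
    exact congrArg (TwistedBimodule.of (act σ)) (map_smul (act s) r _)

theorem actCochain_apply (s : Matrix.symplecticGroup (Fin n) ℂ) {k : ℕ}
    (f : MultilinearMap ℂ (fun _ : Fin k => WeylAlgebra n) (Twisted σ))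
    (a : Fin k → WeylAlgebra n) : actCochain σ s k f a = TwistedBimodule.of (act σ)
      (act s ((TwistedBimodule.of (act σ)).symm (f fun i => act s⁻¹ (a i)))) := rfl

theorem act_mul (s t : Matrix.symplecticGroup (Fin n) ℂ) (a : WeylAlgebra n) :
    act (s * t) a = act s (act t a) := actHom_mul s t a

theorem act_act_inv (s : Matrix.symplecticGroup (Fin n) ℂ) (a : WeylAlgebra n) :
    act s (act s⁻¹ a) = a := (act s).apply_symm_apply a

theorem actCochain_mul (s t : Matrix.symplecticGroup (Fin n) ℂ) {k : ℕ}
    (f : MultilinearMap ℂ (fun _ : Fin k => WeylAlgebra n) (Twisted σ)) :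
    actCochain σ (s * t) k f = actCochain σ s k (actCochain σ t k f) := by
  ext a
  simp only [actCochain_apply, act_mul, mul_inv_rev, LinearEquiv.symm_apply_apply]

theorem actCochain_mem (s : Matrix.symplecticGroup (Fin n) ℂ) {k : ℕ}
    {f : MultilinearMap ℂ (fun _ : Fin k => WeylAlgebra n) (Twisted σ)} (hf : f ∈ cochains σ k) :
    actCochain σ s k f ∈ cochains σ k := by
  rintro a ⟨i, r, hr⟩
  rw [actCochain_apply, hf _ ⟨i, r, by rw [← hr, AlgEquiv.commutes]⟩, map_zero, map_zero, map_zero]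

theorem d_actCochain {s : Matrix.symplecticGroup (Fin n) ℂ} (hs : s * σ = σ * s) {k : ℕ}
    (f : MultilinearMap ℂ (fun _ : Fin k => WeylAlgebra n) (Twisted σ)) :
    Hochschild.d ℂ (WeylAlgebra n) (Twisted σ) k (actCochain σ s k f)
      = actCochain σ s (k + 1) (Hochschild.d ℂ (WeylAlgebra n) (Twisted σ) k f) := by
  refine Hochschild.d_natural (actHom s⁻¹) _ (fun a m => ?_) (fun a m => ?_) f
  · obtain ⟨b, rfl⟩ := (TwistedBimodule.of (act σ)).surjective m
    change TwistedBimodule.of (act σ) (act s (act s⁻¹ a * b))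
      = TwistedBimodule.of (act σ) (a * act s b)
    rw [map_mul, act_act_inv]
  · obtain ⟨b, rfl⟩ := (TwistedBimodule.of (act σ)).surjective m
    change TwistedBimodule.of (act σ) (act s (b * act σ (act s⁻¹ a)))
      = TwistedBimodule.of (act σ) (act s b * act σ a)
    rw [map_mul, ← act_mul, hs, act_mul, act_act_inv]

theorem restrict_actCochain (s : Matrix.symplecticGroup (Fin n) ℂ) {k : ℕ}
    (f : MultilinearMap ℂ (fun _ : Fin k => WeylAlgebra n) (Twisted σ))
    (v : Fin k → Fin n ⊕ Fin n → ℂ) :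
    restrict σ (actCochain σ s k f) v = act s (restrict σ f fun i => toEnd s⁻¹ (v i)) := by
  simp only [restrict, actCochain_apply, map_sum, map_smul, act_ofVec,
    LinearEquiv.symm_apply_apply]

/-- The average of a cochain over a finite group of symplectic maps. -/
def average (σ : Matrix.symplecticGroup (Fin n) ℂ)
    (S : Subgroup (Matrix.symplecticGroup (Fin n) ℂ)) [Fintype S] (k : ℕ) :
    Module.End ℂ (MultilinearMap ℂ (fun _ : Fin k => WeylAlgebra n) (Twisted σ)) :=
  (Fintype.card S : ℂ)⁻¹ • ∑ s : S, actCochain σ s.1 k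

section average

variable {S : Subgroup (Matrix.symplecticGroup (Fin n) ℂ)} [Fintype S] {k : ℕ}
  {f : MultilinearMap ℂ (fun _ : Fin k => WeylAlgebra n) (Twisted σ)}

theorem average_apply (f : MultilinearMap ℂ (fun _ : Fin k => WeylAlgebra n) (Twisted σ)) :
    average σ S k f = (Fintype.card S : ℂ)⁻¹ • ∑ s : S, actCochain σ s.1 k f := by
  rw [average, LinearMap.smul_apply, LinearMap.sum_apply]

theorem actCochain_average {t : Matrix.symplecticGroup (Fin n) ℂ} (ht : t ∈ S)
    (f : MultilinearMap ℂ (fun _ : Fin k => WeylAlgebra n) (Twisted σ)) :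
    actCochain σ t k (average σ S k f) = average σ S k f := by
  have h : ∑ s : S, actCochain σ (t * s.1) k f = ∑ s : S, actCochain σ s.1 k f :=
    Equiv.sum_comp (Equiv.mulLeft (⟨t, ht⟩ : S)) fun s : S => actCochain σ s.1 k f
  rw [average_apply, map_smul, map_sum, ← h]
  simp only [actCochain_mul]

theorem average_mem (hf : f ∈ cochains σ k) : average σ S k f ∈ invariantCochains σ S k := by
  refine ⟨?_, fun t ht a => ?_⟩
  · rw [average_apply]
    exact Submodule.smul_mem _ _ (Submodule.sum_mem _ fun s _ => actCochain_mem s.1 hf)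
  · rw [← LinearEquiv.symm_apply_apply (TwistedBimodule.of (act σ)) (act t _), ← actCochain_apply,
      actCochain_average ht]

theorem card_inv_smul_sum {E : Type*} [AddCommGroup E] [Module ℂ E] (F : S → E) (x : E)
    (h : ∀ s, F s = x) : (Fintype.card S : ℂ)⁻¹ • ∑ s : S, F s = x := by
  simp only [h, Finset.sum_const, Finset.card_univ]
  rw [← Nat.cast_smul_eq_nsmul ℂ, smul_smul, inv_mul_cancel₀, one_smul]
  exact Nat.cast_ne_zero.mpr Fintype.card_ne_zero

theorem average_of_mem (hf : f ∈ invariantCochains σ S k) : average σ S k f = f := by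
  rw [average_apply]
  refine card_inv_smul_sum _ _ fun s => ?_
  ext a
  rw [actCochain_apply, hf.2 s.1 s.2 a, LinearEquiv.apply_symm_apply]

theorem d_average (hS : ∀ s ∈ S, s * σ = σ * s)
    (f : MultilinearMap ℂ (fun _ : Fin k => WeylAlgebra n) (Twisted σ)) :
    Hochschild.d ℂ (WeylAlgebra n) (Twisted σ) k (average σ S k f)
      = average σ S (k + 1) (Hochschild.d ℂ (WeylAlgebra n) (Twisted σ) k f) := by
  rw [average_apply, average_apply, map_smul, map_sum]
  congr 1
  exact Finset.sum_congr rfl fun s _ => d_actCochain (hS s.1 s.2) f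

theorem average_mem_cocycles (hS : ∀ s ∈ S, s * σ = σ * s)
    (hf : f ∈ Hochschild.cocycles (cochains σ) k) :
    average σ S k f ∈ Hochschild.cocycles (invariantCochains σ S) k :=
  ⟨average_mem hf.1, by
    have h : Hochschild.d ℂ (WeylAlgebra n) (Twisted σ) k f = 0 := hf.2
    exact LinearMap.mem_ker.mpr (by rw [d_average hS, h, map_zero])⟩

theorem restrict_average (hS : ∀ s ∈ S, s * σ = σ * s) (hσ : IsDiagonalizable σ)
    {Ω : MultilinearMap ℂ (fun _ : Fin (2 * halfDim σ) => WeylAlgebra n) (Twisted σ)}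
    (hΩ : ∀ v, restrict σ Ω v = algebraMap ℂ (WeylAlgebra n) (volumeForm σ hσ v))
    (v : Fin (2 * halfDim σ) → Fin n ⊕ Fin n → ℂ) :
    restrict σ (average σ S _ Ω) v = algebraMap ℂ (WeylAlgebra n) (volumeForm σ hσ v) := by
  have h : ∀ F : S → MultilinearMap ℂ (fun _ : Fin (2 * halfDim σ) => WeylAlgebra n) (Twisted σ),
      restrict σ (∑ s, F s) v = ∑ s, restrict σ (F s) v := by
    intro F
    simp only [restrict, sum_apply, map_sum, Finset.smul_sum]
    exact Finset.sum_comm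
  rw [average_apply, restrict_smul, h]
  refine card_inv_smul_sum _ _ fun s => ?_
  rw [restrict_actCochain, hΩ, AlgEquiv.commutes, volumeForm_comp hσ (hS _ (inv_mem s.2))]

/-- A coboundary that is invariant is the coboundary of an invariant cochain. -/
theorem mem_coboundaries_invariantCochains (hS : ∀ s ∈ S, s * σ = σ * s) :
    ∀ {k : ℕ} {f : MultilinearMap ℂ (fun _ : Fin k => WeylAlgebra n) (Twisted σ)},
    f ∈ invariantCochains σ S k → f ∈ Hochschild.coboundaries (cochains σ) k →
    f ∈ Hochschild.coboundaries (invariantCochains σ S) k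
  | 0, _, _, hf => hf
  | k + 1, _, hf, ⟨h, hh, hd⟩ =>
    ⟨average σ S k h, average_mem hh, by rw [d_average hS, hd, average_of_mem hf]⟩

end average

end WeylAlgebra

/-! ### Cohomology spanned by one class -/

namespace Hochschild

variable {𝕜 A M : Type*} [Field 𝕜] [Ring A] [Algebra 𝕜 A] [AddCommGroup M] [Module 𝕜 M]
  [Module A M] [Module Aᵐᵒᵖ M] [IsScalarTower 𝕜 A M] [IsScalarTower 𝕜 Aᵐᵒᵖ M]
  {C : ∀ k, Submodule 𝕜 (MultilinearMap 𝕜 (fun _ : Fin k => A) M)} {k : ℕ}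

theorem cls_eq_zero_iff (f : cocycles C k) : cls C k f = 0 ↔ f.1 ∈ coboundaries C k :=
  Submodule.Quotient.mk_eq_zero _

theorem exists_smul_cls_eq {Ω : cocycles C k}
    (h : ∀ f ∈ cocycles C k, ∃ a : 𝕜, f - a • Ω.1 ∈ coboundaries C k) (x : Cohomology C k) :
    ∃ a : 𝕜, a • cls C k Ω = x := by
  obtain ⟨f, rfl⟩ := Submodule.mkQ_surjective _ x
  obtain ⟨a, ha⟩ := h f.1 f.2
  refine ⟨a, Eq.symm ?_⟩
  rw [← sub_eq_zero, ← map_smul, ← map_sub]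
  exact (cls_eq_zero_iff (f - a • Ω)).mpr ha

theorem span_cls_eq_top {Ω : cocycles C k}
    (h : ∀ f ∈ cocycles C k, ∃ a : 𝕜, f - a • Ω.1 ∈ coboundaries C k) :
    Submodule.span 𝕜 {cls C k Ω} = ⊤ :=
  eq_top_iff.mpr fun x _ => Submodule.mem_span_singleton.mpr (exists_smul_cls_eq h x)

theorem subsingleton_cohomology (h : cocycles C k ≤ coboundaries C k) :
    Subsingleton (Cohomology C k) :=
  Submodule.Quotient.subsingleton_iff.mpr (eq_top_iff.mpr fun f _ => h f.2)

end Hochschild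

/-! ### The cohomology of the twisted bimodules and its invariant part -/

theorem mainTheorem3 (n : ℕ) (σ : Matrix.symplecticGroup (Fin n) ℂ)
    (hσ : SymplecticMap.IsDiagonalizable σ) :
    -- the range of `σ - Id` has even dimension `2 k_σ`
    Module.finrank ℂ (SymplecticMap.movedSpace σ) = 2 * SymplecticMap.halfDim σ ∧
    -- the dimensions of the cohomology spaces
    Module.finrank ℂ
        (Hochschild.Cohomology (WeylAlgebra.cochains σ) (2 * SymplecticMap.halfDim σ)) = 1 ∧
    (∀ k : ℕ, k ≠ 2 * SymplecticMap.halfDim σ →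
      Subsingleton (Hochschild.Cohomology (WeylAlgebra.cochains σ) k)) ∧
    -- a spanning cocycle that restricts to the volume form
    (∃ Ω : Hochschild.cocycles (WeylAlgebra.cochains σ) (2 * SymplecticMap.halfDim σ),
      (∀ v, WeylAlgebra.restrict σ Ω.1 v
        = algebraMap ℂ (WeylAlgebra n) (SymplecticMap.volumeForm σ hσ v)) ∧
      Submodule.span ℂ {Hochschild.cls (WeylAlgebra.cochains σ) _ Ω} = ⊤) ∧
    -- invariance under a finite group that commutes with `σ`
    ∀ S : Subgroup (Matrix.symplecticGroup (Fin n) ℂ), Finite S → (∀ s ∈ S, s * σ = σ * s) →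
      (∀ k : ℕ, Function.Bijective
        (Hochschild.cohomologyMap (WeylAlgebra.invariantCochains_le σ S) k)) ∧
      ∃ Ω : Hochschild.cocycles (WeylAlgebra.cochains σ) (2 * SymplecticMap.halfDim σ),
        Ω.1 ∈ WeylAlgebra.invariantCochains σ S (2 * SymplecticMap.halfDim σ) ∧
        (∀ v, WeylAlgebra.restrict σ Ω.1 v
          = algebraMap ℂ (WeylAlgebra n) (SymplecticMap.volumeForm σ hσ v)) ∧
        Submodule.span ℂ {Hochschild.cls (WeylAlgebra.cochains σ) _ Ω} = ⊤ := by
  obtain ⟨g, c, hg, hc⟩ := SymplecticMap.exists_eigenbasis hσ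
  obtain ⟨⟨Ω, hΩ, hΩv⟩, hspan, hk⟩ := WeylAlgebra.exists_restrict_eq_volumeForm hσ
  refine ⟨SymplecticMap.finrank_movedSpace_eq hg hc,
    finrank_eq_one (Hochschild.cls _ _ ⟨Ω, hΩ⟩)
      (fun h => (hspan Ω hΩ hΩv).1 ((Hochschild.cls_eq_zero_iff _).mp h))
      (Hochschild.exists_smul_cls_eq (hspan Ω hΩ hΩv).2),
    fun k h => Hochschild.subsingleton_cohomology (hk k h),
    ⟨⟨Ω, hΩ⟩, hΩv, Hochschild.span_cls_eq_top (hspan Ω hΩ hΩv).2⟩, fun S hfin hS => ?_⟩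
  have := Fintype.ofFinite S
  have hΩS := WeylAlgebra.average_mem_cocycles hS hΩ
  have hΩS' : WeylAlgebra.average σ S _ Ω ∈ Hochschild.cocycles (WeylAlgebra.cochains σ) _ :=
    ⟨hΩS.1.1, hΩS.2⟩
  have hspanS := hspan _ hΩS' (WeylAlgebra.restrict_average hS hσ hΩv)
  refine ⟨fun k => ⟨?_, ?_⟩, ⟨_, hΩS'⟩, hΩS.1, WeylAlgebra.restrict_average hS hσ hΩv,
    Hochschild.span_cls_eq_top hspanS.2⟩
  · rw [injective_iff_map_eq_zero]
    intro x hx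
    obtain ⟨f, rfl⟩ := Submodule.mkQ_surjective _ x
    exact (Hochschild.cls_eq_zero_iff f).mpr
      (WeylAlgebra.mem_coboundaries_invariantCochains hS f.2.1
        ((Hochschild.cls_eq_zero_iff (C := WeylAlgebra.cochains σ) ⟨f.1, f.2.1.1, f.2.2⟩).mp hx))
  · intro x
    by_cases h : k = 2 * SymplecticMap.halfDim σ
    · subst h
      obtain ⟨a, rfl⟩ := Hochschild.exists_smul_cls_eq (Ω := ⟨_, hΩS'⟩) hspanS.2 x
      exact ⟨a • Hochschild.cls _ _ ⟨_, hΩS⟩, map_smul _ _ _⟩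
    · have := Hochschild.subsingleton_cohomology (hk k h)
      exact ⟨0, Subsingleton.elim _ _⟩
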